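/- Let $\mathsf B$ be a cartesian closed category and let $\mathsf p:\mathsf E\to\mathsf B$ be a split fibration (a fibration with a chosen cleavage $u\mapsto u^*$ that is strictly functorial). Suppose that $\mathsf p$ has simple coproducts and simple products, i.e. every weakening functor $\pi_I^*:\mathsf E_I\to\mathsf E_{I\times X}$ has a left adjoint $\coprod_{\pi_I}$ and a right adjoint $\prod_{\pi_I}$, both satisfying the Beck--Chevalley condition (the canonical comparison arrows are isomorphisms) for the pullback squares of projections $\pi_J:J\times X\to J$ along arrows $f:I\to J$. Then the following are equivalent. 1. There are a split fibration $\mathsf p':\mathsf E'\to\mathsf B$ and an equivalence of fibrations $\mathfrak{Dial}(\mathsf p')\simeq\mathsf p$ over $\mathsf B$. 2. $\mathsf p$ is a Gödel fibration. Here the terms are as follows. *Dialectica construction.* The objects of the total category of $\mathfrak{Dial}(\mathsf p')$ are quadruples $(I,X,U,\alpha)$ with $I,X,U\in\mathsf B$ and $\alpha\in\mathsf E'_{I\times X\times U}$. A morphism $(I,X,U,\alpha)\to(J,Y,V,\beta)$ is a quadruple $(f,f_0,f_1,\phi)$ with $f:I\to J$, $f_0:I\times X\to Y$, $f_1:I\times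 X\times V\to U$ in $\mathsf B$ and a vertical arrow $\phi:\langle\pi_{I\times X},f_1\rangle^*\alpha\to(\langle f\pi_I,f_0\rangle\times 1_V)^*\beta$ over $I\times X\times V$, that is, $\phi:\alpha(i,x,f_1(i,x,v))\to\beta(f(i),f_0(i,x),v)$. Composition is by substitution, and the functor to $\mathsf B$ sends $(I,X,U,\alpha)$ to $I$. *Equivalence of fibrations over $\mathsf B$.* An equivalence of the total categories in which both functors commute with the projections to $\mathsf B$ and preserve cartesian arrows, and whose unit and counit are vertical. *Quantifier-free objects.* An object $\alpha\in\mathsf E_I$ is $\coprod$-quantifier-free if for all $f:A\to I$, all $B\in\mathsf B$, all $\beta\in\mathsf E_{A\times B}$ and every vertical $h:f^*\alpha\to\coprod_{\pi_A}\beta$ there is a unique pair $(g,\bar h)$, with $g:A\to B$ in $\mathsf B$ and $\bar h:f^*\alpha\to\langle 1_A,g\rangle^*\beta$ vertical, such that $h$ is the composite of $\bar h$ with $\langle 1_A,g\rangle^*\eta_\beta:\langle 1_A,g\rangle^*\beta\to\langle 1_A,g\rangle^*\pi_A^*\coprod_{\pi_A}\beta=\coprod_{\pi_A}\beta$, where $\eta$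 is the unit of $\coprod_{\pi_A}\dashv\pi_A^*$. The notion of $\prod$-quantifier-free object is the fibrewise dual: every vertical $h:\prod_{\pi_A}\beta\to f^*\alpha$ is, for a unique pair $(g,\bar h)$ with $g:A\to B$ and $\bar h:\langle 1_A,g\rangle^*\beta\to f^*\alpha$ vertical, the composite of $\langle 1_A,g\rangle^*\varepsilon_\beta:\prod_{\pi_A}\beta=\langle 1_A,g\rangle^*\pi_A^*\prod_{\pi_A}\beta\to\langle 1_A,g\rangle^*\beta$ with $\bar h$, where $\varepsilon$ is the counit of $\pi_A^*\dashv\prod_{\pi_A}$. A fibration has enough $\coprod$-quantifier-free objects if every $\alpha\in\mathsf E_I$ is isomorphic in $\mathsf E_I$ to $\coprod_{\pi_I}\beta$ for some $A$ and some $\coprod$-quantifier-free $\beta\in\mathsf E_{I\times A}$; enough $\prod$-quantifier-free objects is defined in the same way with $\prod_{\pi_I}$. *Gödel fibration.* $\mathsf p$ (with simple products and simple coproducts, over a cartesian closed base) is a Gödel fibration if it has enough $\coprod$-quantifier-free objects; if $\prod_{\pi}\alpha$ is $\coprod$-quantifier-free for every projection $\pi:J\times X\to J$ and every $\coprod$-quantifier-free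 $\alpha\in\mathsf E_{J\times X}$; and if the full sub-fibration of $\mathsf p$ on the $\coprod$-quantifier-free objects, which then has simple products, has enough $\prod$-quantifier-free objects, where $\prod$-quantifier-freeness is computed in this sub-fibration. -/

import Mathlib

open CategoryTheory MonoidalCategory CartesianMonoidalCategory

universe v₁ v₂ v₃ u₁ u₂ u₃

namespace DialecticaFib

section Cleavages

variable {B : Type u₁} [Category.{v₁} B] {E : Type u₂} [Category.{v₂} E]

/-- A split cleavage of a functor `p : E ⥤ B`: a choice of a cartesian lift `pull u Y ⟶ Y` of every
`u : I ⟶ J` and every object `Y` of the fibre over `J`, functorial in `u` on the nose.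
A functor together with such a choice is a (cloven and) split fibration. -/
structure SplitCleavage (p : E ⥤ B) where
  /-- the reindexed object `u^* Y` -/
  pull {I J : B} (u : I ⟶ J) (Y : p.Fiber J) : p.Fiber I
  /-- the chosen cartesian arrow `u^* Y ⟶ Y` over `u` -/
  cart {I J : B} (u : I ⟶ J) (Y : p.Fiber J) : (pull u Y).1 ⟶ Y.1
  isCartesian {I J : B} (u : I ⟶ J) (Y : p.Fiber J) : p.IsStronglyCartesian u (cart u Y)
  pull_id {J : B} (Y : p.Fiber J) : pull (𝟙 J) Y = Y
  pull_comp {I J K : B} (u : I ⟶ J) (v : J ⟶ K) (Y : p.Fiber K) :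
    pull (u ≫ v) Y = pull u (pull v Y)
  cart_id {J : B} (Y : p.Fiber J) :
    cart (𝟙 J) Y = eqToHom (congrArg Subtype.val (pull_id Y))
  cart_comp {I J K : B} (u : I ⟶ J) (v : J ⟶ K) (Y : p.Fiber K) :
    cart (u ≫ v) Y =
      eqToHom (congrArg Subtype.val (pull_comp u v Y)) ≫ cart u (pull v Y) ≫ cart v Y

namespace SplitCleavage

variable {p : E ⥤ B} (c : SplitCleavage p)

attribute [instance] SplitCleavage.isCartesian

/-- Vertical arrows into a reindexed object agree as soon as they agree after composition with the
chosen cartesian arrow. -/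
lemma vert_ext {I J : B} (u : I ⟶ J) {X : p.Fiber I} {Y : p.Fiber J} {φ ψ : X ⟶ c.pull u Y}
    (h : φ.1 ≫ c.cart u Y = ψ.1 ≫ c.cart u Y) : φ = ψ := by
  have := φ.2
  have := ψ.2
  exact Subtype.ext (Functor.IsStronglyCartesian.ext p u (c.cart u Y) (𝟙 I) h)

/-- The action of reindexing on vertical arrows: `u^* φ` is the unique vertical arrow making the
square with the two chosen cartesian arrows commute. -/
noncomputable def pullMap {I J : B} (u : I ⟶ J) {X Y : p.Fiber J} (φ : X ⟶ Y) :
    c.pull u X ⟶ c.pull u Y :=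
  have := φ.2
  ⟨Functor.IsStronglyCartesian.map p u (c.cart u Y) (g := 𝟙 I) (f' := u) (by simp)
    (c.cart u X ≫ φ.1), inferInstance⟩

lemma pullMap_cart {I J : B} (u : I ⟶ J) {X Y : p.Fiber J} (φ : X ⟶ Y) :
    (c.pullMap u φ).1 ≫ c.cart u Y = c.cart u X ≫ φ.1 := by
  have := φ.2
  exact Functor.IsStronglyCartesian.fac p u (c.cart u Y) (g := 𝟙 I) (f' := u) (by simp)
    (c.cart u X ≫ φ.1)

/-- The substitution functor `u^*` between fibres. -/
noncomputable def reindex {I J : B} (u : I ⟶ J) : p.Fiber J ⥤ p.Fiber I where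
  obj := c.pull u
  map φ := c.pullMap u φ
  map_id X := by
    apply c.vert_ext u
    rw [pullMap_cart]
    change c.cart u X ≫ 𝟙 _ = 𝟙 _ ≫ c.cart u X
    simp
  map_comp {X Y Z} φ ψ := by
    apply c.vert_ext u
    rw [pullMap_cart]
    change c.cart u X ≫ φ.1 ≫ ψ.1 = ((c.pullMap u φ).1 ≫ (c.pullMap u ψ).1) ≫ c.cart u Z
    rw [Category.assoc, pullMap_cart, ← Category.assoc, ← Category.assoc, pullMap_cart]

lemma eqToHom_val {I : B} {X Y : p.Fiber I} (h : X = Y) :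
    Subtype.val (eqToHom h) = eqToHom (congrArg Subtype.val h) := by
  subst h
  rfl

lemma reindex_obj_id {J : B} (Y : p.Fiber J) : (c.reindex (𝟙 J)).obj Y = Y := c.pull_id Y

lemma reindex_obj_comp {I J K : B} (u : I ⟶ J) (v : J ⟶ K) (Y : p.Fiber K) :
    (c.reindex (u ≫ v)).obj Y = (c.reindex u).obj ((c.reindex v).obj Y) := c.pull_comp u v Y

lemma reindex_map_cart {I J : B} (u : I ⟶ J) {X Y : p.Fiber J} (φ : X ⟶ Y) :
    Subtype.val ((c.reindex u).map φ) ≫ c.cart u Y = c.cart u X ≫ φ.1 := c.pullMap_cart u φ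

lemma reindex_map_congr {I J : B} {u v : I ⟶ J} (h : u = v) {X Y : p.Fiber J} (φ : X ⟶ Y) :
    (c.reindex u).map φ = eqToHom (by rw [h]) ≫ (c.reindex v).map φ ≫ eqToHom (by rw [h]) := by
  subst h
  simp

lemma reindex_map_id {J : B} {X Y : p.Fiber J} (φ : X ⟶ Y) :
    (c.reindex (𝟙 J)).map φ =
      eqToHom (c.reindex_obj_id X) ≫ φ ≫ eqToHom (c.reindex_obj_id Y).symm := by
  apply c.vert_ext (𝟙 J)
  change (c.pullMap (𝟙 J) φ).1 ≫ _ = (Subtype.val (eqToHom (c.pull_id X)) ≫ φ.1 ≫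
    Subtype.val (eqToHom (c.pull_id Y).symm)) ≫ _
  rw [pullMap_cart, eqToHom_val, eqToHom_val, cart_id, cart_id]
  simp

lemma reindex_map_comp {I J K : B} (u : I ⟶ J) (v : J ⟶ K) {X Y : p.Fiber K} (φ : X ⟶ Y) :
    (c.reindex (u ≫ v)).map φ = eqToHom (c.reindex_obj_comp u v X) ≫
      (c.reindex u).map ((c.reindex v).map φ) ≫ eqToHom (c.reindex_obj_comp u v Y).symm := by
  apply c.vert_ext (u ≫ v)
  change (c.pullMap (u ≫ v) φ).1 ≫ _ =
    (Subtype.val (eqToHom (c.pull_comp u v X)) ≫ (c.pullMap u (c.pullMap v φ)).1 ≫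
      Subtype.val (eqToHom (c.pull_comp u v Y).symm)) ≫ _
  rw [pullMap_cart, eqToHom_val, eqToHom_val, cart_comp, cart_comp]
  have h₁ := c.pullMap_cart u (c.pullMap v φ)
  have h₂ := c.pullMap_cart v φ
  simp only [Category.assoc, eqToHom_trans_assoc, eqToHom_refl, Category.id_comp]
  rw [← h₂, ← Category.assoc (c.pullMap u (c.pullMap v φ)).1, h₁]
  simp

lemma reindex_map_map {I J K : B} (u : I ⟶ J) (v : J ⟶ K) {X Y : p.Fiber K} (φ : X ⟶ Y) :
    (c.reindex u).map ((c.reindex v).map φ) = eqToHom (c.reindex_obj_comp u v X).symm ≫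
      (c.reindex (u ≫ v)).map φ ≫ eqToHom (c.reindex_obj_comp u v Y) := by
  simp [reindex_map_comp]

end SplitCleavage

end Cleavages

section Quantifiers

variable {B : Type u₁} [Category.{v₁} B] [CartesianMonoidalCategory B]
variable {E : Type u₂} [Category.{v₂} E] {p : E ⥤ B}

namespace SplitCleavage

variable (c : SplitCleavage p)

/-- The weakening functor `π_I^*`, reindexing along the projection `π_I : I × X ⟶ I`. -/
noncomputable abbrev weaken (I X : B) : p.Fiber I ⥤ p.Fiber (I ⊗ X) := c.reindex (fst I X)

lemma weaken_comm {I J : B} (f : I ⟶ J) (X : B) (Y : p.Fiber J) :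
    (c.reindex (f ▷ X)).obj ((c.reindex (fst J X)).obj Y) = (c.reindex (fst I X)).obj ((c.reindex f).obj Y) := by
  rw [← c.reindex_obj_comp, ← c.reindex_obj_comp, whiskerRight_fst]

lemma weaken_section {A X : B} (g : A ⟶ X) (Y : p.Fiber A) :
    (c.reindex (lift (𝟙 A) g)).obj ((c.reindex (fst A X)).obj Y) = Y := by
  rw [← c.reindex_obj_comp, lift_fst, c.reindex_obj_id]

/-- Simple coproducts: left adjoints to all weakening functors, satisfying the Beck-Chevalley
condition for the squares with sides `f × id_X : I × X ⟶ J × X` and `f : I ⟶ J`. -/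
structure SimpleCoproducts where
  coprod (I X : B) : p.Fiber (I ⊗ X) ⥤ p.Fiber I
  adj (I X : B) : coprod I X ⊣ c.weaken I X
  /-- The canonical arrow `∐_{π_I} (f × id)^* α ⟶ f^* ∐_{π_J} α`, the transpose of
  `(f × id)^* η_α`, is invertible. -/
  beckChevalley {I J : B} (f : I ⟶ J) (X : B) (α : p.Fiber (J ⊗ X)) :
    IsIso (((adj I X).homEquiv ((c.reindex (f ▷ X)).obj α) ((c.reindex f).obj ((coprod J X).obj α))).symm
      ((c.reindex (f ▷ X)).map ((adj J X).unit.app α) ≫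
        eqToHom (c.weaken_comm f X ((coprod J X).obj α))))

/-- Simple products: right adjoints to all weakening functors, satisfying the Beck-Chevalley
condition for the squares with sides `f × id_X : I × X ⟶ J × X` and `f : I ⟶ J`. -/
structure SimpleProducts where
  prod (I X : B) : p.Fiber (I ⊗ X) ⥤ p.Fiber I
  adj (I X : B) : c.weaken I X ⊣ prod I X
  /-- The canonical arrow `f^* ∏_{π_J} α ⟶ ∏_{π_I} (f × id)^* α`, the transpose of
  `(f × id)^* ε_α`, is invertible. -/
  beckChevalley {I J : B} (f : I ⟶ J) (X : B) (α : p.Fiber (J ⊗ X)) :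
    IsIso ((adj I X).homEquiv ((c.reindex f).obj ((prod J X).obj α)) ((c.reindex (f ▷ X)).obj α)
      (eqToHom (c.weaken_comm f X ((prod J X).obj α)).symm ≫
        (c.reindex (f ▷ X)).map ((adj J X).counit.app α)))

end SplitCleavage

namespace SplitCleavage.SimpleCoproducts

variable {c : SplitCleavage p} (C : c.SimpleCoproducts)

/-- Every vertical arrow `h : γ ⟶ ∐_{π_A} β` is, for a unique pair `(g, h')` of an arrow
`g : A ⟶ X` of the base and a vertical arrow `h' : γ ⟶ ⟨1_A, g⟩^* β`, the composite
`γ ⟶ ⟨1_A, g⟩^* β ⟶ ⟨1_A, g⟩^* π_A^* ∐_{π_A} β = ∐_{π_A} β`, whose second arrow is the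
reindexed unit. -/
def Witnessed {A : B} (γ : p.Fiber A) : Prop :=
  ∀ (X : B) (β : p.Fiber (A ⊗ X)) (h : γ ⟶ (C.coprod A X).obj β),
    ∃! x : (g : A ⟶ X) × (γ ⟶ (c.reindex (lift (𝟙 A) g)).obj β),
      h = x.2 ≫ (c.reindex (lift (𝟙 A) x.1)).map ((C.adj A X).unit.app β) ≫
        eqToHom (c.weaken_section x.1 ((C.coprod A X).obj β))

/-- `α` is `∐`-quantifier-free: all its reindexings have the unique witness property. -/
def QuantifierFree {I : B} (α : p.Fiber I) : Prop :=
  ∀ (A : B) (f : A ⟶ I), C.Witnessed ((c.reindex f).obj α)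

/-- Enough `∐`-quantifier-free objects: every object of every fibre is isomorphic, in that fibre, to
some `∐_{π_I} β` with `β` being `∐`-quantifier-free. -/
def Enough : Prop :=
  ∀ (I : B) (α : p.Fiber I), ∃ (A : B) (β : p.Fiber (I ⊗ A)),
    C.QuantifierFree β ∧ Nonempty (α ≅ (C.coprod I A).obj β)

lemma QuantifierFree.pull {C : c.SimpleCoproducts} {I J : B} {α : p.Fiber J}
    (h : C.QuantifierFree α) (u : I ⟶ J) : C.QuantifierFree ((c.reindex u).obj α) := by
  intro A f
  rw [← c.reindex_obj_comp]
  exact h A (f ≫ u)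

/-- The property of objects of the total category of being `∐`-quantifier-free (in their fibre). -/
def qf : ObjectProperty E := fun X => C.QuantifierFree (I := p.obj X) ⟨X, rfl⟩

lemma qf_iff {I : B} (α : p.Fiber I) : C.qf α.1 ↔ C.QuantifierFree α := by
  obtain ⟨X, rfl⟩ := α
  exact Iff.rfl

/-- The full sub-fibration of `p` on the `∐`-quantifier-free objects. -/
abbrev sub : C.qf.FullSubcategory ⥤ B := C.qf.ι ⋙ p

/-- An object of a fibre of the sub-fibration, seen in the corresponding fibre of `p`. -/
def subIncl {I : B} (Y : C.sub.Fiber I) : p.Fiber I := ⟨Y.1.1, Y.2⟩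

/-- A `∐`-quantifier-free object of a fibre of `p`, seen in the fibre of the sub-fibration. -/
def subMk {I : B} (α : p.Fiber I) (h : C.QuantifierFree α) : C.sub.Fiber I :=
  ⟨⟨α.1, (C.qf_iff α).2 h⟩, α.2⟩

lemma subIncl_qf {I : B} (Y : C.sub.Fiber I) : C.QuantifierFree (C.subIncl Y) :=
  (C.qf_iff (C.subIncl Y)).1 Y.1.2

lemma subIncl_injective {I : B} : Function.Injective (C.subIncl (I := I)) := by
  rintro ⟨⟨X, hX⟩, h⟩ ⟨⟨Y, hY⟩, h'⟩ e
  have : X = Y := congrArg Subtype.val e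
  subst this
  rfl

lemma sub_isHomLift {I J : B} (u : I ⟶ J) {X Y : C.qf.FullSubcategory} (φ : X ⟶ Y) :
    C.sub.IsHomLift u φ ↔ p.IsHomLift u φ.hom := by
  constructor
  · intro h
    exact IsHomLift.of_fac p u φ.hom (IsHomLift.domain_eq C.sub u φ)
      (IsHomLift.codomain_eq C.sub u φ) (IsHomLift.fac C.sub u φ)
  · intro h
    exact IsHomLift.of_fac C.sub u φ (IsHomLift.domain_eq p u φ.hom)
      (IsHomLift.codomain_eq p u φ.hom) (IsHomLift.fac p u φ.hom)

lemma sub_eqToHom_hom {X Y : C.qf.FullSubcategory} (h : X = Y) :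
    (eqToHom h).hom = eqToHom (congrArg ObjectProperty.FullSubcategory.obj h) := by
  subst h
  rfl

/-- The sub-fibration of `∐`-quantifier-free objects, with the cleavage of `p`. -/
def subCleavage : SplitCleavage C.sub where
  pull u Y := C.subMk (c.pull u (C.subIncl Y)) ((C.subIncl_qf Y).pull u)
  cart u Y := ⟨c.cart u (C.subIncl Y)⟩
  isCartesian {I J} u Y := by
    have : C.sub.IsHomLift u (⟨c.cart u (C.subIncl Y)⟩ :
        (C.subMk (c.pull u (C.subIncl Y)) ((C.subIncl_qf Y).pull u)).1 ⟶ Y.1) :=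
      (C.sub_isHomLift u _).2 (c.isCartesian u (C.subIncl Y)).toIsHomLift
    refine ⟨?_⟩
    intro Z g φ hφ
    have : p.IsHomLift (g ≫ u) φ.hom := (C.sub_isHomLift (g ≫ u) φ).1 hφ
    obtain ⟨χ, ⟨h₁, h₂⟩, h₃⟩ := @Functor.IsStronglyCartesian.universal_property' _ _ _ _ p
      _ _ _ _ u (c.cart u (C.subIncl Y)) _ Z.obj g φ.hom this
    refine ⟨⟨χ⟩, ⟨(C.sub_isHomLift _ _).2 h₁, ?_⟩, ?_⟩
    · ext
      exact h₂
    · rintro ψ ⟨k₁, k₂⟩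
      ext
      exact h₃ ψ.hom ⟨(C.sub_isHomLift _ _).1 k₁, congrArg (fun t => t.hom) k₂⟩
  pull_id Y := C.subIncl_injective (c.pull_id (C.subIncl Y))
  pull_comp u v Y := C.subIncl_injective (c.pull_comp u v (C.subIncl Y))
  cart_id Y := by
    ext
    rw [sub_eqToHom_hom]
    exact c.cart_id (C.subIncl Y)
  cart_comp u v Y := by
    ext
    rw [ObjectProperty.FullSubcategory.comp_hom,
      ObjectProperty.FullSubcategory.comp_hom, sub_eqToHom_hom]
    exact c.cart_comp u v (C.subIncl Y)

end SplitCleavage.SimpleCoproducts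

namespace SplitCleavage.SimpleProducts

variable {c : SplitCleavage p} (P : c.SimpleProducts)

/-- Every vertical arrow `h : ∏_{π_A} β ⟶ γ` is, for a unique pair `(g, h')` of an arrow
`g : A ⟶ X` of the base and a vertical arrow `h' : ⟨1_A, g⟩^* β ⟶ γ`, the composite
`∏_{π_A} β = ⟨1_A, g⟩^* π_A^* ∏_{π_A} β ⟶ ⟨1_A, g⟩^* β ⟶ γ`, whose first arrow is the
reindexed counit. -/
def CoWitnessed {A : B} (γ : p.Fiber A) : Prop :=
  ∀ (X : B) (β : p.Fiber (A ⊗ X)) (h : (P.prod A X).obj β ⟶ γ),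
    ∃! x : (g : A ⟶ X) × ((c.reindex (lift (𝟙 A) g)).obj β ⟶ γ),
      h = eqToHom (c.weaken_section x.1 ((P.prod A X).obj β)).symm ≫
        (c.reindex (lift (𝟙 A) x.1)).map ((P.adj A X).counit.app β) ≫ x.2

/-- `α` is `∏`-quantifier-free. -/
def QuantifierFree {I : B} (α : p.Fiber I) : Prop :=
  ∀ (A : B) (f : A ⟶ I), P.CoWitnessed ((c.reindex f).obj α)

/-- Enough `∏`-quantifier-free objects: every object of every fibre is isomorphic, in that fibre, to
some `∏_{π_I} β` with `β` being `∏`-quantifier-free. -/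
def Enough : Prop :=
  ∀ (I : B) (α : p.Fiber I), ∃ (A : B) (β : p.Fiber (I ⊗ A)),
    P.QuantifierFree β ∧ Nonempty (α ≅ (P.prod I A).obj β)

end SplitCleavage.SimpleProducts

namespace SplitCleavage

variable {c : SplitCleavage p}

/-- A split fibration with simple products and simple coproducts over a cartesian closed base is a
Skolem fibration if it has enough `∐`-quantifier-free objects and these are stable under simple
products. -/
structure IsSkolem [MonoidalClosed B] (P : c.SimpleProducts) (C : c.SimpleCoproducts) : Prop where
  enough : C.Enough
  stable {I X : B} (α : p.Fiber (I ⊗ X)) (h : C.QuantifierFree α) :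
    C.QuantifierFree ((P.prod I X).obj α)

/-- A Gödel fibration is a Skolem fibration whose sub-fibration of `∐`-quantifier-free objects, with
its simple products (which are unique up to canonical isomorphism), has enough `∏`-quantifier-free
objects. -/
structure IsGodel [MonoidalClosed B] (P : c.SimpleProducts) (C : c.SimpleCoproducts) : Prop
    extends IsSkolem P C where
  enough_sub : ∃ P' : C.subCleavage.SimpleProducts, P'.Enough

end SplitCleavage

end Quantifiers

section Dialectica

variable {B : Type u₁} [Category.{v₁} B] [CartesianMonoidalCategory B]
variable {E : Type u₂} [Category.{v₂} E] {p : E ⥤ B}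

/-- Objects `(I, X, U, α)` of the Dialectica category of `p`, with `α` in the fibre over
`I × X × U`. -/
structure Dial (c : SplitCleavage p) where
  ctx : B
  wit : B
  ctr : B
  pred : p.Fiber ((ctx ⊗ wit) ⊗ ctr)

namespace Dial

variable {c : SplitCleavage p}

/-- The arrow `(i, x) ↦ (f(i), f₀(i, x))`. -/
def subst {I J X Y : B} (f : I ⟶ J) (f₀ : I ⊗ X ⟶ Y) : I ⊗ X ⟶ J ⊗ Y :=
  lift (fst I X ≫ f) f₀

@[simp]
lemma subst_fst {I J X Y : B} (f : I ⟶ J) (f₀ : I ⊗ X ⟶ Y) :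
    subst f f₀ ≫ fst J Y = fst I X ≫ f := by simp [subst]

@[simp]
lemma subst_snd {I J X Y : B} (f : I ⟶ J) (f₀ : I ⊗ X ⟶ Y) :
    subst f f₀ ≫ snd J Y = f₀ := by simp [subst]

@[simp]
lemma subst_id (I X : B) : subst (𝟙 I) (snd I X) = 𝟙 (I ⊗ X) := by ext <;> simp

lemma subst_comp {I J K X Y Z : B} (f : I ⟶ J) (f₀ : I ⊗ X ⟶ Y) (g : J ⟶ K) (g₀ : J ⊗ Y ⟶ Z) :
    subst (f ≫ g) (subst f f₀ ≫ g₀) = subst f f₀ ≫ subst g g₀ := by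
  apply CartesianMonoidalCategory.hom_ext
  · rw [subst_fst, Category.assoc, subst_fst, ← Category.assoc, ← Category.assoc, subst_fst]
  · rw [subst_snd, Category.assoc, subst_snd]

/-- Morphisms `(f, f₀, f₁, φ) : (I, X, U, α) ⟶ (J, Y, V, β)`, where `φ` is a vertical arrow
`α(i, x, f₁(i, x, v)) ⟶ β(f(i), f₀(i, x), v)` over `I × X × V`. -/
structure Hom (S T : Dial c) where
  base : S.ctx ⟶ T.ctx
  fwd : S.ctx ⊗ S.wit ⟶ T.wit
  bwd : (S.ctx ⊗ S.wit) ⊗ T.ctr ⟶ S.ctr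
  vert : (c.reindex (lift (fst (S.ctx ⊗ S.wit) T.ctr) bwd)).obj S.pred ⟶
    (c.reindex (subst base fwd ▷ T.ctr)).obj T.pred

lemma Hom.ext' {S T : Dial c} {F G : Hom S T} (h₁ : F.base = G.base) (h₂ : F.fwd = G.fwd)
    (h₃ : F.bwd = G.bwd)
    (h₄ : F.vert = eqToHom (by rw [h₃]) ≫ G.vert ≫ eqToHom (by rw [h₁, h₂])) : F = G := by
  obtain ⟨a, b, d, e⟩ := F
  obtain ⟨a', b', d', e'⟩ := G
  dsimp only at h₁ h₂ h₃
  subst h₁ h₂ h₃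
  simpa using h₄

/-- The arrow `(i, x) ↦ (f(i), f₀(i, x))`. -/
abbrev Hom.sub {S T : Dial c} (F : Hom S T) : S.ctx ⊗ S.wit ⟶ T.ctx ⊗ T.wit :=
  subst F.base F.fwd

/-- The arrow `(i, x, w) ↦ (i, x, g₁(f(i), f₀(i, x), w))`. -/
abbrev Hom.mid {S T R : Dial c} (F : Hom S T) (G : Hom T R) :
    (S.ctx ⊗ S.wit) ⊗ R.ctr ⟶ (S.ctx ⊗ S.wit) ⊗ T.ctr :=
  lift (fst _ _) (F.sub ▷ R.ctr ≫ G.bwd)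

/-- The identity morphism `(1, π_X, π_U, 1)`. -/
noncomputable def Hom.id (S : Dial c) : Hom S S where
  base := 𝟙 _
  fwd := snd _ _
  bwd := snd _ _
  vert := eqToHom (by simp)

lemma Hom.comp_eq₁ {S T R : Dial c} (F : Hom S T) (G : Hom T R) :
    (c.reindex (lift (fst (S.ctx ⊗ S.wit) R.ctr) (F.mid G ≫ F.bwd))).obj S.pred =
      (c.reindex (F.mid G)).obj
        ((c.reindex (lift (fst (S.ctx ⊗ S.wit) T.ctr) F.bwd)).obj S.pred) := by
  rw [← c.reindex_obj_comp, comp_lift, lift_fst]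

lemma Hom.comp_eq₂ {S T R : Dial c} (F : Hom S T) (G : Hom T R) :
    (c.reindex (F.mid G)).obj ((c.reindex (F.sub ▷ T.ctr)).obj T.pred) =
      (c.reindex (F.sub ▷ R.ctr)).obj
        ((c.reindex (lift (fst (T.ctx ⊗ T.wit) R.ctr) G.bwd)).obj T.pred) := by
  rw [← c.reindex_obj_comp, ← c.reindex_obj_comp, comp_lift, whiskerRight_fst, lift_whiskerRight]

lemma Hom.comp_eq₃ {S T R : Dial c} (F : Hom S T) (G : Hom T R) :
    (c.reindex (F.sub ▷ R.ctr)).obj ((c.reindex (G.sub ▷ R.ctr)).obj R.pred) =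
      (c.reindex (subst (F.base ≫ G.base) (F.sub ≫ G.fwd) ▷ R.ctr)).obj R.pred := by
  rw [← c.reindex_obj_comp, subst_comp, comp_whiskerRight]

/-- The composite of `F = (f, f₀, f₁, φ)` and `G = (g, g₀, g₁, ψ)`, with components `g(f(i))`,
`g₀(f(i), f₀(i, x))` and `f₁(i, x, g₁(f(i), f₀(i, x), w))`, and with last component the composite
`α(i, x, f₁(i, x, g₁(f(i), f₀(i, x), w))) ⟶ β(f(i), f₀(i, x), g₁(f(i), f₀(i, x), w)) ⟶
γ(g(f(i)), g₀(f(i), f₀(i, x)), w)` of the reindexings of `φ` and `ψ`. -/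
noncomputable def Hom.comp {S T R : Dial c} (F : Hom S T) (G : Hom T R) : Hom S R where
  base := F.base ≫ G.base
  fwd := F.sub ≫ G.fwd
  bwd := F.mid G ≫ F.bwd
  vert := eqToHom (F.comp_eq₁ G) ≫ (c.reindex (F.mid G)).map F.vert ≫
    eqToHom (F.comp_eq₂ G) ≫ (c.reindex (F.sub ▷ R.ctr)).map G.vert ≫ eqToHom (F.comp_eq₃ G)

@[simp]
lemma Hom.id_base (S : Dial c) : (Hom.id S).base = 𝟙 S.ctx := rfl

@[simp]
lemma Hom.id_fwd (S : Dial c) : (Hom.id S).fwd = snd S.ctx S.wit := rfl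

@[simp]
lemma Hom.id_bwd (S : Dial c) : (Hom.id S).bwd = snd (S.ctx ⊗ S.wit) S.ctr := rfl

lemma Hom.id_vert (S : Dial c) : (Hom.id S).vert =
    eqToHom (show (c.reindex (lift (fst (S.ctx ⊗ S.wit) S.ctr) (Hom.id S).bwd)).obj S.pred =
      (c.reindex ((Hom.id S).sub ▷ S.ctr)).obj S.pred by
        rw [id_bwd, Hom.sub, id_base, id_fwd, subst_id]; simp) := rfl

@[simp]
lemma Hom.comp_base {S T R : Dial c} (F : Hom S T) (G : Hom T R) :
    (F.comp G).base = F.base ≫ G.base := rfl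

@[simp]
lemma Hom.comp_fwd {S T R : Dial c} (F : Hom S T) (G : Hom T R) :
    (F.comp G).fwd = F.sub ≫ G.fwd := rfl

@[simp]
lemma Hom.comp_bwd {S T R : Dial c} (F : Hom S T) (G : Hom T R) :
    (F.comp G).bwd = F.mid G ≫ F.bwd := rfl

lemma Hom.comp_vert {S T R : Dial c} (F : Hom S T) (G : Hom T R) :
    (F.comp G).vert =
      eqToHom (show (c.reindex (lift (fst (S.ctx ⊗ S.wit) R.ctr) (F.comp G).bwd)).obj S.pred = _
        from F.comp_eq₁ G) ≫ (c.reindex (F.mid G)).map F.vert ≫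
      eqToHom (F.comp_eq₂ G) ≫ (c.reindex (F.sub ▷ R.ctr)).map G.vert ≫
      eqToHom (show _ = (c.reindex ((F.comp G).sub ▷ R.ctr)).obj R.pred from F.comp_eq₃ G) := rfl

lemma Hom.id_comp {S T : Dial c} (F : Hom S T) : (Hom.id S).comp F = F := by
  have h₀ : (Hom.id S).sub = 𝟙 _ := subst_id ..
  have h : (Hom.id S).sub ▷ T.ctr = 𝟙 _ := by rw [h₀, id_whiskerRight]
  refine Hom.ext' (by simp) (by rw [comp_fwd, h₀, Category.id_comp])
    (by rw [comp_bwd, Hom.mid, h, id_bwd]; simp) ?_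
  rw [comp_vert, id_vert, c.reindex_map_congr h, c.reindex_map_id]
  simp only [eqToHom_map, eqToHom_trans, eqToHom_trans_assoc, Category.assoc]

lemma Hom.comp_id {S T : Dial c} (F : Hom S T) : F.comp (Hom.id T) = F := by
  have h : F.mid (Hom.id T) = 𝟙 _ := by ext <;> simp
  refine Hom.ext' (by simp) (by simp) (by rw [comp_bwd, h, Category.id_comp]) ?_
  rw [comp_vert, id_vert, c.reindex_map_congr h, c.reindex_map_id]
  simp only [eqToHom_map, eqToHom_trans, eqToHom_trans_assoc, Category.assoc]

lemma Hom.assoc {S T R Q : Dial c} (F : Hom S T) (G : Hom T R) (H : Hom R Q) :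
    (F.comp G).comp H = F.comp (G.comp H) := by
  have h₀ : (F.comp G).sub = F.sub ≫ G.sub := subst_comp ..
  have h₂ : (F.comp G).mid H ≫ F.sub ▷ R.ctr = F.sub ▷ Q.ctr ≫ G.mid H := by
    rw [Hom.mid, h₀]
    ext <;> simp
  have h₁ : (F.comp G).mid H ≫ F.mid G = F.mid (G.comp H) := by
    rw [Hom.mid, Hom.mid, comp_lift, lift_fst, ← Category.assoc]
    change lift _ (((F.comp G).mid H ≫ F.sub ▷ R.ctr) ≫ G.bwd) = _
    rw [h₂, Category.assoc]
    rfl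
  have h₃ : (F.comp G).sub ▷ Q.ctr = F.sub ▷ Q.ctr ≫ G.sub ▷ Q.ctr := by
    rw [h₀, comp_whiskerRight]
  refine Hom.ext' (by simp) ?_ ?_ ?_
  · rw [comp_fwd, comp_fwd, comp_fwd, h₀, Category.assoc]
  · rw [comp_bwd, comp_bwd, comp_bwd, ← h₁, Category.assoc]
  rw [comp_vert (F.comp G) H, comp_vert F (G.comp H), comp_vert F G, comp_vert G H]
  simp only [Functor.map_comp, eqToHom_map, c.reindex_map_map, Category.assoc]
  rw [c.reindex_map_congr h₁, c.reindex_map_congr h₂, c.reindex_map_congr h₃]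
  simp only [Category.assoc, eqToHom_trans, eqToHom_trans_assoc]

noncomputable instance : Category (Dial c) where
  Hom := Hom
  id := Hom.id
  comp := Hom.comp
  id_comp := Hom.id_comp
  comp_id := Hom.comp_id
  assoc := Hom.assoc

/-- The projection of the Dialectica fibration, `(I, X, U, α) ↦ I`. -/
def proj (c : SplitCleavage p) : Dial c ⥤ B where
  obj S := S.ctx
  map F := Hom.base F

end Dial

end Dialectica

/-- Equivalence of fibrations over the same base `B`: an equivalence of the total categories which
lies strictly over `B`, preserves cartesian arrows, and has vertical unit and counit. -/
structure FibredEquivalence {B : Type u₁} [Category.{v₁} B] {D : Type u₂} [Category.{v₂} D]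
    {E : Type u₃} [Category.{v₃} E] (q : D ⥤ B) (p : E ⥤ B) where
  equiv : D ≌ E
  functor_comp : equiv.functor ⋙ p = q
  inverse_comp : equiv.inverse ⋙ q = p
  functor_cartesian {X Y : D} {I J : B} (u : I ⟶ J) (φ : X ⟶ Y) :
    q.IsStronglyCartesian u φ → p.IsStronglyCartesian u (equiv.functor.map φ)
  inverse_cartesian {X Y : E} {I J : B} (u : I ⟶ J) (φ : X ⟶ Y) :
    p.IsStronglyCartesian u φ → q.IsStronglyCartesian u (equiv.inverse.map φ)
  unit_vertical (X : D) : q.IsHomLift (𝟙 (q.obj X)) (equiv.unit.app X)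
  counit_vertical (Y : E) : p.IsHomLift (𝟙 (p.obj Y)) (equiv.counit.app Y)

end DialecticaFib

/-!
The theorem is proved by splitting the Dialectica construction into its two quantifiers. Morphisms
of objects `(I, X, U, α)`, read as the formulas `∃ x, ∀ u, α(i, x, u)`, factor through the category
`FormalProd` of formal products `(K, U, α)`, read as `∏_U α` over `K`, whose morphisms carry only
the backward components of the Dialectica morphisms: a Dialectica morphism is a morphism of formal
products over a compatible arrow of the base (`Dial.Hom.fam`, `Dial.Hom.ofFam`). Both sides of the
equivalence say that the formal products of some fibration `p'` embed fully faithfully in `p` as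
`∐`-quantifier-free objects, and that every object of `p` is a simple coproduct of an embedded one;
this is `FormalProd.Embedding` together with `FormalProd.Embedding.Generates`.

Such an embedding gives an equivalence of `p` with the Dialectica fibration of `p'`
(`Generates.nonempty_fibredEquivalence`), since coproduct injections are cocartesian and arrows from
quantifier-free objects into coproducts lift uniquely along them. If `p` is a Gödel fibration, one
takes for `p'` the `∏`-quantifier-free objects among the `∐`-quantifier-free ones. The co-witness
property makes the interpretation of formal products by simple products fully faithful
(`SimpleProducts.prodMap_bijective`), and the two assumptions of having enough quantifier-free
objects say that every object is a coproduct of a product (`generates_embeddingOfSub`).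

Conversely, an equivalence of `p` with a Dialectica fibration embeds the formal products as the
objects with trivial witness type. A Dialectica morphism that is invertible on formal products is
cocartesian, so the simple coproducts of `p` are those of the Dialectica fibration, and objects with
trivial witness type have the witness property (`FibredEquivalence.generates_embedding`). It remains
to see that a generating embedding that preserves cartesian arrows makes `p` a Gödel fibration
(`Generates.isGodel`). A simple product of a formal product is a formal product, obtained by
pairing the two types of counterexamples (`FormalProd.existsUnique_prod`). Since every object is a
coproduct of a formal product, its universal property can be tested on formal products, and it is a
simple product in `p` (`Generates.exists_iso_prod`); hence quantifier-free objects are stable under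
simple products. Every formal product `(I, U, α)` is the product along `U` of `(I × U, 1, α)`, and
arrows from a product into a formal product with terminal type of counterexamples come from a unique
instance of the product (`FormalProd.existsUnique_inst`), so that these objects are
`∏`-quantifier-free among the `∐`-quantifier-free ones (`Generates.enough_subProducts`).

Identities between vertical arrows in different fibres are proved in the total category: `tot`
and `arr` send the fibres there, and `SplitCleavage.π` and `SplitCleavage.fill` are the chosen
cartesian arrows and their universal property. This avoids transport along the equalities
`(u ≫ v)^* = u^* v^*`.
-/

namespace DialecticaFib

section

/-! ### Arrows of the total category over a given arrow of the base -/

section Lifts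

variable {B : Type u₁} [Category.{v₁} B] {E : Type u₂} [Category.{v₂} E] {p : E ⥤ B}

lemma over_congr {I J : B} {u v : I ⟶ J} {X Y : E} {φ : X ⟶ Y} (h : p.IsHomLift u φ)
    (e : u = v) : p.IsHomLift v φ := e ▸ h

lemma over_unique {I J : B} {u v : I ⟶ J} {X Y : E} {φ : X ⟶ Y} (hu : p.IsHomLift u φ)
    (hv : p.IsHomLift v φ) : u = v := by
  rw [IsHomLift.fac p u φ, IsHomLift.fac p v φ]

lemma id_comp_over {I J : B} {u : I ⟶ J} {X Y : E} {φ : X ⟶ Y} (h : p.IsHomLift u φ) :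
    p.IsHomLift (𝟙 I ≫ u) φ := by rwa [Category.id_comp]

lemma over_comp {I J K : B} {u : I ⟶ J} {v : J ⟶ K} {X Y Z : E} {φ : X ⟶ Y} {ψ : Y ⟶ Z}
    (h : p.IsHomLift u φ) (k : p.IsHomLift v ψ) : p.IsHomLift (u ≫ v) (φ ≫ ψ) :=
  inferInstance

lemma over_comp_vert {I J : B} {u : I ⟶ J} {X Y Z : E} {φ : X ⟶ Y} {ψ : Y ⟶ Z}
    (h : p.IsHomLift u φ) (k : p.IsHomLift (𝟙 J) ψ) : p.IsHomLift u (φ ≫ ψ) :=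
  inferInstance

lemma vert_comp_over {I J : B} {u : I ⟶ J} {X Y Z : E} {φ : X ⟶ Y} {ψ : Y ⟶ Z}
    (h : p.IsHomLift (𝟙 I) φ) (k : p.IsHomLift u ψ) : p.IsHomLift u (φ ≫ ψ) :=
  inferInstance

lemma vert_inv {I : B} {X Y : E} {i : X ≅ Y} (h : p.IsHomLift (𝟙 I) i.hom) :
    p.IsHomLift (𝟙 I) i.inv := by
  have : p.IsHomLift (Iso.refl I).hom i.hom := h
  exact IsHomLift.inv_lift_inv p (Iso.refl I) i

lemma cartesian_ext {I J L : B} {u : I ⟶ J} {X Y Z : E} {φ : X ⟶ Y}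
    (h : p.IsStronglyCartesian u φ) {w : L ⟶ I} {ψ ψ' : Z ⟶ X} (hψ : p.IsHomLift w ψ)
    (hψ' : p.IsHomLift w ψ') (e : ψ ≫ φ = ψ' ≫ φ) : ψ = ψ' :=
  Functor.IsStronglyCartesian.ext p u φ w e

/-- The object of the total category underlying an object of a fibre. -/
def tot {I : B} (X : p.Fiber I) : E := X.1

/-- The arrow of the total category underlying a vertical arrow. -/
def arr {I : B} {X Y : p.Fiber I} (φ : X ⟶ Y) : tot X ⟶ tot Y := φ.1

/-- A vertical arrow of the total category, as an arrow of the fibre. -/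
def mkVert {I : B} {X Y : p.Fiber I} (φ : tot X ⟶ tot Y) (h : p.IsHomLift (𝟙 I) φ) : X ⟶ Y :=
  ⟨φ, h⟩

lemma arr_over {I : B} {X Y : p.Fiber I} (φ : X ⟶ Y) : p.IsHomLift (𝟙 I) (arr φ) := φ.2

lemma tot_over {I : B} (X : p.Fiber I) : p.IsHomLift (𝟙 I) (𝟙 (tot X)) := IsHomLift.id X.2

lemma arr_ext {I : B} {X Y : p.Fiber I} {φ ψ : X ⟶ Y} (h : arr φ = arr ψ) : φ = ψ :=
  Subtype.ext h

@[simp]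
lemma arr_mkVert {I : B} {X Y : p.Fiber I} (φ : tot X ⟶ tot Y) (h : p.IsHomLift (𝟙 I) φ) :
    arr (mkVert φ h) = φ := rfl

@[simp]
lemma arr_comp {I : B} {X Y Z : p.Fiber I} (φ : X ⟶ Y) (ψ : Y ⟶ Z) :
    arr (φ ≫ ψ) = arr φ ≫ arr ψ := rfl

@[simp]
lemma arr_id {I : B} (X : p.Fiber I) : arr (𝟙 X) = 𝟙 (tot X) := rfl

lemma arr_eqToHom {I : B} {X Y : p.Fiber I} (h : X = Y) :
    arr (eqToHom h) = eqToHom (congrArg tot h) := by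
  subst h
  rfl

lemma exists_over {I J : B} (X : p.Fiber I) (Y : p.Fiber J) (φ : tot X ⟶ tot Y) :
    ∃ u : I ⟶ J, p.IsHomLift u φ :=
  ⟨eqToHom X.2.symm ≫ p.map φ ≫ eqToHom Y.2, IsHomLift.of_fac p _ φ X.2 Y.2 rfl⟩

/-- An isomorphism of a fibre, seen in the total category. -/
def totalIso {I : B} {X Y : p.Fiber I} (i : X ≅ Y) : tot X ≅ tot Y where
  hom := arr i.hom
  inv := arr i.inv
  hom_inv_id := congrArg arr i.hom_inv_id
  inv_hom_id := congrArg arr i.inv_hom_id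

@[simp]
lemma arr_hom_inv {I : B} {X Y : p.Fiber I} (i : X ≅ Y) : arr i.hom ≫ arr i.inv = 𝟙 _ :=
  (totalIso i).hom_inv_id

@[simp]
lemma arr_hom_inv_assoc {I : B} {X Y : p.Fiber I} (i : X ≅ Y) {Z : E} (z : tot X ⟶ Z) :
    arr i.hom ≫ arr i.inv ≫ z = z :=
  (totalIso i).hom_inv_id_assoc z

@[simp]
lemma arr_inv_hom {I : B} {X Y : p.Fiber I} (i : X ≅ Y) : arr i.inv ≫ arr i.hom = 𝟙 _ :=
  (totalIso i).inv_hom_id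

@[simp]
lemma arr_inv_hom_assoc {I : B} {X Y : p.Fiber I} (i : X ≅ Y) {Z : E} (z : tot Y ⟶ Z) :
    arr i.inv ≫ arr i.hom ≫ z = z :=
  (totalIso i).inv_hom_id_assoc z

/-- A vertical isomorphism of the total category, seen in the fibre. -/
def fiberIso {I : B} {X Y : p.Fiber I} (i : tot X ≅ tot Y) (h : p.IsHomLift (𝟙 I) i.hom) :
    X ≅ Y where
  hom := mkVert i.hom h
  inv := mkVert i.inv (vert_inv h)
  hom_inv_id := arr_ext i.hom_inv_id
  inv_hom_id := arr_ext i.inv_hom_id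

namespace SplitCleavage

variable (c : SplitCleavage p)

/-- The chosen cartesian arrow over `u`. -/
def π {I J : B} (u : I ⟶ J) (Y : p.Fiber J) : tot ((c.reindex u).obj Y) ⟶ tot Y := c.cart u Y

lemma π_cartesian {I J : B} (u : I ⟶ J) (Y : p.Fiber J) : p.IsStronglyCartesian u (c.π u Y) :=
  c.isCartesian u Y

lemma π_over {I J : B} (u : I ⟶ J) (Y : p.Fiber J) : p.IsHomLift u (c.π u Y) :=
  (c.isCartesian u Y).toIsHomLift

lemma arr_reindex_π {I J : B} (u : I ⟶ J) {X Y : p.Fiber J} (φ : X ⟶ Y) :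
    arr ((c.reindex u).map φ) ≫ c.π u Y = c.π u X ≫ arr φ := c.pullMap_cart u φ

/-- The factorization through the chosen cartesian arrow over `u` of an arrow over `w ≫ u`. -/
noncomputable def fill {I J : B} (u : I ⟶ J) (Y : p.Fiber J) {L : B} (w : L ⟶ I) {Z : E}
    (z : Z ⟶ tot Y) (hz : p.IsHomLift (w ≫ u) z) : Z ⟶ tot ((c.reindex u).obj Y) :=
  have := c.π_cartesian u Y
  Functor.IsStronglyCartesian.map p u (c.π u Y) (g := w) (f' := w ≫ u) rfl z

lemma fill_over {I J : B} (u : I ⟶ J) (Y : p.Fiber J) {L : B} (w : L ⟶ I) {Z : E}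
    (z : Z ⟶ tot Y) (hz : p.IsHomLift (w ≫ u) z) : p.IsHomLift w (c.fill u Y w z hz) :=
  have := c.π_cartesian u Y
  Functor.IsStronglyCartesian.map_isHomLift p u (c.π u Y) (g := w) (f' := w ≫ u) rfl z

@[simp]
lemma fill_π {I J : B} (u : I ⟶ J) (Y : p.Fiber J) {L : B} (w : L ⟶ I) {Z : E}
    (z : Z ⟶ tot Y) (hz : p.IsHomLift (w ≫ u) z) : c.fill u Y w z hz ≫ c.π u Y = z :=
  have := c.π_cartesian u Y
  Functor.IsStronglyCartesian.fac p u (c.π u Y) (g := w) (f' := w ≫ u) rfl z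

@[simp]
lemma fill_π_assoc {I J : B} (u : I ⟶ J) (Y : p.Fiber J) {L : B} (w : L ⟶ I) {Z : E}
    (z : Z ⟶ tot Y) (hz : p.IsHomLift (w ≫ u) z) {W : E} (y : tot Y ⟶ W) :
    c.fill u Y w z hz ≫ c.π u Y ≫ y = z ≫ y := by
  rw [← Category.assoc, fill_π]

lemma π_ext {I J : B} {u : I ⟶ J} {Y : p.Fiber J} {L : B} (w : L ⟶ I) {Z : E}
    {φ ψ : Z ⟶ tot ((c.reindex u).obj Y)} (hφ : p.IsHomLift w φ) (hψ : p.IsHomLift w ψ)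
    (h : φ ≫ c.π u Y = ψ ≫ c.π u Y) : φ = ψ :=
  have := c.π_cartesian u Y
  Functor.IsStronglyCartesian.ext p u (c.π u Y) w h

lemma fill_eq {I J : B} {u : I ⟶ J} {Y : p.Fiber J} {L : B} {w : L ⟶ I} {Z : E}
    {z : Z ⟶ tot Y} (hz : p.IsHomLift (w ≫ u) z) {φ : Z ⟶ tot ((c.reindex u).obj Y)}
    (hφ : p.IsHomLift w φ) (h : φ ≫ c.π u Y = z) : c.fill u Y w z hz = φ :=
  c.π_ext w (c.fill_over ..) hφ (by rw [fill_π, h])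

lemma fill_congr {I J : B} {u : I ⟶ J} {Y : p.Fiber J} {L : B} {w w' : L ⟶ I} {Z : E}
    {z z' : Z ⟶ tot Y} (hw : w = w') (e : z = z') (hz : p.IsHomLift (w ≫ u) z)
    (hz' : p.IsHomLift (w' ≫ u) z') : c.fill u Y w z hz = c.fill u Y w' z' hz' := by
  subst hw e
  rfl

lemma comp_fill {I J : B} {u : I ⟶ J} {Y : p.Fiber J} {L L' : B} {w : L ⟶ I} {r : L' ⟶ L}
    {Z Z' : E} {z : Z ⟶ tot Y} (hz : p.IsHomLift (w ≫ u) z) {ρ : Z' ⟶ Z}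
    (hρ : p.IsHomLift r ρ) :
    ρ ≫ c.fill u Y w z hz = c.fill u Y (r ≫ w) (ρ ≫ z)
      (over_congr (over_comp hρ hz) (Category.assoc _ _ _).symm) :=
  (c.fill_eq _ (over_comp hρ (c.fill_over ..)) (by simp)).symm

lemma eqToHom_π_comp {I J K : B} (u : I ⟶ J) (v : J ⟶ K) (Y : p.Fiber K) {X : p.Fiber I}
    (e : X = (c.reindex (u ≫ v)).obj Y) (e' : X = (c.reindex u).obj ((c.reindex v).obj Y)) :
    arr (eqToHom e') ≫ c.π u ((c.reindex v).obj Y) ≫ c.π v Y =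
      arr (eqToHom e) ≫ c.π (u ≫ v) Y := by
  subst e
  rw [arr_eqToHom, eqToHom_refl, arr_id, Category.id_comp]
  exact (c.cart_comp u v Y).symm

lemma eqToHom_π_congr {I J : B} {u v : I ⟶ J} (h : u = v) (Y : p.Fiber J) {X : p.Fiber I}
    (e : X = (c.reindex u).obj Y) (e' : X = (c.reindex v).obj Y) :
    arr (eqToHom e) ≫ c.π u Y = arr (eqToHom e') ≫ c.π v Y := by
  subst h e
  rfl

lemma eqToHom_eq_π {I : B} {u : I ⟶ I} (h : u = 𝟙 I) (Y : p.Fiber I)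
    (e : (c.reindex u).obj Y = Y) : arr (eqToHom e) = c.π u Y := by
  subst h
  rw [arr_eqToHom]
  exact (c.cart_id Y).symm

end SplitCleavage

end Lifts

section Quantifiers

variable {B : Type u₁} [Category.{v₁} B] [CartesianMonoidalCategory B]
variable {E : Type u₂} [Category.{v₂} E] {p : E ⥤ B} {c : SplitCleavage p}

/-! ### Simple coproducts in terms of the total category -/

namespace SplitCleavage

lemma weaken_comm_π {I J : B} (f : I ⟶ J) (X : B) (Y : p.Fiber J) :
    arr (eqToHom (c.weaken_comm f X Y)) ≫ c.π (fst I X) ((c.reindex f).obj Y) ≫ c.π f Y =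
      c.π (f ▷ X) ((c.reindex (fst J X)).obj Y) ≫ c.π (fst J X) Y := by
  have e : (c.reindex (f ▷ X)).obj ((c.reindex (fst J X)).obj Y) =
      (c.reindex (f ▷ X ≫ fst J X)).obj Y := (c.reindex_obj_comp ..).symm
  have e' : (c.reindex (f ▷ X)).obj ((c.reindex (fst J X)).obj Y) =
      (c.reindex (fst I X ≫ f)).obj Y := by rw [← whiskerRight_fst, c.reindex_obj_comp]
  rw [c.eqToHom_π_comp _ _ _ e', c.eqToHom_π_congr (whiskerRight_fst f X).symm Y e' e,
    ← c.eqToHom_π_comp _ _ _ e rfl, eqToHom_refl, arr_id, Category.id_comp]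

lemma weaken_section_π {A X : B} (g : A ⟶ X) (Y : p.Fiber A) :
    arr (eqToHom (c.weaken_section g Y)) =
      c.π (lift (𝟙 A) g) ((c.reindex (fst A X)).obj Y) ≫ c.π (fst A X) Y := by
  have e : (c.reindex (lift (𝟙 A) g)).obj ((c.reindex (fst A X)).obj Y) =
      (c.reindex (lift (𝟙 A) g ≫ fst A X)).obj Y := (c.reindex_obj_comp ..).symm
  have h := c.eqToHom_π_comp _ _ _ e rfl
  rw [← c.eqToHom_eq_π (lift_fst _ _) Y (e.symm.trans (c.weaken_section g Y)), eqToHom_refl,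
    arr_id, Category.id_comp, ← arr_comp, eqToHom_trans] at h
  exact h.symm

end SplitCleavage

namespace SplitCleavage.SimpleCoproducts

variable (C : c.SimpleCoproducts)

/-- The unit `β ⟶ π_A^* ∐_{π_A} β`. -/
noncomputable def unit {A X : B} (β : p.Fiber (A ⊗ X)) :
    β ⟶ (c.reindex (fst A X)).obj ((C.coprod A X).obj β) :=
  (C.adj A X).unit.app β

/-- Transposition of vertical arrows out of a coproduct. -/
noncomputable def transpose {A X : B} (β : p.Fiber (A ⊗ X)) (Z : p.Fiber A) :
    ((C.coprod A X).obj β ⟶ Z) ≃ (β ⟶ (c.reindex (fst A X)).obj Z) :=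
  (C.adj A X).homEquiv β Z

lemma transpose_apply {A X : B} {β : p.Fiber (A ⊗ X)} {Z : p.Fiber A}
    (φ : (C.coprod A X).obj β ⟶ Z) :
    C.transpose β Z φ = C.unit β ≫ (c.reindex (fst A X)).map φ :=
  Adjunction.homEquiv_unit ..

/-- The coproduct injection `β ⟶ ∐_{π_A} β`, over the projection `π_A`, whose vertical part is the
unit of the adjunction. -/
noncomputable def inj {A X : B} (β : p.Fiber (A ⊗ X)) : tot β ⟶ tot ((C.coprod A X).obj β) :=
  arr (C.unit β) ≫ c.π (fst A X) ((C.coprod A X).obj β)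

lemma inj_over {A X : B} (β : p.Fiber (A ⊗ X)) : p.IsHomLift (fst A X) (C.inj β) :=
  vert_comp_over (arr_over _) (c.π_over _ _)

lemma inj_arr {A X : B} {β : p.Fiber (A ⊗ X)} {Z : p.Fiber A}
    (φ : (C.coprod A X).obj β ⟶ Z) :
    C.inj β ≫ arr φ = arr (C.transpose β Z φ) ≫ c.π (fst A X) Z := by
  rw [transpose_apply, arr_comp, Category.assoc, arr_reindex_π, inj, Category.assoc]

/-- Coproduct injections are cocartesian: this is the universal property of the coproduct in terms
of the total category. -/
lemma existsUnique_desc {A X J : B} (β : p.Fiber (A ⊗ X)) (Z : p.Fiber J) (f : A ⟶ J)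
    (k : tot β ⟶ tot Z) (hk : p.IsHomLift (fst A X ≫ f) k) :
    ∃! h : tot ((C.coprod A X).obj β) ⟶ tot Z, p.IsHomLift f h ∧ C.inj β ≫ h = k := by
  let k₁ := c.fill f Z (fst A X) k hk
  have hk₁ : p.IsHomLift (𝟙 _ ≫ fst A X) k₁ := by rw [Category.id_comp]; exact c.fill_over ..
  let k₂ : β ⟶ (c.reindex (fst A X)).obj ((c.reindex f).obj Z) :=
    mkVert (c.fill (fst A X) _ (𝟙 _) k₁ hk₁) (c.fill_over ..)
  let h : (C.coprod A X).obj β ⟶ (c.reindex f).obj Z := (C.transpose _ _).symm k₂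
  have hh : C.inj β ≫ arr h = k₁ := by
    rw [inj_arr, Equiv.apply_symm_apply, arr_mkVert, fill_π]
  refine ⟨arr h ≫ c.π f Z, ⟨vert_comp_over (arr_over h) (c.π_over _ _), ?_⟩, ?_⟩
  · rw [← Category.assoc, hh, fill_π]
  · rintro h' ⟨h'₁, h'₂⟩
    let h'' : (C.coprod A X).obj β ⟶ (c.reindex f).obj Z :=
      mkVert (c.fill f Z (𝟙 _) h' (id_comp_over h'₁)) (c.fill_over ..)
    have e : arr h'' ≫ c.π f Z = h' := by rw [arr_mkVert, fill_π]
    have : h'' = h := by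
      apply (C.transpose _ _).injective
      apply arr_ext
      apply c.π_ext (𝟙 _) (arr_over _) (arr_over _)
      rw [← inj_arr, ← inj_arr, hh]
      apply c.π_ext (fst A X) (over_comp_vert (C.inj_over β) (arr_over h'')) (c.fill_over ..)
      rw [Category.assoc, e, h'₂, fill_π]
    rw [← e, this]

lemma desc_ext {A X J : B} {β : p.Fiber (A ⊗ X)} {Z : p.Fiber J} {f : A ⟶ J}
    {h h' : tot ((C.coprod A X).obj β) ⟶ tot Z} (o : p.IsHomLift f h) (o' : p.IsHomLift f h')
    (e : C.inj β ≫ h = C.inj β ≫ h') : h = h' :=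
  (C.existsUnique_desc β Z f (C.inj β ≫ h') (over_comp (C.inj_over β) o')).unique ⟨o, e⟩ ⟨o', rfl⟩

lemma reindex_unit_section {A X : B} (β : p.Fiber (A ⊗ X)) (g : A ⟶ X) :
    arr ((c.reindex (lift (𝟙 A) g)).map (C.unit β)) ≫
        arr (eqToHom (c.weaken_section g ((C.coprod A X).obj β))) =
      c.π (lift (𝟙 A) g) β ≫ C.inj β := by
  rw [weaken_section_π, ← Category.assoc, arr_reindex_π, inj, Category.assoc]

/-- A vertical arrow factors through the reindexed unit as in the witness property if and only if
the corresponding arrow of the total category factors through the coproduct injection. -/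
lemma eq_comp_unit_iff {A X : B} {γ : p.Fiber A} {β : p.Fiber (A ⊗ X)}
    (h : γ ⟶ (C.coprod A X).obj β) (g : A ⟶ X) (k : γ ⟶ (c.reindex (lift (𝟙 A) g)).obj β) :
    h = k ≫ (c.reindex (lift (𝟙 A) g)).map ((C.adj A X).unit.app β) ≫
        eqToHom (c.weaken_section g ((C.coprod A X).obj β)) ↔
      (arr k ≫ c.π (lift (𝟙 A) g) β) ≫ C.inj β = arr h := by
  have e : arr (k ≫ (c.reindex (lift (𝟙 A) g)).map ((C.adj A X).unit.app β) ≫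
      eqToHom (c.weaken_section g ((C.coprod A X).obj β))) =
      (arr k ≫ c.π (lift (𝟙 A) g) β) ≫ C.inj β := by
    rw [Category.assoc, ← C.reindex_unit_section β g]
    rfl
  exact ⟨fun H => by rw [← e, ← H], fun H => arr_ext (by rw [e, H])⟩

/-- The witness property in terms of the total category: vertical arrows into a coproduct lift
uniquely along the coproduct injection. -/
lemma witnessed_iff {A : B} (γ : p.Fiber A) :
    C.Witnessed γ ↔ ∀ (X : B) (β : p.Fiber (A ⊗ X)) (h : tot γ ⟶ tot ((C.coprod A X).obj β)),
      p.IsHomLift (𝟙 A) h → ∃! k : tot γ ⟶ tot β, k ≫ C.inj β = h := by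
  have key {X : B} {β : p.Fiber (A ⊗ X)} {h : tot γ ⟶ tot ((C.coprod A X).obj β)}
      (hh : p.IsHomLift (𝟙 A) h) {k : tot γ ⟶ tot β} (e : k ≫ C.inj β = h) :
      ∃ g : A ⟶ X, p.IsHomLift (𝟙 A ≫ lift (𝟙 A) g) k := by
    obtain ⟨v, hv⟩ := exists_over γ β k
    have h₁ : v ≫ fst A X = 𝟙 A := over_unique (over_comp hv (C.inj_over β)) (e ▸ hh)
    refine ⟨v ≫ snd A X, over_congr hv ?_⟩
    ext <;> simp [h₁]
  constructor
  · intro H X β h hh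
    obtain ⟨⟨g, k⟩, hk, hu⟩ := H X β (mkVert h hh)
    rw [C.eq_comp_unit_iff] at hk
    refine ⟨_, hk, ?_⟩
    intro k' e
    obtain ⟨g', hk'⟩ := key hh e
    have := hu ⟨g', mkVert (c.fill (lift (𝟙 A) g') β (𝟙 A) k' hk') (c.fill_over ..)⟩
      ((C.eq_comp_unit_iff _ _ _).2 (by rw [arr_mkVert, fill_π, e, arr_mkVert]))
    cases this
    exact (c.fill_π _ _ _ _ hk').symm
  · intro H X β h
    obtain ⟨k, hk, hu⟩ := H X β (arr h) (arr_over h)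
    obtain ⟨g, hg⟩ := key (arr_over h) hk
    refine ⟨⟨g, mkVert (c.fill (lift (𝟙 A) g) β (𝟙 A) k hg) (c.fill_over ..)⟩, ?_, ?_⟩
    · exact (C.eq_comp_unit_iff _ _ _).2 (by rw [arr_mkVert, fill_π, hk])
    · rintro ⟨g', k'⟩ e
      rw [C.eq_comp_unit_iff] at e
      have e₁ : arr k' ≫ c.π (lift (𝟙 A) g') β = k := hu _ e
      have o : p.IsHomLift (lift (𝟙 A) g') k :=
        e₁ ▸ vert_comp_over (arr_over k') (c.π_over _ _)
      have : lift (𝟙 A) g' = 𝟙 A ≫ lift (𝟙 A) g := over_unique o hg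
      obtain rfl : g' = g := by
        simpa using congrArg (· ≫ snd A X) this
      congr 1
      apply arr_ext
      exact (c.fill_eq hg (arr_over k') e₁).symm

/-- Beck-Chevalley in terms of the total category: for every `f : A ⟶ J`, the arrow
`(f × 1)^* β ⟶ f^* ∐ β` induced by the coproduct injection exhibits the reindexed coproduct as a
coproduct of the reindexed object. -/
lemma exists_iso_reindex {A J X : B} (f : A ⟶ J) (β : p.Fiber (J ⊗ X)) :
    ∃ i : (C.coprod A X).obj ((c.reindex (f ▷ X)).obj β) ≅
        (c.reindex f).obj ((C.coprod J X).obj β),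
      C.inj ((c.reindex (f ▷ X)).obj β) ≫ arr i.hom ≫ c.π f _ = c.π (f ▷ X) β ≫ C.inj β := by
  have hi := C.beckChevalley f X β
  obtain ⟨i, hi⟩ : ∃ i : (C.coprod A X).obj ((c.reindex (f ▷ X)).obj β) ≅
      (c.reindex f).obj ((C.coprod J X).obj β), i.hom = (C.transpose _ _).symm
        ((c.reindex (f ▷ X)).map (C.unit β) ≫ eqToHom (c.weaken_comm f X _)) :=
    ⟨@asIso _ _ _ _ _ hi, rfl⟩
  refine ⟨i, ?_⟩
  rw [← Category.assoc, inj_arr, hi, Equiv.apply_symm_apply, arr_comp, Category.assoc,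
    Category.assoc, weaken_comm_π, ← Category.assoc, arr_reindex_π, inj, Category.assoc]

variable {C}

/-- Arrows from a quantifier-free object into a coproduct, over an arbitrary arrow of the base, lift
uniquely along the coproduct injection. -/
lemma QuantifierFree.existsUnique_lift {I J X : B} {α : p.Fiber I} (hα : C.QuantifierFree α)
    (β : p.Fiber (J ⊗ X)) (h : tot α ⟶ tot ((C.coprod J X).obj β)) :
    ∃! k : tot α ⟶ tot β, k ≫ C.inj β = h := by
  obtain ⟨f, hf⟩ := exists_over α _ h
  obtain ⟨i, hi⟩ := C.exists_iso_reindex f β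
  have w : C.Witnessed α := by
    have := hα I (𝟙 I)
    rwa [c.reindex_obj_id] at this
  rw [witnessed_iff] at w
  have hf' : p.IsHomLift (𝟙 I ≫ f) h := by rwa [Category.id_comp]
  let h₁ := c.fill f _ (𝟙 I) h hf'
  have oh₁ : p.IsHomLift (𝟙 I) h₁ := c.fill_over ..
  obtain ⟨k, hk, hu⟩ := w X ((c.reindex (f ▷ X)).obj β) (h₁ ≫ arr i.inv)
    (over_comp_vert oh₁ (arr_over _))
  refine ⟨k ≫ c.π (f ▷ X) β, ?_, ?_⟩
  · dsimp only at hk ⊢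
    rw [Category.assoc, ← hi, ← Category.assoc, hk, Category.assoc, arr_inv_hom_assoc]
    exact c.fill_π ..
  · intro k' e
    obtain ⟨v, hv⟩ := exists_over α β k'
    have hv₁ : v ≫ fst J X = f := over_unique (over_comp hv (C.inj_over β)) (e ▸ hf)
    have hv' : p.IsHomLift (lift (𝟙 I) (v ≫ snd J X) ≫ f ▷ X) k' := by
      refine over_congr hv ?_
      ext <;> simp [hv₁]
    have e' := hu (c.fill (f ▷ X) β _ k' hv') (by
      have o₁ : p.IsHomLift (𝟙 I)
          (c.fill (f ▷ X) β _ k' hv' ≫ C.inj ((c.reindex (f ▷ X)).obj β)) :=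
        over_congr (over_comp (c.fill_over ..) (C.inj_over _)) (by simp)
      have : c.fill (f ▷ X) β _ k' hv' ≫ C.inj ((c.reindex (f ▷ X)).obj β) ≫ arr i.hom = h₁ := by
        rw [← Category.assoc]
        refine c.π_ext (𝟙 I) (over_comp_vert o₁ (arr_over _)) oh₁ ?_
        rw [Category.assoc, Category.assoc, hi, fill_π_assoc, e]
        exact (c.fill_π ..).symm
      rw [← this]
      simp)
    rw [← e', fill_π]

end SplitCleavage.SimpleCoproducts

/-! ### Simple products in terms of the total category -/

namespace SplitCleavage.SimpleProducts

variable (P : c.SimpleProducts)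

/-- The counit `π_J^* ∏_{π_J} α ⟶ α`. -/
noncomputable def counit {J X : B} (α : p.Fiber (J ⊗ X)) :
    (c.reindex (fst J X)).obj ((P.prod J X).obj α) ⟶ α :=
  (P.adj J X).counit.app α

/-- Transposition of vertical arrows into a product. -/
noncomputable def transpose {A X : B} (Z : p.Fiber A) (α : p.Fiber (A ⊗ X)) :
    ((c.reindex (fst A X)).obj Z ⟶ α) ≃ (Z ⟶ (P.prod A X).obj α) :=
  (P.adj A X).homEquiv Z α

lemma transpose_symm_apply {A X : B} {Z : p.Fiber A} {α : p.Fiber (A ⊗ X)}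
    (φ : Z ⟶ (P.prod A X).obj α) :
    (P.transpose Z α).symm φ = (c.reindex (fst A X)).map φ ≫ P.counit α :=
  Adjunction.homEquiv_counit ..

/-- Evaluation at `x` of a generalized element of a product: an arrow `y : W ⟶ ∏_{π_J} α` over
`j : L ⟶ J` and an arrow `x : L ⟶ X` give an arrow `W ⟶ α` over `⟨j, x⟩`. -/
noncomputable def ev {J X L : B} (α : p.Fiber (J ⊗ X)) (j : L ⟶ J) (x : L ⟶ X) {W : E}
    (y : W ⟶ tot ((P.prod J X).obj α)) (hy : p.IsHomLift j y) : W ⟶ tot α :=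
  c.fill (fst J X) ((P.prod J X).obj α) (lift j x) y (by rwa [lift_fst]) ≫ arr (P.counit α)

lemma ev_over {J X L : B} (α : p.Fiber (J ⊗ X)) (j : L ⟶ J) (x : L ⟶ X) {W : E}
    (y : W ⟶ tot ((P.prod J X).obj α)) (hy : p.IsHomLift j y) :
    p.IsHomLift (lift j x) (P.ev α j x y hy) :=
  over_comp_vert (c.fill_over ..) (arr_over _)

lemma comp_ev {J X L L' : B} (α : p.Fiber (J ⊗ X)) (j : L ⟶ J) (x : L ⟶ X) {W W' : E}
    (y : W ⟶ tot ((P.prod J X).obj α)) (hy : p.IsHomLift j y) {r : L' ⟶ L} {ρ : W' ⟶ W}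
    (hρ : p.IsHomLift r ρ) :
    ρ ≫ P.ev α j x y hy = P.ev α (r ≫ j) (r ≫ x) (ρ ≫ y) (over_comp hρ hy) := by
  rw [ev, ev, ← Category.assoc, c.comp_fill _ hρ]
  congr 1
  exact c.fill_eq _ (over_congr (c.fill_over ..) (by simp)) (c.fill_π ..)

lemma ev_congr {J X L : B} {α : p.Fiber (J ⊗ X)} {j j' : L ⟶ J} {x x' : L ⟶ X} {W : E}
    {y y' : W ⟶ tot ((P.prod J X).obj α)} (hy : p.IsHomLift j y) (hx : x = x') (e : y = y')
    (hy' : p.IsHomLift j' y') : P.ev α j x y hy = P.ev α j' x' y' hy' := by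
  subst e hx
  obtain rfl := over_unique hy hy'
  rfl

lemma ev_arr {A X : B} {α : p.Fiber (A ⊗ X)} {Z : p.Fiber A} (φ : Z ⟶ (P.prod A X).obj α)
    (h : p.IsHomLift (fst A X) (c.π (fst A X) Z ≫ arr φ)) :
    P.ev α (fst A X) (snd A X) (c.π (fst A X) Z ≫ arr φ) h =
      arr ((P.transpose Z α).symm φ) := by
  rw [transpose_symm_apply, arr_comp, ev]
  congr 1
  exact c.fill_eq _ (over_congr (arr_over _) lift_fst_snd.symm) (c.arr_reindex_π (fst A X) φ)

/-- Beck-Chevalley in terms of the total category: the comparison of `f^* ∏ α` with the product of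
the reindexed object is invertible and commutes with evaluation. -/
lemma exists_iso_reindex {A J X : B} (f : A ⟶ J) (α : p.Fiber (J ⊗ X)) :
    ∃ i : (c.reindex f).obj ((P.prod J X).obj α) ≅
        (P.prod A X).obj ((c.reindex (f ▷ X)).obj α),
      ∀ {L : B} (j : L ⟶ A) (x : L ⟶ X) {W : E}
        (y : W ⟶ tot ((c.reindex f).obj ((P.prod J X).obj α))) (hy : p.IsHomLift j y),
        P.ev _ j x (y ≫ arr i.hom) (over_comp_vert hy (arr_over _)) ≫ c.π (f ▷ X) α =
          P.ev α (j ≫ f) x (y ≫ c.π f _) (over_comp hy (c.π_over _ _)) := by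
  have hi := P.beckChevalley f X α
  obtain ⟨i, hi⟩ : ∃ i : (c.reindex f).obj ((P.prod J X).obj α) ≅
      (P.prod A X).obj ((c.reindex (f ▷ X)).obj α), i.hom = P.transpose _ _
        (eqToHom (c.weaken_comm f X _).symm ≫ (c.reindex (f ▷ X)).map (P.counit α)) :=
    ⟨@asIso _ _ _ _ _ hi, rfl⟩
  refine ⟨i, ?_⟩
  intro L j x W y hy
  have o := over_comp_vert (c.π_over (fst A X) ((c.reindex f).obj ((P.prod J X).obj α)))
    (arr_over i.hom)
  have h₁ := P.ev_arr i.hom o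
  rw [(P.transpose _ _).symm_apply_eq.2 hi, arr_comp] at h₁
  have hy' : p.IsHomLift (lift j x ≫ fst A X) y := by rwa [lift_fst]
  let y' := c.fill (fst A X) _ (lift j x) y hy'
  have oy' : p.IsHomLift (lift j x) y' := c.fill_over ..
  have e : y' ≫ c.π (fst A X) _ = y := c.fill_π ..
  have h₂ := congrArg (fun t => y' ≫ t) h₁
  rw [P.comp_ev _ _ _ _ _ oy'] at h₂
  rw [P.ev_congr (j' := lift j x ≫ fst A X) (x' := lift j x ≫ snd A X) _ (by simp)
    (by rw [← Category.assoc, e]) (over_comp oy' o), h₂, ev, Category.assoc, Category.assoc,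
    arr_reindex_π, ← Category.assoc, ← Category.assoc]
  congr 1
  symm
  refine c.fill_eq _ ?_ ?_
  · refine over_congr (over_comp (over_comp_vert oy' (arr_over _)) (c.π_over _ _)) ?_
    ext <;> simp
  · rw [Category.assoc, Category.assoc, ← weaken_comm_π, ← Category.assoc (arr _), ← arr_comp,
      eqToHom_trans, eqToHom_refl, arr_id, Category.id_comp, ← Category.assoc, e]

/-- The universal property of products in terms of the total category: arrows `Y ⟶ ∏ α` over
`f : L ⟶ J` correspond, by evaluation, to arrows from the weakening of `Y` to `α` over `f × 1`. -/
lemma existsUnique_curry {J X L : B} (α : p.Fiber (J ⊗ X)) (Y : p.Fiber L) (f : L ⟶ J)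
    (t : tot ((c.reindex (fst L X)).obj Y) ⟶ tot α) (ht : p.IsHomLift (f ▷ X) t) :
    ∃! m : tot Y ⟶ tot ((P.prod J X).obj α), ∃ h : p.IsHomLift f m,
      P.ev α (fst L X ≫ f) (snd L X) (c.π (fst L X) Y ≫ m) (over_comp (c.π_over _ _) h) =
        t := by
  obtain ⟨i, hi⟩ := P.exists_iso_reindex f α
  let t' : (c.reindex (fst L X)).obj Y ⟶ (c.reindex (f ▷ X)).obj α :=
    mkVert (c.fill (f ▷ X) α (𝟙 _) t (id_comp_over ht)) (c.fill_over ..)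
  have ht' : arr t' ≫ c.π (f ▷ X) α = t := by rw [arr_mkVert, fill_π]
  let n : Y ⟶ (P.prod L X).obj ((c.reindex (f ▷ X)).obj α) := P.transpose _ _ t'
  have ev_eq (m' : Y ⟶ (c.reindex f).obj ((P.prod J X).obj α))
      (h : p.IsHomLift f (arr m' ≫ c.π f _)) :
      P.ev α (fst L X ≫ f) (snd L X) (c.π (fst L X) Y ≫ arr m' ≫ c.π f _)
        (over_comp (c.π_over _ _) h) =
      arr ((P.transpose _ _).symm (m' ≫ i.hom)) ≫ c.π (f ▷ X) α := by
    have o : p.IsHomLift (fst L X) (c.π (fst L X) Y ≫ arr m') :=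
      over_comp_vert (c.π_over _ _) (arr_over m')
    have := hi (fst L X) (snd L X) (c.π (fst L X) Y ≫ arr m') o
    rw [← P.ev_arr (m' ≫ i.hom) (over_comp_vert (c.π_over _ _) (arr_over _))]
    simp only [Category.assoc, arr_comp] at this ⊢
    exact this.symm
  refine ⟨arr (n ≫ i.inv) ≫ c.π f _,
    ⟨vert_comp_over (arr_over (n ≫ i.inv)) (c.π_over _ _), ?_⟩, ?_⟩
  · rw [ev_eq _ (vert_comp_over (arr_over _) (c.π_over _ _)), Category.assoc,
      i.inv_hom_id, Category.comp_id, Equiv.symm_apply_apply, ht']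
  · rintro m ⟨hm, e⟩
    let m' : Y ⟶ (c.reindex f).obj ((P.prod J X).obj α) :=
      mkVert (c.fill f _ (𝟙 _) m (id_comp_over hm)) (c.fill_over ..)
    have hm' : arr m' ≫ c.π f _ = m := by rw [arr_mkVert, fill_π]
    rw [P.ev_congr (y' := c.π (fst L X) Y ≫ arr m' ≫ c.π f _) (j' := fst L X ≫ f) _ rfl
      (by rw [hm']) (over_comp (c.π_over _ _) (hm'.symm ▸ hm)),
      ev_eq m' (hm'.symm ▸ hm), ← ht'] at e
    have e := c.π_ext (𝟙 _) (arr_over _) (arr_over _) e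
    have e : (P.transpose _ _).symm (m' ≫ i.hom) = t' := arr_ext e
    rw [Equiv.symm_apply_eq] at e
    have : m' = n ≫ i.inv := by rw [Iso.eq_comp_inv, e]
    rw [← hm', this]

end SplitCleavage.SimpleProducts

end Quantifiers

end

section

/-! ### Formal products -/

section FormalProducts

variable {B : Type u₁} [Category.{v₁} B] [CartesianMonoidalCategory B]
variable {E : Type u₂} [Category.{v₂} E] {p : E ⥤ B}

/-- An object `(K, U, α)` of the free completion of a fibration under simple products, with `α` in
the fibre over `K × U`: it stands for the product `∏_U α` over `K`. -/
structure FormalProd (c : SplitCleavage p) where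
  ctx : B
  ctr : B
  pred : p.Fiber (ctx ⊗ ctr)

namespace FormalProd

variable {c : SplitCleavage p}

/-- A morphism `(σ, f₁, t) : (K, U, α) ⟶ (L, V, β)` with `t : α(k, f₁(k, v)) ⟶ β(σ(k), v)`. The last
component is an arrow of the total category over `σ × 1_V` rather than a vertical one, which avoids
transport along equalities of objects. -/
structure Hom (S T : FormalProd c) where
  base : S.ctx ⟶ T.ctx
  bwd : S.ctx ⊗ T.ctr ⟶ S.ctr
  arrow : tot ((c.reindex (lift (fst S.ctx T.ctr) bwd)).obj S.pred) ⟶ tot T.pred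
  arrow_over : p.IsHomLift (base ▷ T.ctr) arrow

/-- The action of a morphism on generalized elements: over `k : L ⟶ K` and `v : L ⟶ V`, an arrow
`Z ⟶ α` over `⟨k, f₁(k, v)⟩` is sent to an arrow `Z ⟶ β` over `⟨σ(k), v⟩`. -/
noncomputable def Hom.app {S T : FormalProd c} (F : Hom S T) {L : B} (k : L ⟶ S.ctx)
    (v : L ⟶ T.ctr) {Z : E} (z : Z ⟶ tot S.pred)
    (hz : p.IsHomLift (lift k (lift k v ≫ F.bwd)) z) : Z ⟶ tot T.pred :=
  c.fill (lift (fst S.ctx T.ctr) F.bwd) S.pred (lift k v) z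
    (over_congr hz (by rw [comp_lift, lift_fst])) ≫ F.arrow

lemma Hom.app_over {S T : FormalProd c} (F : Hom S T) {L : B} (k : L ⟶ S.ctx)
    (v : L ⟶ T.ctr) {Z : E} (z : Z ⟶ tot S.pred)
    (hz : p.IsHomLift (lift k (lift k v ≫ F.bwd)) z) :
    p.IsHomLift (lift (k ≫ F.base) v) (F.app k v z hz) :=
  over_congr (over_comp (c.fill_over ..) F.arrow_over) (by ext <;> simp)

lemma Hom.comp_app {S T : FormalProd c} (F : Hom S T) {L L' : B} (k : L ⟶ S.ctx)
    (v : L ⟶ T.ctr) {Z Z' : E} (z : Z ⟶ tot S.pred)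
    (hz : p.IsHomLift (lift k (lift k v ≫ F.bwd)) z) {r : L' ⟶ L} {ρ : Z' ⟶ Z}
    (hρ : p.IsHomLift r ρ) :
    ρ ≫ F.app k v z hz = F.app (r ≫ k) (r ≫ v) (ρ ≫ z)
      (over_congr (over_comp hρ hz) (by ext <;> simp [← comp_lift])) := by
  rw [app, app, ← Category.assoc, c.comp_fill _ hρ]
  congr 1
  exact c.fill_eq _ (over_congr (c.fill_over ..) (by simp)) (c.fill_π ..)

lemma Hom.app_congr {S T : FormalProd c} (F : Hom S T) {L : B} {k k' : L ⟶ S.ctx}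
    {v v' : L ⟶ T.ctr} {Z : E} {z z' : Z ⟶ tot S.pred}
    (hz : p.IsHomLift (lift k (lift k v ≫ F.bwd)) z) (hk : k = k') (hv : v = v') (e : z = z')
    (hz' : p.IsHomLift (lift k' (lift k' v' ≫ F.bwd)) z') :
    F.app k v z hz = F.app k' v' z' hz' := by
  subst hk hv e
  rfl

/-- The last component of a morphism is its action on the generic element. -/
lemma Hom.app_generic {S T : FormalProd c} (F : Hom S T)
    (h : p.IsHomLift (lift (fst S.ctx T.ctr) (lift (fst S.ctx T.ctr) (snd S.ctx T.ctr) ≫ F.bwd))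
      (c.π (lift (fst S.ctx T.ctr) F.bwd) S.pred)) :
    F.app (fst S.ctx T.ctr) (snd S.ctx T.ctr) (c.π (lift (fst S.ctx T.ctr) F.bwd) S.pred) h =
      F.arrow := by
  rw [app, c.fill_eq (φ := 𝟙 _) _ (over_congr (tot_over _) (by simp)) (Category.id_comp _),
    Category.id_comp]

lemma Hom.ext_app {S T : FormalProd c} {F G : Hom S T} (h₁ : F.base = G.base)
    (h₂ : F.bwd = G.bwd)
    (h₃ : ∀ {L : B} (k : L ⟶ S.ctx) (v : L ⟶ T.ctr) {Z : E} (z : Z ⟶ tot S.pred)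
      (hz : p.IsHomLift (lift k (lift k v ≫ F.bwd)) z)
      (hz' : p.IsHomLift (lift k (lift k v ≫ G.bwd)) z), F.app k v z hz = G.app k v z hz') :
    F = G := by
  obtain ⟨a, b, t, ht⟩ := F
  obtain ⟨a', b', t', ht'⟩ := G
  dsimp only at h₁ h₂
  subst h₁ h₂
  have h : p.IsHomLift (lift (fst S.ctx T.ctr) (lift (fst S.ctx T.ctr) (snd S.ctx T.ctr) ≫ b))
      (c.π (lift (fst S.ctx T.ctr) b) S.pred) := over_congr (c.π_over _ _) (by simp)
  have := h₃ (fst S.ctx T.ctr) (snd S.ctx T.ctr) (c.π (lift (fst S.ctx T.ctr) b) S.pred) h h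
  have h₄ := app_generic ⟨a, b, t, ht⟩ h
  have h₅ := app_generic ⟨a, b, t', ht'⟩ h
  dsimp only at h₄ h₅
  obtain rfl : t = t' := by rw [← h₄, ← h₅, this]
  rfl

lemma Hom.mk_congr {S T : FormalProd c} {a a' : S.ctx ⟶ T.ctx} {b : S.ctx ⊗ T.ctr ⟶ S.ctr}
    {t t' : tot ((c.reindex (lift (fst S.ctx T.ctr) b)).obj S.pred) ⟶ tot T.pred} (ha : a = a')
    (ht : t = t') (h : p.IsHomLift (a ▷ T.ctr) t) (h' : p.IsHomLift (a' ▷ T.ctr) t') :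
    Hom.mk a b t h = Hom.mk a' b t' h' := by
  subst ha ht
  rfl

/-- The identity morphism `(1, π_U, 1)`. -/
noncomputable def Hom.id (S : FormalProd c) : Hom S S where
  base := 𝟙 _
  bwd := snd _ _
  arrow := c.π _ S.pred
  arrow_over := over_congr (c.π_over _ _) (by simp)

/-- The composite `(σ, f₁, t) ≫ (τ, g₁, s) = (τ ∘ σ, f₁(k, g₁(σ(k), w)), s ∘ t)`. -/
noncomputable def Hom.comp {S T R : FormalProd c} (F : Hom S T) (G : Hom T R) : Hom S R where
  base := F.base ≫ G.base
  bwd := lift (fst S.ctx R.ctr) (F.base ▷ R.ctr ≫ G.bwd) ≫ F.bwd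
  arrow := G.app (fst S.ctx R.ctr ≫ F.base) (snd S.ctx R.ctr)
    (F.app (fst S.ctx R.ctr) (F.base ▷ R.ctr ≫ G.bwd) (c.π _ S.pred) (c.π_over _ _))
    (over_congr (F.app_over _ _ _ _) (by
      congr 2
      ext <;> simp))
  arrow_over := over_congr (G.app_over _ _ _ _) (by ext <;> simp)

lemma Hom.id_app {S : FormalProd c} {L : B} (k : L ⟶ S.ctx) (v : L ⟶ S.ctr) {Z : E}
    (z : Z ⟶ tot S.pred) (hz : p.IsHomLift (lift k (lift k v ≫ (Hom.id S).bwd)) z) :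
    (Hom.id S).app k v z hz = z :=
  c.fill_π ..

@[simp]
lemma Hom.comp_base {S T R : FormalProd c} (F : Hom S T) (G : Hom T R) :
    (F.comp G).base = F.base ≫ G.base := rfl

lemma Hom.comp_bwd {S T R : FormalProd c} (F : Hom S T) (G : Hom T R) :
    (F.comp G).bwd = lift (fst S.ctx R.ctr) (F.base ▷ R.ctr ≫ G.bwd) ≫ F.bwd := rfl

lemma Hom.lift_comp_bwd {S T R : FormalProd c} (F : Hom S T) (G : Hom T R) {L : B}
    (k : L ⟶ S.ctx) (w : L ⟶ R.ctr) :
    lift k w ≫ (F.comp G).bwd = lift k (lift (k ≫ F.base) w ≫ G.bwd) ≫ F.bwd := by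
  have e : lift k w ≫ F.base ▷ R.ctr = lift (k ≫ F.base) w := by ext <;> simp
  rw [comp_bwd, ← Category.assoc, comp_lift, lift_fst, ← Category.assoc, e]

lemma Hom.ext_lift {S T : FormalProd c} {f g : S.ctx ⊗ T.ctr ⟶ S.ctr}
    (h : lift (fst S.ctx T.ctr) (snd S.ctx T.ctr) ≫ f =
      lift (fst S.ctx T.ctr) (snd S.ctx T.ctr) ≫ g) : f = g := by
  simpa using h

lemma Hom.comp_app_eq {S T R : FormalProd c} (F : Hom S T) (G : Hom T R) {L : B}
    (k : L ⟶ S.ctx) (w : L ⟶ R.ctr) {Z : E} (z : Z ⟶ tot S.pred)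
    (hz : p.IsHomLift (lift k (lift k w ≫ (F.comp G).bwd)) z)
    (hz' : p.IsHomLift (lift k (lift k (lift (k ≫ F.base) w ≫ G.bwd) ≫ F.bwd)) z) :
    (F.comp G).app k w z hz = G.app (k ≫ F.base) w
      (F.app k (lift (k ≫ F.base) w ≫ G.bwd) z hz') (F.app_over _ _ _ _) := by
  have e : lift k w ≫ F.base ▷ R.ctr = lift (k ≫ F.base) w := by ext <;> simp
  have h : p.IsHomLift (lift (fst S.ctx R.ctr ≫ F.base)
      (lift (fst S.ctx R.ctr ≫ F.base) (snd S.ctx R.ctr) ≫ G.bwd))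
      (F.app (fst S.ctx R.ctr) (F.base ▷ R.ctr ≫ G.bwd) (c.π _ S.pred) (c.π_over _ _)) :=
    over_congr (F.app_over _ _ _ _) (by
      congr 2
      ext <;> simp)
  refine (comp_app G _ _ _ h (c.fill_over _ _ _ _
    (over_congr hz (by rw [comp_lift, lift_fst]; rfl)))).trans ?_
  refine G.app_congr _ (by simp) (by simp) ?_ _
  rw [comp_app F _ _ _ _ (c.fill_over ..)]
  refine F.app_congr _ (by simp) (by rw [← Category.assoc, e]) ?_ _
  exact c.fill_π ..

lemma Hom.id_comp {S T : FormalProd c} (F : Hom S T) : (Hom.id S).comp F = F := by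
  refine ext_app (Category.id_comp _) (by simp [comp, id]) ?_
  intro L k v Z z hz hz'
  rw [comp_app_eq _ _ _ _ _ _ (over_congr hz (by simp [comp, id]))]
  exact F.app_congr _ (Category.comp_id _) rfl (id_app ..) _

lemma Hom.comp_id {S T : FormalProd c} (F : Hom S T) : F.comp (Hom.id T) = F := by
  have e : (F.comp (Hom.id T)).bwd = F.bwd := by
    simp [comp, id]
  refine ext_app (Category.comp_id _) e ?_
  intro L k v Z z hz hz'
  rw [comp_app_eq _ _ _ _ _ _ (over_congr hz' (by simp [id])), id_app]
  exact F.app_congr _ rfl (by simp [id]) rfl _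

lemma Hom.assoc {S T R Q : FormalProd c} (F : Hom S T) (G : Hom T R) (H : Hom R Q) :
    (F.comp G).comp H = F.comp (G.comp H) := by
  refine ext_app (Category.assoc _ _ _) (ext_lift ?_) ?_
  · simp only [lift_comp_bwd, comp_base, Category.assoc]
  intro L k v Z z hz hz'
  have h₁ : p.IsHomLift (lift k (lift k (lift (k ≫ (F.comp G).base) v ≫ H.bwd) ≫
      (F.comp G).bwd)) z := over_congr hz (by rw [lift_comp_bwd])
  have h₂ : p.IsHomLift (lift k (lift k (lift (k ≫ F.base)
      (lift (k ≫ (F.comp G).base) v ≫ H.bwd) ≫ G.bwd) ≫ F.bwd)) z :=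
    over_congr h₁ (by rw [lift_comp_bwd])
  have h₃ : p.IsHomLift (lift k (lift k (lift (k ≫ F.base) v ≫ (G.comp H).bwd) ≫ F.bwd)) z :=
    over_congr hz' (by rw [lift_comp_bwd])
  have h₄ : p.IsHomLift (lift (k ≫ F.base) (lift (k ≫ F.base)
      (lift ((k ≫ F.base) ≫ G.base) v ≫ H.bwd) ≫ G.bwd))
      (F.app k (lift (k ≫ F.base) v ≫ (G.comp H).bwd) z h₃) :=
    over_congr (F.app_over _ _ _ _) (by rw [lift_comp_bwd])
  have e₁ := comp_app_eq (F.comp G) H k v z hz h₁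
  have e₂ := comp_app_eq F G k _ z h₁ h₂
  have e₃ := comp_app_eq F (G.comp H) k v z hz' h₃
  have e₄ := comp_app_eq G H (k ≫ F.base) v _ (F.app_over _ _ _ _) h₄
  refine e₁.trans (.trans ?_ (e₄.symm.trans e₃.symm))
  have e : k ≫ (F.comp G).base = (k ≫ F.base) ≫ G.base := (Category.assoc _ _ _).symm
  refine H.app_congr _ e rfl (e₂.trans ?_) _
  refine G.app_congr _ rfl (by rw [e]) ?_ _
  exact F.app_congr _ rfl (by rw [lift_comp_bwd, e]) rfl _

noncomputable instance : Category (FormalProd c) where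
  Hom := Hom
  id := Hom.id
  comp := Hom.comp
  id_comp := Hom.id_comp
  comp_id := Hom.comp_id
  assoc := Hom.assoc

/-- The underlying context of a formal product. -/
def proj (c : SplitCleavage p) : FormalProd c ⥤ B where
  obj S := S.ctx
  map F := Hom.base F

lemma lift_base {S T : FormalProd c} (F : S ⟶ T) : (proj c).IsHomLift F.base F :=
  inferInstanceAs ((proj c).IsHomLift ((proj c).map F) F)

lemma lift_iff {S T : FormalProd c} {u : S.ctx ⟶ T.ctx} {F : S ⟶ T} :
    (proj c).IsHomLift u F ↔ F.base = u :=
  ⟨fun h => over_unique (lift_base F) h, fun h => h ▸ lift_base F⟩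

@[simp]
lemma base_id (S : FormalProd c) : Hom.base (𝟙 S) = 𝟙 S.ctx := rfl

@[simp]
lemma base_comp {S T R : FormalProd c} (F : S ⟶ T) (G : T ⟶ R) :
    Hom.base (F ≫ G) = F.base ≫ G.base := rfl

lemma lift_bwd_comp {S T R : FormalProd c} (F : S ⟶ T) (G : T ⟶ R) {L : B}
    (k : L ⟶ S.ctx) (w : L ⟶ R.ctr) :
    lift k w ≫ Hom.bwd (F ≫ G) = lift k (lift (k ≫ F.base) w ≫ G.bwd) ≫ F.bwd :=
  Hom.lift_comp_bwd F G k w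

lemma app_comp {S T R : FormalProd c} (F : S ⟶ T) (G : T ⟶ R) {L : B}
    (k : L ⟶ S.ctx) (w : L ⟶ R.ctr) {Z : E} (z : Z ⟶ tot S.pred)
    (hz : p.IsHomLift (lift k (lift k w ≫ Hom.bwd (F ≫ G))) z)
    (hz' : p.IsHomLift (lift k (lift k (lift (k ≫ F.base) w ≫ G.bwd) ≫ F.bwd)) z) :
    Hom.app (F ≫ G) k w z hz = G.app (k ≫ F.base) w
      (F.app k (lift (k ≫ F.base) w ≫ G.bwd) z hz') (F.app_over _ _ _ _) :=
  Hom.comp_app_eq F G k w z hz hz'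

lemma hom_ext {S T : FormalProd c} {F G : S ⟶ T} (h₁ : F.base = G.base)
    (h₂ : ∀ {L : B} (k : L ⟶ S.ctx) (v : L ⟶ T.ctr), lift k v ≫ F.bwd = lift k v ≫ G.bwd)
    (h₃ : ∀ {L : B} (k : L ⟶ S.ctx) (v : L ⟶ T.ctr) {Z : E} (z : Z ⟶ tot S.pred)
      (hz : p.IsHomLift (lift k (lift k v ≫ F.bwd)) z)
      (hz' : p.IsHomLift (lift k (lift k v ≫ G.bwd)) z), F.app k v z hz = G.app k v z hz') :
    F = G :=
  Hom.ext_app h₁ (Hom.ext_lift (h₂ _ _)) h₃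

/-! ### Reindexing formal products -/

/-- The reindexing of a formal product along an arrow of the base. -/
noncomputable abbrev reindex {K : B} (T : FormalProd c) (u : K ⟶ T.ctx) : FormalProd c where
  ctx := K
  ctr := T.ctr
  pred := (c.reindex (u ▷ T.ctr)).obj T.pred

/-- The cartesian morphism from the reindexing of a formal product. -/
noncomputable def cart {K : B} (T : FormalProd c) (u : K ⟶ T.ctx) : T.reindex u ⟶ T where
  base := u
  bwd := snd _ _
  arrow := c.π _ _ ≫ c.π _ _
  arrow_over := over_congr (over_comp (c.π_over _ _) (c.π_over _ _))
    (show lift (fst K T.ctr) (snd K T.ctr) ≫ u ▷ T.ctr = u ▷ T.ctr by simp)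

@[simp]
lemma cart_base {K : B} (T : FormalProd c) (u : K ⟶ T.ctx) : (T.cart u).base = u := rfl

@[simp]
lemma cart_bwd {K : B} (T : FormalProd c) (u : K ⟶ T.ctx) : (T.cart u).bwd = snd _ _ := rfl

lemma cart_app {K : B} (T : FormalProd c) (u : K ⟶ T.ctx) {L : B} (k : L ⟶ K) (v : L ⟶ T.ctr)
    {Z : E} (z : Z ⟶ tot ((c.reindex (u ▷ T.ctr)).obj T.pred))
    (hz : p.IsHomLift (lift k (lift k v ≫ (T.cart u).bwd)) z) :
    (T.cart u).app k v z hz = z ≫ c.π _ _ :=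
  c.fill_π_assoc _ _ _ _ _ _

/-- The universal property of the reindexing of a formal product. -/
noncomputable def liftCart {K : B} {T : FormalProd c} {u : K ⟶ T.ctx} {R : FormalProd c}
    (h : R ⟶ T) (w : R.ctx ⟶ K) (e : h.base = w ≫ u) : R ⟶ T.reindex u where
  base := w
  bwd := h.bwd
  arrow := c.fill (u ▷ T.ctr) T.pred (w ▷ T.ctr) h.arrow
    (over_congr h.arrow_over (by rw [e, comp_whiskerRight]))
  arrow_over := c.fill_over ..

@[simp]
lemma liftCart_base {K : B} {T : FormalProd c} {u : K ⟶ T.ctx} {R : FormalProd c}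
    (h : R ⟶ T) (w : R.ctx ⟶ K) (e : h.base = w ≫ u) : (liftCart h w e).base = w := rfl

@[simp]
lemma liftCart_cart {K : B} {T : FormalProd c} {u : K ⟶ T.ctx} {R : FormalProd c}
    (h : R ⟶ T) (w : R.ctx ⟶ K) (e : h.base = w ≫ u) : liftCart h w e ≫ T.cart u = h := by
  refine hom_ext e.symm ?_ ?_
  · intro L k v
    rw [lift_bwd_comp, cart_bwd, lift_snd]
    rfl
  · intro L k v Z z hz hz'
    have hz₁ : p.IsHomLift (lift k (lift k (lift (k ≫ (liftCart h w e).base) v ≫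
        (T.cart u).bwd) ≫ (liftCart h w e).bwd)) z := over_congr hz (by rw [lift_bwd_comp])
    refine (app_comp _ _ _ _ _ hz hz₁).trans ((cart_app T u _ _ _ _).trans ?_)
    rw [Hom.app, Hom.app, Category.assoc]
    congr 1
    · congr 1
      simp
    · exact c.fill_π _ _ _ _ (over_congr h.arrow_over (by rw [e, comp_whiskerRight]))

lemma cart_ext {K : B} {T : FormalProd c} {u : K ⟶ T.ctx} {R : FormalProd c}
    {f g : R ⟶ T.reindex u} (h₁ : f.base = g.base) (h₂ : f ≫ T.cart u = g ≫ T.cart u) :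
    f = g := by
  have hb : ∀ {L : B} (k : L ⟶ R.ctx) (v : L ⟶ T.ctr), lift k v ≫ f.bwd = lift k v ≫ g.bwd := by
    intro L k v
    have := congrArg (fun t => lift k v ≫ Hom.bwd t) h₂
    simpa only [lift_bwd_comp, cart_bwd, lift_snd] using this
  refine hom_ext h₁ hb ?_
  intro L k (v : L ⟶ T.ctr) Z z hz hz'
  refine c.π_ext (lift (k ≫ f.base) v) (f.app_over _ _ _ _)
    (over_congr (g.app_over _ _ _ _) (by rw [h₁])) ?_
  have hf : p.IsHomLift (lift k (lift k v ≫ Hom.bwd (f ≫ T.cart u : R ⟶ T))) z :=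
    over_congr hz (by rw [lift_bwd_comp, cart_bwd, lift_snd])
  have hg : p.IsHomLift (lift k (lift k v ≫ Hom.bwd (g ≫ T.cart u : R ⟶ T))) z := h₂ ▸ hf
  have h : Hom.app (f ≫ T.cart u : R ⟶ T) k v z hf = Hom.app (g ≫ T.cart u : R ⟶ T) k v z hg := by
    simp only [h₂]
  rw [app_comp _ _ _ _ _ hf (over_congr hz (by rw [cart_bwd, lift_snd])),
    app_comp _ _ _ _ _ hg (over_congr hz' (by rw [cart_bwd, lift_snd])), cart_app, cart_app] at h
  convert h using 2
  · exact f.app_congr _ rfl (by simp) rfl _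
  · exact g.app_congr _ rfl (by simp) rfl _

lemma cart_cartesian {K : B} (T : FormalProd c) (u : K ⟶ T.ctx) :
    (proj c).IsStronglyCartesian u (T.cart u) := by
  have : (proj c).IsHomLift u (T.cart u) := lift_base (T.cart u)
  refine ⟨?_⟩
  intro R w h hh
  have e : h.base = w ≫ u := lift_iff.1 hh
  refine ⟨liftCart h w e, ⟨lift_iff.2 (liftCart_base h w e), liftCart_cart h w e⟩, ?_⟩
  rintro g ⟨hg₁, hg₂⟩
  exact cart_ext (lift_iff.1 hg₁) (hg₂.trans (liftCart_cart h w e).symm)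

lemma isIso_cart {K : B} (T : FormalProd c) (u : K ⟶ T.ctx) [IsIso u] : IsIso (T.cart u) :=
  have := T.cart_cartesian u
  Functor.IsStronglyCartesian.isIso_of_base_isIso (proj c) u (T.cart u)

end FormalProd

end FormalProducts

end

section

/-! ### The Dialectica category in terms of formal products -/

namespace Dial

variable {B : Type u₁} [Category.{v₁} B] [CartesianMonoidalCategory B]
variable {E : Type u₂} [Category.{v₂} E] {p : E ⥤ B} {c : SplitCleavage p}

/-- The formal product `(I × X, U, α)` under the existential quantifier of `(I, X, U, α)`. -/
abbrev fam (S : Dial c) : FormalProd c := ⟨S.ctx ⊗ S.wit, S.ctr, S.pred⟩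

/-- The morphism of formal products underlying a Dialectica morphism. -/
noncomputable def Hom.fam {S T : Dial c} (F : Hom S T) : S.fam ⟶ T.fam where
  base := F.sub
  bwd := F.bwd
  arrow := arr F.vert ≫ c.π _ _
  arrow_over := vert_comp_over (arr_over _) (c.π_over _ _)

lemma Hom.fam_id (S : Dial c) : (Hom.id S).fam = 𝟙 S.fam := by
  have h₁ : (Hom.id S).sub = 𝟙 _ := subst_id ..
  have h₂ : (Hom.id S).sub ▷ S.ctr = lift (fst (S.ctx ⊗ S.wit) S.ctr) (snd _ _) := by
    rw [h₁, id_whiskerRight, lift_fst_snd]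
  have h₃ : arr (Hom.id S).vert ≫ c.π ((Hom.id S).sub ▷ S.ctr) S.pred =
      c.π (lift (fst (S.ctx ⊗ S.wit) S.ctr) (snd _ _)) S.pred := by
    refine (c.eqToHom_π_congr h₂ S.pred
      (congrArg (fun t => (c.reindex t).obj S.pred) h₂.symm) rfl).trans ?_
    rw [eqToHom_refl, arr_id, Category.id_comp]
  exact FormalProd.Hom.mk_congr h₁ h₃ _ _

lemma Hom.fam_comp {S T R : Dial c} (F : Hom S T) (G : Hom T R) :
    (F.comp G).fam = F.fam ≫ G.fam := by
  have h₁ : (F.comp G).sub = F.sub ≫ G.sub := subst_comp ..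
  refine FormalProd.Hom.mk_congr h₁ ?_ _ _
  have e₁ : arr (eqToHom (F.comp_eq₁ G)) ≫ c.π (F.mid G) _ =
      c.fill (lift (fst (S.ctx ⊗ S.wit) T.ctr) F.bwd) S.pred (F.mid G)
        (c.π (lift (fst (S.ctx ⊗ S.wit) R.ctr) (F.mid G ≫ F.bwd)) S.pred)
        (over_congr (c.π_over _ _) (by rw [comp_lift, lift_fst])) := by
    symm
    refine c.fill_eq _ (vert_comp_over (arr_over _) (c.π_over _ _)) ?_
    rw [Category.assoc]
    have e : (c.reindex (lift (fst (S.ctx ⊗ S.wit) R.ctr) (F.mid G ≫ F.bwd))).obj S.pred =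
        (c.reindex (F.mid G ≫ lift (fst (S.ctx ⊗ S.wit) T.ctr) F.bwd)).obj S.pred := by
      rw [comp_lift, lift_fst]
    rw [c.eqToHom_π_comp _ _ _ e, c.eqToHom_π_congr (by rw [comp_lift, lift_fst]) S.pred e rfl,
      eqToHom_refl, arr_id, Category.id_comp]
  have e₂ : arr (eqToHom (F.comp_eq₂ G)) ≫ c.π (F.sub ▷ R.ctr) _ ≫
      c.π (lift (fst (T.ctx ⊗ T.wit) R.ctr) G.bwd) T.pred =
        c.π (F.mid G) _ ≫ c.π (F.sub ▷ T.ctr) T.pred := by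
    have e : (c.reindex (F.mid G)).obj ((c.reindex (F.sub ▷ T.ctr)).obj T.pred) =
        (c.reindex (F.mid G ≫ F.sub ▷ T.ctr)).obj T.pred := (c.reindex_obj_comp ..).symm
    have h : F.sub ▷ R.ctr ≫ lift (fst (T.ctx ⊗ T.wit) R.ctr) G.bwd = F.mid G ≫ F.sub ▷ T.ctr := by
      rw [comp_lift, whiskerRight_fst, lift_whiskerRight]
    have e' : (c.reindex (F.mid G)).obj ((c.reindex (F.sub ▷ T.ctr)).obj T.pred) =
        (c.reindex (F.sub ▷ R.ctr ≫ lift (fst (T.ctx ⊗ T.wit) R.ctr) G.bwd)).obj T.pred := by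
      rw [h, e]
    rw [c.eqToHom_π_comp _ _ _ e', c.eqToHom_π_congr h T.pred e' e, ← c.eqToHom_π_comp _ _ _ e rfl,
      eqToHom_refl, arr_id, Category.id_comp]
  have e₃ : arr (eqToHom (F.comp_eq₃ G)) ≫
      c.π (subst (F.base ≫ G.base) (F.sub ≫ G.fwd) ▷ R.ctr) R.pred =
      c.π (F.sub ▷ R.ctr) _ ≫ c.π (G.sub ▷ R.ctr) R.pred := by
    have e : (c.reindex (F.sub ▷ R.ctr)).obj ((c.reindex (G.sub ▷ R.ctr)).obj R.pred) =
        (c.reindex (F.sub ▷ R.ctr ≫ G.sub ▷ R.ctr)).obj R.pred := (c.reindex_obj_comp ..).symm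
    have h : subst (F.base ≫ G.base) (F.sub ≫ G.fwd) ▷ R.ctr =
        F.sub ▷ R.ctr ≫ G.sub ▷ R.ctr := by rw [subst_comp, comp_whiskerRight]
    rw [c.eqToHom_π_congr h R.pred (F.comp_eq₃ G) e, ← c.eqToHom_π_comp _ _ _ e rfl,
      eqToHom_refl, arr_id, Category.id_comp]
  -- the two middle factors of the composite are the factorization of the first morphism through
  -- the domain of the second
  have e₄ : arr (eqToHom (F.comp_eq₁ G)) ≫ arr ((c.reindex (F.mid G)).map F.vert) ≫
      arr (eqToHom (F.comp_eq₂ G)) ≫ c.π (F.sub ▷ R.ctr) _ =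
        c.fill (lift (fst (T.ctx ⊗ T.wit) R.ctr) G.bwd) T.pred (F.sub ▷ R.ctr)
          (c.fill (lift (fst (S.ctx ⊗ S.wit) T.ctr) F.bwd) S.pred (F.mid G)
            (c.π (lift (fst (S.ctx ⊗ S.wit) R.ctr) (F.mid G ≫ F.bwd)) S.pred)
            (over_congr (c.π_over _ _) (by rw [comp_lift, lift_fst])) ≫
              arr F.vert ≫ c.π (F.sub ▷ T.ctr) T.pred)
          (over_congr (over_comp (c.fill_over ..)
            (vert_comp_over (arr_over F.vert) (c.π_over _ _))) (by
              rw [comp_lift, whiskerRight_fst, lift_whiskerRight])) := by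
    symm
    refine c.fill_eq _ (vert_comp_over (arr_over _) (vert_comp_over (arr_over _)
      (vert_comp_over (arr_over _) (c.π_over _ _)))) ?_
    rw [← e₁]
    simp only [Category.assoc]
    rw [e₂, ← Category.assoc (arr ((c.reindex (F.mid G)).map F.vert)), c.arr_reindex_π]
    simp only [Category.assoc]
  have e₅ : (arr (eqToHom (F.comp_eq₁ G)) ≫ arr ((c.reindex (F.mid G)).map F.vert) ≫
      arr (eqToHom (F.comp_eq₂ G)) ≫ arr ((c.reindex (F.sub ▷ R.ctr)).map G.vert) ≫
        arr (eqToHom (F.comp_eq₃ G))) ≫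
          c.π (subst (F.base ≫ G.base) (F.sub ≫ G.fwd) ▷ R.ctr) R.pred =
      (arr (eqToHom (F.comp_eq₁ G)) ≫ arr ((c.reindex (F.mid G)).map F.vert) ≫
      arr (eqToHom (F.comp_eq₂ G)) ≫ c.π (F.sub ▷ R.ctr) _) ≫
        arr G.vert ≫ c.π (G.sub ▷ R.ctr) R.pred := by
    simp only [Category.assoc]
    rw [e₃, ← Category.assoc (arr ((c.reindex (F.sub ▷ R.ctr)).map G.vert)), c.arr_reindex_π]
    simp only [Category.assoc]
  have hw : F.sub ▷ R.ctr = lift (fst (S.ctx ⊗ S.wit) R.ctr ≫ F.sub) (snd _ _) := by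
    ext <;> simp
  have hw' : F.mid G = lift (fst (S.ctx ⊗ S.wit) R.ctr) (F.sub ▷ R.ctr ≫ G.bwd) := rfl
  refine e₅.trans ?_
  rw [e₄]
  exact congrArg (· ≫ arr G.vert ≫ c.π (G.sub ▷ R.ctr) R.pred) (c.fill_congr hw rfl _ _)

/-- A Dialectica morphism is given by an arrow of the base and a compatible morphism of the formal
products under the existential quantifiers. -/
noncomputable def Hom.ofFam {S T : Dial c} (f : S.ctx ⟶ T.ctx) (m : S.fam ⟶ T.fam)
    (h : m.base ≫ fst T.ctx T.wit = fst S.ctx S.wit ≫ f) : Hom S T where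
  base := f
  fwd := m.base ≫ snd T.ctx T.wit
  bwd := m.bwd
  vert := mkVert (c.fill (subst f (m.base ≫ snd T.ctx T.wit) ▷ T.ctr) T.pred (𝟙 _) m.arrow
    (id_comp_over (over_congr m.arrow_over (by rw [subst, ← h, lift_comp_fst_snd]))))
      (c.fill_over ..)

@[simp]
lemma Hom.ofFam_base {S T : Dial c} (f : S.ctx ⟶ T.ctx) (m : S.fam ⟶ T.fam)
    (h : m.base ≫ fst T.ctx T.wit = fst S.ctx S.wit ≫ f) : (Hom.ofFam f m h).base = f := rfl

@[simp]
lemma Hom.ofFam_fam {S T : Dial c} (f : S.ctx ⟶ T.ctx) (m : S.fam ⟶ T.fam)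
    (h : m.base ≫ fst T.ctx T.wit = fst S.ctx S.wit ≫ f) : (Hom.ofFam f m h).fam = m := by
  have e : subst f (m.base ≫ snd T.ctx T.wit) = m.base := by
    rw [subst, ← h, lift_comp_fst_snd]
  exact FormalProd.Hom.mk_congr (b := m.bwd) e
    (c.fill_π _ _ _ _ (id_comp_over (over_congr m.arrow_over (congrArg (· ▷ T.ctr) e.symm)))) _
    m.arrow_over

lemma Hom.fam_base_fst {S T : Dial c} (F : Hom S T) :
    F.fam.base ≫ fst T.ctx T.wit = fst S.ctx S.wit ≫ F.base := subst_fst ..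

lemma Hom.ext_fam {S T : Dial c} {F G : Hom S T} (h₁ : F.base = G.base) (h₂ : F.fam = G.fam) :
    F = G := by
  obtain ⟨f, f₀, f₁, φ⟩ := F
  obtain ⟨g, g₀, g₁, ψ⟩ := G
  obtain rfl : f = g := h₁
  have e₀ := congrArg (fun m => FormalProd.Hom.base m ≫ snd T.ctx T.wit) h₂
  obtain rfl : f₀ = g₀ := (subst_snd f f₀).symm.trans (e₀.trans (subst_snd f g₀))
  obtain rfl : f₁ = g₁ := congrArg FormalProd.Hom.bwd h₂
  have e : arr φ ≫ c.π _ _ = arr ψ ≫ c.π _ _ := eq_of_heq (FormalProd.Hom.mk.inj h₂).2.2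
  rw [arr_ext (c.π_ext (𝟙 _) (arr_over φ) (arr_over ψ) e)]

lemma lift_base {S T : Dial c} (F : S ⟶ T) : (proj c).IsHomLift F.base F :=
  inferInstanceAs ((proj c).IsHomLift ((proj c).map F) F)

lemma lift_iff {S T : Dial c} {u : S.ctx ⟶ T.ctx} {F : S ⟶ T} :
    (proj c).IsHomLift u F ↔ F.base = u :=
  ⟨fun h => over_unique (lift_base F) h, fun h => h ▸ lift_base F⟩

lemma comp_base {S T R : Dial c} (F : S ⟶ T) (G : T ⟶ R) :
    Hom.base (F ≫ G) = F.base ≫ G.base := rfl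

lemma comp_fam {S T R : Dial c} (F : S ⟶ T) (G : T ⟶ R) :
    Hom.fam (F ≫ G) = F.fam ≫ G.fam := Hom.fam_comp F G

lemma inv_base_comp {S T : FormalProd c} (m : S ⟶ T) [IsIso m] :
    FormalProd.Hom.base (inv m) ≫ m.base = 𝟙 _ := by
  rw [← FormalProd.base_comp, IsIso.inv_hom_id, FormalProd.base_id]

/-- A Dialectica morphism which is invertible on formal products is cocartesian: it exhibits its
codomain as an existential quantification of its domain. -/
lemma existsUnique_desc {S T R : Dial c} (ζ : S ⟶ T) [IsIso ζ.fam] (k : S ⟶ R)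
    (f : T.ctx ⟶ R.ctx) (hk : k.base = ζ.base ≫ f) : ∃! h : T ⟶ R, h.base = f ∧ ζ ≫ h = k := by
  have hb : FormalProd.Hom.base (inv ζ.fam ≫ k.fam) ≫ fst R.ctx R.wit =
      fst T.ctx T.wit ≫ f := by
    have h₁ := k.fam_base_fst
    have h₂ := ζ.fam_base_fst
    have h₃ := inv_base_comp ζ.fam
    rw [FormalProd.base_comp, Category.assoc, h₁, hk, ← Category.assoc (fst S.ctx S.wit), ← h₂,
      Category.assoc, ← Category.assoc (FormalProd.Hom.base (inv ζ.fam : T.fam ⟶ S.fam)), h₃,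
      Category.id_comp]
  refine ⟨Hom.ofFam f _ hb, ⟨rfl, Hom.ext_fam ?_ ?_⟩, ?_⟩
  · exact hk.symm
  · refine (comp_fam ..).trans ?_
    rw [Hom.ofFam_fam, IsIso.hom_inv_id_assoc]
  · rintro h ⟨h₁, h₂⟩
    refine Hom.ext_fam h₁ ?_
    rw [Hom.ofFam_fam, ← h₂, comp_fam, IsIso.inv_hom_id_assoc]

/-- If the projection `R.ctx × R.wit ⟶ R.ctx` is invertible, morphisms out of `R` lift uniquely
along Dialectica morphisms which are invertible on formal products: an object without existential
quantifier cannot tell an existential statement from its matrix. -/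
lemma existsUnique_lift {S T R : Dial c} (ζ : S ⟶ T) [IsIso ζ.fam] [IsIso (fst R.ctx R.wit)]
    (h : R ⟶ T) : ∃! k : R ⟶ S, k ≫ ζ = h := by
  have hb : FormalProd.Hom.base (h.fam ≫ inv ζ.fam) ≫ fst S.ctx S.wit =
      fst R.ctx R.wit ≫ inv (fst R.ctx R.wit) ≫
        FormalProd.Hom.base (h.fam ≫ inv ζ.fam) ≫ fst S.ctx S.wit := by
    rw [IsIso.hom_inv_id_assoc]
  refine ⟨Hom.ofFam _ _ hb, Hom.ext_fam ?_ ?_, ?_⟩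
  · have h₁ := h.fam_base_fst
    have h₂ := ζ.fam_base_fst
    have h₃ := inv_base_comp ζ.fam
    rw [comp_base, Hom.ofFam_base, FormalProd.base_comp, Category.assoc, Category.assoc,
      Category.assoc, ← h₂, ← Category.assoc (FormalProd.Hom.base (inv ζ.fam : T.fam ⟶ S.fam)), h₃,
      Category.id_comp, h₁, IsIso.inv_hom_id_assoc]
  · refine (comp_fam ..).trans ?_
    rw [Hom.ofFam_fam, Category.assoc, IsIso.inv_hom_id, Category.comp_id]
  · rintro k rfl
    have e : k.fam = Hom.fam (k ≫ ζ) ≫ inv ζ.fam := by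
      rw [comp_fam, Category.assoc, IsIso.hom_inv_id, Category.comp_id]
    refine Hom.ext_fam ?_ ?_
    · rw [Hom.ofFam_base, ← e, k.fam_base_fst, IsIso.inv_hom_id_assoc]
    · rw [Hom.ofFam_fam, e]

instance isIso_fst_unit (X : B) : IsIso (fst X (𝟙_ B)) := by
  rw [← rightUnitor_hom]
  infer_instance

/-- A formal product, seen as a Dialectica object with trivial witness type. -/
noncomputable abbrev ofProdObj (K : FormalProd c) : Dial c :=
  ⟨K.ctx, 𝟙_ B, K.ctr, (c.reindex (fst K.ctx (𝟙_ B) ▷ K.ctr)).obj K.pred⟩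

/-- The identification of a formal product with the one underlying its Dialectica object. -/
noncomputable def famIso (K : FormalProd c) : (ofProdObj K).fam ≅ K :=
  have := K.isIso_cart (fst K.ctx (𝟙_ B))
  @asIso _ _ (K.reindex (fst K.ctx (𝟙_ B))) K (K.cart (fst K.ctx (𝟙_ B))) this

lemma famIso_hom_base (K : FormalProd c) : (famIso K).hom.base = fst K.ctx (𝟙_ B) := rfl

lemma famIso_inv_base (K : FormalProd c) : (famIso K).inv.base ≫ fst K.ctx (𝟙_ B) = 𝟙 _ := by
  rw [← famIso_hom_base, ← FormalProd.base_comp, Iso.inv_hom_id, FormalProd.base_id]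

lemma conj_famIso_base {K L : FormalProd c} (m : K ⟶ L) :
    FormalProd.Hom.base ((famIso K).hom ≫ m ≫ (famIso L).inv) ≫ fst L.ctx (𝟙_ B) =
      fst K.ctx (𝟙_ B) ≫ m.base := by
  rw [FormalProd.base_comp, FormalProd.base_comp, Category.assoc, Category.assoc,
    famIso_inv_base, Category.comp_id, famIso_hom_base]

/-- Formal products form a full subcategory of the Dialectica category. -/
noncomputable abbrev ofProd (c : SplitCleavage p) : FormalProd c ⥤ Dial c where
  obj K := ofProdObj K
  map {K L} m := Hom.ofFam m.base ((famIso K).hom ≫ m ≫ (famIso L).inv) (conj_famIso_base m)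
  map_id K := Hom.ext_fam rfl (by
    rw [Hom.ofFam_fam, Category.id_comp, Iso.hom_inv_id]
    exact (Hom.fam_id _).symm)
  map_comp m n := Hom.ext_fam rfl (by
    refine (Hom.ofFam_fam ..).trans (Eq.trans ?_ (comp_fam ..).symm)
    rw [Hom.ofFam_fam, Hom.ofFam_fam]
    simp)

lemma ofProd_map_base {K L : FormalProd c} (m : K ⟶ L) :
    Hom.base ((ofProd c).map m) = m.base := rfl

lemma ofProd_map_fam {K L : FormalProd c} (m : K ⟶ L) :
    Hom.fam ((ofProd c).map m) = (famIso K).hom ≫ m ≫ (famIso L).inv :=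
  Hom.ofFam_fam _ _ (conj_famIso_base m)

lemma ofProd_bijective (K L : FormalProd c) :
    Function.Bijective (fun m : K ⟶ L => (ofProd c).map m) := by
  have key (m : K ⟶ L) : (famIso K).inv ≫ Hom.fam ((ofProd c).map m) ≫ (famIso L).hom = m := by
    rw [ofProd_map_fam]
    simp
  constructor
  · intro m n h
    rw [← key m, ← key n]
    exact congrArg (fun t => (famIso K).inv ≫ Hom.fam t ≫ (famIso L).hom) h
  · intro (h : ofProdObj K ⟶ ofProdObj L)
    refine ⟨(famIso K).inv ≫ h.fam ≫ (famIso L).hom, Hom.ext_fam ?_ ?_⟩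
    · have h₁ := Hom.fam_base_fst h
      dsimp only
      rw [ofProd_map_base, FormalProd.base_comp, FormalProd.base_comp, famIso_hom_base, h₁,
        ← Category.assoc]
      exact (congrArg (· ≫ Hom.base h) (famIso_inv_base K)).trans (Category.id_comp _)
    · refine (ofProd_map_fam _).trans ?_
      simp

lemma ofProd_cartesian {K L : FormalProd c} {u : K.ctx ⟶ L.ctx} {m : K ⟶ L}
    (h : (FormalProd.proj c).IsStronglyCartesian u m) :
    (proj c).IsStronglyCartesian u ((ofProd c).map m) := by
  have hm : m.base = u := FormalProd.lift_iff.1 h.toIsHomLift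
  have : (proj c).IsHomLift u ((ofProd c).map m) := lift_iff.2 hm
  refine ⟨?_⟩
  intro R (w : R.ctx ⟶ K.ctx) (k : R ⟶ ofProdObj L) hk
  have hk : k.base = w ≫ u := lift_iff.1 hk
  have hb : FormalProd.Hom.base (k.fam ≫ (famIso L).hom) = (fst R.ctx R.wit ≫ w) ≫ u := by
    have h₁ := Hom.fam_base_fst k
    rw [FormalProd.base_comp, famIso_hom_base, h₁, hk, Category.assoc]
  have : (FormalProd.proj c).IsHomLift ((fst R.ctx R.wit ≫ w) ≫ u) (k.fam ≫ (famIso L).hom) :=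
    hb ▸ FormalProd.lift_base _
  obtain ⟨χ, ⟨h₁, h₂⟩, h₃⟩ := Functor.IsStronglyCartesian.universal_property (FormalProd.proj c) u m
    (fst R.ctx R.wit ≫ w) _ rfl (k.fam ≫ (famIso L).hom)
  have h₁ : χ.base = fst R.ctx R.wit ≫ w := FormalProd.lift_iff.1 h₁
  have hc : FormalProd.Hom.base (χ ≫ (famIso K).inv) ≫ fst K.ctx (𝟙_ B) =
      fst R.ctx R.wit ≫ w := by
    rw [FormalProd.base_comp, Category.assoc, famIso_inv_base, Category.comp_id, h₁]
  refine ⟨Hom.ofFam w (χ ≫ (famIso K).inv) hc, ⟨lift_iff.2 rfl, Hom.ext_fam ?_ ?_⟩, ?_⟩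
  · rw [comp_base, hk, ofProd_map_base, hm]
    rfl
  · rw [comp_fam, ofProd_map_fam, Hom.ofFam_fam, Category.assoc, Iso.inv_hom_id_assoc,
      ← Category.assoc, h₂, Category.assoc, Iso.hom_inv_id, Category.comp_id]
  · rintro g ⟨g₁, g₂⟩
    have g₁ : g.base = w := lift_iff.1 g₁
    refine Hom.ext_fam g₁ ?_
    rw [Hom.ofFam_fam, Iso.eq_comp_inv]
    refine h₃ _ ⟨FormalProd.lift_iff.2 ?_, ?_⟩
    · have := Hom.fam_base_fst g
      rw [FormalProd.base_comp, famIso_hom_base, ← g₁, this]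
    · have := congrArg Hom.fam g₂
      rw [comp_fam, ofProd_map_fam, ← Category.assoc, ← Category.assoc, Iso.comp_inv_eq] at this
      exact this

end Dial

end

section

/-! ### Fibred equivalences from fully faithful functors -/

namespace FibredEquivalence

variable {B : Type u₁} [Category.{v₁} B] {D : Type u₂} [Category.{v₂} D]
  {E : Type u₃} [Category.{v₃} E] {q : D ⥤ B} {p : E ⥤ B}

lemma isHomLift_map_iff {F : D ⥤ E}
    (hF : ∀ {X Y : D} (f : X ⟶ Y), p.IsHomLift (q.map f) (F.map f))
    {X Y : D} {I J : B} {u : I ⟶ J} {f : X ⟶ Y} :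
    p.IsHomLift u (F.map f) ↔ q.IsHomLift u f := by
  constructor
  · intro h
    obtain rfl : q.obj X = I :=
      (IsHomLift.domain_eq p (q.map f) (F.map f)).symm.trans (IsHomLift.domain_eq p u (F.map f))
    obtain rfl : q.obj Y = J :=
      (IsHomLift.codomain_eq p (q.map f) (F.map f)).symm.trans
        (IsHomLift.codomain_eq p u (F.map f))
    rw [over_unique h (hF f)]
    infer_instance
  · intro h
    obtain rfl : q.obj X = I := IsHomLift.domain_eq q u f
    obtain rfl : q.obj Y = J := IsHomLift.codomain_eq q u f
    have e : u = q.map f := over_unique h (inferInstanceAs (q.IsHomLift (q.map f) f))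
    rw [e]
    exact hF f

variable (F : D ⥤ E) [F.Full] [F.Faithful]
  (hF : ∀ {X Y : D} (f : X ⟶ Y), p.IsHomLift (q.map f) (F.map f))
  (obj : E → D) (i : ∀ Y, F.obj (obj Y) ≅ Y)
  (hi : ∀ Y, p.IsHomLift (𝟙 (p.obj Y)) (i Y).hom)

/-- The equivalence of categories given by a fully faithful functor and a choice of preimages. -/
noncomputable def equivalenceOfFullyFaithful : D ≌ E where
  functor := F
  inverse :=
    { obj := obj
      map f := F.preimage ((i _).hom ≫ f ≫ (i _).inv)
      map_id Y := F.map_injective (by simp)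
      map_comp f g := F.map_injective (by simp) }
  unitIso := NatIso.ofComponents (fun X => F.preimageIso (i (F.obj X)).symm)
    (fun f => F.map_injective (by simp))
  counitIso := NatIso.ofComponents i (by simp)
  functor_unitIso_comp X := by simp

include hF hi in
/-- A fully faithful functor over the base preserves cartesian arrows if it is essentially surjective
along vertical isomorphisms, which is needed to test the universal property on its image. -/
lemma map_isStronglyCartesian {X Y : D} {I J : B} (u : I ⟶ J) (φ : X ⟶ Y)
    (h : q.IsStronglyCartesian u φ) : p.IsStronglyCartesian u (F.map φ) := by
  have := (isHomLift_map_iff hF).2 h.toIsHomLift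
  refine ⟨?_⟩
  intro Z g ψ hψ
  have o : q.IsHomLift (g ≫ u) (F.preimage ((i Z).hom ≫ ψ)) := by
    rw [← isHomLift_map_iff hF, F.map_preimage]
    exact vert_comp_over (hi Z) hψ
  obtain ⟨χ, ⟨h₁, h₂⟩, h₃⟩ := Functor.IsStronglyCartesian.universal_property q u φ g _ rfl
    (F.preimage ((i Z).hom ≫ ψ))
  refine ⟨(i Z).inv ≫ F.map χ, ⟨vert_comp_over (vert_inv (hi Z)) ((isHomLift_map_iff hF).2 h₁),
    ?_⟩, ?_⟩
  · rw [Category.assoc, ← F.map_comp, h₂, F.map_preimage, Iso.inv_hom_id_assoc]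
  · rintro χ' ⟨k₁, k₂⟩
    rw [Iso.eq_inv_comp, ← h₃ (F.preimage ((i Z).hom ≫ χ')) ⟨?_, ?_⟩, F.map_preimage]
    · rw [← isHomLift_map_iff hF, F.map_preimage]
      exact vert_comp_over (hi Z) k₁
    · apply F.map_injective
      rw [F.map_comp, F.map_preimage, F.map_preimage, Category.assoc, k₂]

include hF hi in
/-- The inverse of a fully faithful functor over the base which is vertically essentially surjective
preserves cartesian arrows. -/
lemma preimage_isStronglyCartesian {X Y : E} {I J : B} (u : I ⟶ J) (φ : X ⟶ Y)
    (h : p.IsStronglyCartesian u φ) :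
    q.IsStronglyCartesian u (F.preimage ((i X).hom ≫ φ ≫ (i Y).inv)) := by
  have oX : p.IsHomLift (𝟙 I) (i X).hom := by
    obtain rfl : p.obj X = I := IsHomLift.domain_eq p u φ
    exact hi X
  have oY : p.IsHomLift (𝟙 J) (i Y).hom := by
    obtain rfl : p.obj Y = J := IsHomLift.codomain_eq p u φ
    exact hi Y
  have o : q.IsHomLift u (F.preimage ((i X).hom ≫ φ ≫ (i Y).inv)) := by
    rw [← isHomLift_map_iff hF, F.map_preimage]
    exact vert_comp_over oX (over_comp_vert h.toIsHomLift (vert_inv oY))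
  refine ⟨?_⟩
  intro Z g ψ hψ
  have hψ' : p.IsHomLift (g ≫ u) (F.map ψ ≫ (i Y).hom) :=
    over_comp_vert ((isHomLift_map_iff hF).2 hψ) oY
  obtain ⟨χ, ⟨h₁, h₂⟩, h₃⟩ := Functor.IsStronglyCartesian.universal_property p u φ g _ rfl
    (F.map ψ ≫ (i Y).hom)
  refine ⟨F.preimage (χ ≫ (i X).inv), ⟨?_, ?_⟩, ?_⟩
  · rw [← isHomLift_map_iff hF, F.map_preimage]
    exact over_comp_vert h₁ (vert_inv oX)
  · apply F.map_injective
    rw [F.map_comp, F.map_preimage, F.map_preimage, Category.assoc, Iso.inv_hom_id_assoc,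
      ← Category.assoc, h₂, Category.assoc, Iso.hom_inv_id, Category.comp_id]
  · rintro χ' ⟨k₁, k₂⟩
    apply F.map_injective
    rw [F.map_preimage, Iso.eq_comp_inv]
    refine h₃ _ ⟨over_comp_vert ((isHomLift_map_iff hF).2 k₁) oX, ?_⟩
    have := congrArg (fun t => F.map t ≫ (i Y).hom) k₂
    simpa using this

/-- A fully faithful functor over `B` such that every object of the codomain is vertically
isomorphic to an object of its image is an equivalence of fibrations. -/
noncomputable def ofFullyFaithful : FibredEquivalence q p where
  equiv := equivalenceOfFullyFaithful F obj i
  functor_comp := by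
    have key {X Y : D} (f : X ⟶ Y) : p.map (F.map f) =
        eqToHom (IsHomLift.domain_eq p (q.map f) (F.map f)) ≫ q.map f ≫
          eqToHom (IsHomLift.codomain_eq p (q.map f) (F.map f)).symm :=
      IsHomLift.fac' p (q.map f) (F.map f)
    exact CategoryTheory.Functor.ext
      (fun X => @IsHomLift.domain_eq _ _ _ _ p _ _ _ _ _ _ (hF (𝟙 X)))
      (fun X Y f => key f)
  inverse_comp := by
    have key {X Y : E} (f : X ⟶ Y) :
        q.IsHomLift (p.map f) (F.preimage ((i X).hom ≫ f ≫ (i Y).inv)) := by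
      rw [← isHomLift_map_iff hF, F.map_preimage]
      exact vert_comp_over (hi X) (over_comp_vert
        (inferInstanceAs (p.IsHomLift (p.map f) f)) (vert_inv (hi Y)))
    refine CategoryTheory.Functor.ext (fun X => ?_) (fun X Y f => ?_)
    · exact @IsHomLift.domain_eq _ _ _ _ q _ _ _ _ _ _ (key (𝟙 X))
    · have := key f
      exact IsHomLift.fac' q (p.map f) (F.preimage ((i X).hom ≫ f ≫ (i Y).inv))
  functor_cartesian u φ h := map_isStronglyCartesian F hF obj i hi u φ h
  inverse_cartesian u φ h := preimage_isStronglyCartesian F hF obj i hi u φ h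
  unit_vertical X := by
    rw [← isHomLift_map_iff hF]
    have := hF (𝟙 X)
    have e : p.obj (F.obj X) = q.obj X := IsHomLift.domain_eq p (q.map (𝟙 X)) (F.map (𝟙 X))
    have h := vert_inv (hi (F.obj X))
    rw [e] at h
    rw [← F.map_preimage (i (F.obj X)).inv] at h
    exact h
  counit_vertical Y := hi Y

end FibredEquivalence

/-! ### Existential completions of formal products -/

section Embeddings

variable {B : Type u₁} [Category.{v₁} B] [CartesianMonoidalCategory B]
variable {E : Type u₂} [Category.{v₂} E] {p : E ⥤ B} {c : SplitCleavage p}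
variable {E' : Type u₃} [Category.{v₃} E'] {p' : E' ⥤ B}

/-- A fully faithful functor from the formal products of a fibration to another fibration which
lies over the base; its values are recorded in the fibres over their contexts. -/
structure FormalProd.Embedding (c' : SplitCleavage p') (p : E ⥤ B) where
  obj (K : FormalProd c') : p.Fiber K.ctx
  map {K L : FormalProd c'} (m : K ⟶ L) : tot (obj K) ⟶ tot (obj L)
  map_id (K : FormalProd c') : map (𝟙 K) = 𝟙 _
  map_comp {K L M : FormalProd c'} (m : K ⟶ L) (n : L ⟶ M) : map (m ≫ n) = map m ≫ map n
  map_over {K L : FormalProd c'} (m : K ⟶ L) : p.IsHomLift m.base (map m)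
  map_bijective (K L : FormalProd c') : Function.Bijective (map (K := K) (L := L))

namespace FormalProd.Embedding

variable {c' : SplitCleavage p'} (H : FormalProd.Embedding c' p)

/-- An embedding of formal products generates a fibration with simple coproducts if the embedded
objects are `∐`-quantifier-free and every object is a simple coproduct of an embedded one. -/
structure Generates (C : c.SimpleCoproducts) : Prop where
  qf (K : FormalProd c') : C.QuantifierFree (H.obj K)
  gen {I : B} (α : p.Fiber I) : ∃ (X U : B) (a : p'.Fiber ((I ⊗ X) ⊗ U)),
    Nonempty (α ≅ (C.coprod I X).obj (H.obj ⟨I ⊗ X, U, a⟩))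

/-- An embedding of formal products preserves cartesian arrows. -/
def PreservesCartesian : Prop :=
  ∀ {K L : FormalProd c'} {u : K.ctx ⟶ L.ctx} {m : K ⟶ L},
    (proj c').IsStronglyCartesian u m → p.IsStronglyCartesian u (H.map m)

variable {H}

lemma PreservesCartesian.exists_iso_reindex (h : H.PreservesCartesian) (K : FormalProd c') {A : B}
    (f : A ⟶ K.ctx) :
    ∃ i : (c.reindex f).obj (H.obj K) ≅ H.obj (K.reindex f),
      arr i.hom ≫ H.map (K.cart f) = c.π f _ := by
  have h₁ := h (K.cart_cartesian f)
  have h₂ := c.π_cartesian f (H.obj K)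
  refine ⟨fiberIso (Functor.IsCartesian.domainUniqueUpToIso p f (H.map (K.cart f))
    (c.π f (H.obj K))) inferInstance, ?_⟩
  exact Functor.IsCartesian.fac p f (H.map (K.cart f)) (c.π f (H.obj K))

variable {C : c.SimpleCoproducts}

/-- The object `∐_X ∏_U α` interpreting `(I, X, U, α)`. -/
noncomputable abbrev sigma (H : FormalProd.Embedding c' p) (C : c.SimpleCoproducts) (S : Dial c') :
    p.Fiber S.ctx :=
  (C.coprod S.ctx S.wit).obj (H.obj S.fam)

lemma existsUnique_sigmaMap {S T : Dial c'} (F : S ⟶ T) :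
    ∃! h : tot (H.sigma C S) ⟶ tot (H.sigma C T), p.IsHomLift F.base h ∧
      C.inj (H.obj S.fam) ≫ h = H.map F.fam ≫ C.inj (H.obj T.fam) :=
  C.existsUnique_desc _ _ _ _
    (over_congr (over_comp (H.map_over F.fam) (C.inj_over _)) F.fam_base_fst)

/-- The morphism `∐_X ∏_U α ⟶ ∐_Y ∏_V β` interpreting a Dialectica morphism. -/
noncomputable def sigmaMap {S T : Dial c'} (F : S ⟶ T) : tot (H.sigma C S) ⟶ tot (H.sigma C T) :=
  (existsUnique_sigmaMap (C := C) (H := H) F).choose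

lemma sigmaMap_over {S T : Dial c'} (F : S ⟶ T) :
    p.IsHomLift F.base (sigmaMap (H := H) (C := C) F) :=
  (existsUnique_sigmaMap F).choose_spec.1.1

lemma inj_sigmaMap {S T : Dial c'} (F : S ⟶ T) :
    C.inj (H.obj S.fam) ≫ sigmaMap F = H.map F.fam ≫ C.inj (H.obj T.fam) :=
  (existsUnique_sigmaMap F).choose_spec.1.2

lemma eq_sigmaMap {S T : Dial c'} {F : S ⟶ T} {h : tot (H.sigma C S) ⟶ tot (H.sigma C T)}
    (o : p.IsHomLift F.base h)
    (e : C.inj (H.obj S.fam) ≫ h = H.map F.fam ≫ C.inj (H.obj T.fam)) : h = sigmaMap F :=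
  (existsUnique_sigmaMap F).choose_spec.2 h ⟨o, e⟩

variable (H C) in
/-- The interpretation of the Dialectica category by simple coproducts of embedded formal
products. -/
noncomputable abbrev sigmaFunctor : Dial c' ⥤ E where
  obj S := tot (H.sigma C S)
  map F := sigmaMap F
  map_id S := by
    symm
    refine eq_sigmaMap (tot_over _) ?_
    have e : Dial.Hom.fam (𝟙 S) = 𝟙 S.fam := Dial.Hom.fam_id S
    rw [e, H.map_id, Category.id_comp, Category.comp_id]
  map_comp F G := by
    symm
    refine eq_sigmaMap (over_comp (sigmaMap_over F) (sigmaMap_over G)) ?_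
    rw [← Category.assoc, inj_sigmaMap, Category.assoc, inj_sigmaMap, ← Category.assoc,
      ← H.map_comp, ← Dial.comp_fam]

lemma Generates.sigmaMap_bijective (hH : H.Generates C) (S T : Dial c') :
    Function.Bijective (fun F : S ⟶ T => sigmaMap (H := H) (C := C) F) := by
  constructor
  · intro F G (h : sigmaMap F = sigmaMap G)
    have h₁ : F.base = G.base := over_unique (sigmaMap_over F) (h ▸ sigmaMap_over G)
    refine Dial.Hom.ext_fam h₁ ((H.map_bijective _ _).1 ?_)
    refine ((hH.qf S.fam).existsUnique_lift _ (C.inj (H.obj S.fam) ≫ sigmaMap G)).unique ?_ ?_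
    · exact (inj_sigmaMap F).symm.trans (by rw [h])
    · exact (inj_sigmaMap G).symm
  · intro h
    obtain ⟨f, hf⟩ := exists_over _ _ h
    obtain ⟨k, hk, -⟩ := (hH.qf S.fam).existsUnique_lift _ (C.inj (H.obj S.fam) ≫ h)
    obtain ⟨m, rfl⟩ := (H.map_bijective _ _).2 k
    have e : m.base ≫ fst T.ctx T.wit = fst S.ctx S.wit ≫ f :=
      over_unique (over_comp (H.map_over m) (C.inj_over _))
        (hk.symm ▸ over_comp (C.inj_over _) hf)
    refine ⟨Dial.Hom.ofFam f m e, (eq_sigmaMap ?_ ?_).symm⟩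
    · exact hf
    · rw [Dial.Hom.ofFam_fam]
      exact hk.symm

/-- A fibration whose objects are simple coproducts of embedded formal products of `p'` is
equivalent to the Dialectica fibration of `p'`. -/
lemma Generates.nonempty_fibredEquivalence (hH : H.Generates C) :
    Nonempty (FibredEquivalence (Dial.proj c') p) := by
  have : (H.sigmaFunctor C).Full := ⟨(hH.sigmaMap_bijective _ _).2⟩
  have : (H.sigmaFunctor C).Faithful := ⟨fun h => (hH.sigmaMap_bijective _ _).1 h⟩
  have key (Y : E) : ∃ (S : Dial c') (i : (H.sigmaFunctor C).obj S ≅ Y),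
      p.IsHomLift (𝟙 (p.obj Y)) i.hom := by
    let α : p.Fiber (p.obj Y) := ⟨Y, rfl⟩
    obtain ⟨X, U, a, ⟨i⟩⟩ := hH.gen α
    exact ⟨⟨p.obj Y, X, U, a⟩, totalIso i.symm, arr_over i.inv⟩
  choose S i hi using key
  exact ⟨FibredEquivalence.ofFullyFaithful (H.sigmaFunctor C) (fun F => sigmaMap_over F) S i hi⟩

end FormalProd.Embedding

end Embeddings

end

section

/-! ### Full subfibrations -/

section FullSub

variable {B : Type u₁} [Category.{v₁} B] {E : Type u₂} [Category.{v₂} E] {p : E ⥤ B}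

namespace SplitCleavage

variable {c : SplitCleavage p} {Q : ObjectProperty E}

/-- An object of a fibre of a full subfibration, seen in the fibre of the whole fibration. -/
abbrev incl {I : B} (Y : (Q.ι ⋙ p).Fiber I) : p.Fiber I := ⟨Y.1.1, Y.2⟩

lemma full_lift_iff {I J : B} {u : I ⟶ J} {X Y : Q.FullSubcategory} {φ : X ⟶ Y} :
    (Q.ι ⋙ p).IsHomLift u φ ↔ p.IsHomLift u φ.hom :=
  ⟨fun _ => IsHomLift.of_fac p u φ.hom (IsHomLift.domain_eq (Q.ι ⋙ p) u φ)
      (IsHomLift.codomain_eq (Q.ι ⋙ p) u φ) (IsHomLift.fac (Q.ι ⋙ p) u φ),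
    fun _ => IsHomLift.of_fac (Q.ι ⋙ p) u φ (IsHomLift.domain_eq p u φ.hom)
      (IsHomLift.codomain_eq p u φ.hom) (IsHomLift.fac p u φ.hom)⟩

lemma incl_injective {I : B} : Function.Injective (incl (p := p) (Q := Q) (I := I)) := by
  rintro ⟨⟨X, hX⟩, h⟩ ⟨⟨Y, hY⟩, h'⟩ e
  obtain rfl : X = Y := congrArg Subtype.val e
  rfl

lemma full_eqToHom_hom {X Y : Q.FullSubcategory} (h : X = Y) :
    (eqToHom h).hom = eqToHom (congrArg ObjectProperty.FullSubcategory.obj h) := by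
  subst h
  rfl

variable (c) in
/-- The cleavage of the full subfibration on a class of objects stable under reindexing. -/
abbrev full (hQ : ∀ {I J : B} (u : I ⟶ J) (Y : p.Fiber J), Q Y.1 → Q (c.pull u Y).1) :
    SplitCleavage (Q.ι ⋙ p) where
  pull u Y := ⟨⟨(c.pull u (incl Y)).1, hQ u (incl Y) Y.1.2⟩, (c.pull u (incl Y)).2⟩
  cart u Y := ⟨c.cart u (incl Y)⟩
  isCartesian {I J} u Y := by
    have : (Q.ι ⋙ p).IsHomLift u (⟨c.cart u (incl Y)⟩ :
        (⟨(c.pull u (incl Y)).1, hQ u (incl Y) Y.1.2⟩ : Q.FullSubcategory) ⟶ Y.1) :=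
      full_lift_iff.2 (c.isCartesian u (incl Y)).toIsHomLift
    refine ⟨?_⟩
    intro Z g φ hφ
    have : p.IsHomLift (g ≫ u) φ.hom := full_lift_iff.1 hφ
    obtain ⟨χ, ⟨h₁, h₂⟩, h₃⟩ := @Functor.IsStronglyCartesian.universal_property' _ _ _ _ p
      _ _ _ _ u (c.cart u (incl Y)) _ Z.obj g φ.hom this
    refine ⟨⟨χ⟩, ⟨full_lift_iff.2 h₁, ?_⟩, ?_⟩
    · ext
      exact h₂
    · rintro ψ ⟨k₁, k₂⟩
      ext
      exact h₃ ψ.hom ⟨full_lift_iff.1 k₁, congrArg (fun t => t.hom) k₂⟩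
  pull_id Y := incl_injective (c.pull_id (incl Y))
  pull_comp u v Y := incl_injective (c.pull_comp u v (incl Y))
  cart_id Y := by
    ext
    rw [full_eqToHom_hom]
    exact c.cart_id (incl Y)
  cart_comp u v Y := by
    ext
    rw [ObjectProperty.FullSubcategory.comp_hom,
      ObjectProperty.FullSubcategory.comp_hom, full_eqToHom_hom]
    exact c.cart_comp u v (incl Y)

lemma full_fill_hom {hQ : ∀ {I J : B} (u : I ⟶ J) (Y : p.Fiber J), Q Y.1 → Q (c.pull u Y).1}
    {I J : B} (u : I ⟶ J) (Y : (Q.ι ⋙ p).Fiber J) {L : B} (w : L ⟶ I) {Z : Q.FullSubcategory}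
    (z : Z ⟶ tot Y) (hz : (Q.ι ⋙ p).IsHomLift (w ≫ u) z) :
    ((c.full hQ).fill u Y w z hz).hom = c.fill u (incl Y) w z.hom (full_lift_iff.1 hz) := by
  symm
  refine c.fill_eq _ (full_lift_iff.1 ((c.full hQ).fill_over ..)) ?_
  exact congrArg (fun t => t.hom) ((c.full hQ).fill_π u Y w z hz)

end SplitCleavage

end FullSub

variable {B : Type u₁} [Category.{v₁} B] [CartesianMonoidalCategory B]
variable {E : Type u₂} [Category.{v₂} E] {p : E ⥤ B} {c : SplitCleavage p}

namespace FormalProd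

open SplitCleavage

variable {Q : ObjectProperty E}
  {hQ : ∀ {I J : B} (u : I ⟶ J) (Y : p.Fiber J), Q Y.1 → Q (c.pull u Y).1}

/-- A formal product in a full subfibration, seen in the whole fibration. -/
abbrev inclObj (K : FormalProd (c.full hQ)) : FormalProd c := ⟨K.ctx, K.ctr, incl K.pred⟩

/-- A morphism of formal products in a full subfibration, seen in the whole fibration. -/
abbrev inclMap {K L : FormalProd (c.full hQ)} (F : K ⟶ L) : K.inclObj ⟶ L.inclObj where
  base := F.base
  bwd := F.bwd
  arrow := F.arrow.hom
  arrow_over := full_lift_iff.1 F.arrow_over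

lemma inclMap_bijective (K L : FormalProd (c.full hQ)) :
    Function.Bijective (fun F : K ⟶ L => inclMap F) := by
  constructor
  · rintro ⟨a, b, ⟨t⟩, ht⟩ ⟨a', b', ⟨t'⟩, ht'⟩ h
    cases h
    rfl
  · rintro ⟨a, b, t, ht⟩
    exact ⟨⟨a, b, ⟨t⟩, full_lift_iff.2 ht⟩, rfl⟩

lemma inclMap_app {K L : FormalProd (c.full hQ)} (F : K ⟶ L) {I : B} (k : I ⟶ K.ctx)
    (v : I ⟶ L.ctr) {Z : Q.FullSubcategory} (z : Z ⟶ tot K.pred)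
    (hz : (Q.ι ⋙ p).IsHomLift (lift k (lift k v ≫ F.bwd)) z) :
    (F.app k v z hz).hom = (inclMap F).app k v z.hom (full_lift_iff.1 hz) :=
  congrArg (· ≫ F.arrow.hom) (full_fill_hom ..)

lemma inclMap_comp {K L M : FormalProd (c.full hQ)} (F : K ⟶ L) (G : L ⟶ M) :
    inclMap (F ≫ G) = inclMap F ≫ inclMap G := by
  have o : (Q.ι ⋙ p).IsHomLift (lift (fst K.ctx M.ctr ≫ F.base)
      (lift (fst K.ctx M.ctr ≫ F.base) (snd K.ctx M.ctr) ≫ G.bwd))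
      (F.app (fst K.ctx M.ctr) (F.base ▷ M.ctr ≫ G.bwd) ((c.full hQ).π _ K.pred)
        ((c.full hQ).π_over _ _)) :=
    over_congr (F.app_over _ _ _ _) (by
      congr 2
      ext <;> simp)
  have e₁ := inclMap_app F (fst K.ctx M.ctr) (F.base ▷ M.ctr ≫ G.bwd) ((c.full hQ).π _ K.pred)
    ((c.full hQ).π_over _ _)
  have e : (Hom.arrow (F ≫ G)).hom = Hom.arrow (inclMap F ≫ inclMap G) :=
    (inclMap_app G _ _ _ o).trans
      ((inclMap G).app_congr _ rfl rfl e₁ (e₁ ▸ full_lift_iff.1 o))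
  exact Hom.mk_congr rfl e (full_lift_iff.1 (Hom.arrow_over (F ≫ G)))
    (Hom.arrow_over (inclMap F ≫ inclMap G))

end FormalProd

/-! ### The interpretation of formal products by simple products -/

namespace SplitCleavage

namespace SimpleProducts

variable (P : c.SimpleProducts)

/-- Evaluation of the reindexed product `j^* ∏ α` at `g`, as an arrow `j^* ∏ α ⟶ ⟨j, g⟩^* α`. -/
noncomputable def evAt {A J X : B} (j : A ⟶ J) (α : p.Fiber (J ⊗ X)) (g : A ⟶ X) :
    tot ((c.reindex j).obj ((P.prod J X).obj α)) ⟶ tot ((c.reindex (lift j g)).obj α) :=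
  c.fill (lift j g) α (𝟙 A) (P.ev α j g (c.π j _) (c.π_over _ _)) (id_comp_over (P.ev_over ..))

lemma evAt_over {A J X : B} (j : A ⟶ J) (α : p.Fiber (J ⊗ X)) (g : A ⟶ X) :
    p.IsHomLift (𝟙 A) (P.evAt j α g) := c.fill_over ..

lemma reindex_counit_section {A X : B} (β : p.Fiber (A ⊗ X)) (g : A ⟶ X) :
    (arr (eqToHom (c.weaken_section g ((P.prod A X).obj β)).symm) ≫
        arr ((c.reindex (lift (𝟙 A) g)).map (P.counit β))) ≫ c.π (lift (𝟙 A) g) β =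
      P.ev β (𝟙 A) g (𝟙 _) (tot_over _) := by
  rw [Category.assoc, arr_reindex_π, ev, ← Category.assoc]
  congr 1
  symm
  refine c.fill_eq _ (vert_comp_over (arr_over _) (c.π_over _ _)) ?_
  rw [Category.assoc, ← weaken_section_π, ← arr_comp, eqToHom_trans, eqToHom_refl, arr_id]

end SimpleProducts

variable (c) in
/-- Arrows over `f` correspond to vertical arrows into the reindexed object. -/
noncomputable def fillEquiv {A I : B} (f : A ⟶ I) (γ : p.Fiber I) (Z : p.Fiber A) :
    {h : tot Z ⟶ tot γ // p.IsHomLift f h} ≃ (Z ⟶ (c.reindex f).obj γ) where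
  toFun h := mkVert (c.fill f γ (𝟙 A) h.1 (id_comp_over h.2)) (c.fill_over ..)
  invFun k := ⟨arr k ≫ c.π f γ, vert_comp_over (arr_over _) (c.π_over _ _)⟩
  left_inv h := Subtype.ext (c.fill_π _ _ _ _ (id_comp_over h.2))
  right_inv k := arr_ext (c.fill_eq (id_comp_over (vert_comp_over (arr_over k) (c.π_over _ _)))
    (arr_over k) rfl)

namespace SimpleProducts

variable {P : c.SimpleProducts}

/-- The co-witness property over an arbitrary context: arrows from a reindexed product to a
`∏`-quantifier-free object over `f` come from a unique instance of the product. -/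
lemma QuantifierFree.bijective_evAt {I : B} {γ : p.Fiber I} (hγ : P.QuantifierFree γ) {A J X : B}
    (f : A ⟶ I) (j : A ⟶ J) (α : p.Fiber (J ⊗ X)) :
    Function.Bijective (fun x : (g : A ⟶ X) ×
        {h : tot ((c.reindex (lift j g)).obj α) ⟶ tot γ // p.IsHomLift f h} =>
      (⟨P.evAt j α x.1 ≫ x.2.1, vert_comp_over (P.evAt_over ..) x.2.2⟩ :
        {h : tot ((c.reindex j).obj ((P.prod J X).obj α)) ⟶ tot γ // p.IsHomLift f h})) := by
  obtain ⟨i, hi⟩ := P.exists_iso_reindex j α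
  let β := (c.reindex (j ▷ X)).obj α
  have e (g : A ⟶ X) : (c.reindex (lift (𝟙 A) g)).obj β = (c.reindex (lift j g)).obj α := by
    rw [← c.reindex_obj_comp, lift_whiskerRight, Category.id_comp]
  have hκ (g : A ⟶ X) : arr (eqToHom (e g)) ≫ c.π (lift j g) α =
      c.π (lift (𝟙 A) g) β ≫ c.π (j ▷ X) α := by
    have e' : (c.reindex (lift (𝟙 A) g)).obj β = (c.reindex (lift (𝟙 A) g ≫ j ▷ X)).obj α :=
      (c.reindex_obj_comp ..).symm
    rw [← c.eqToHom_π_congr (show lift (𝟙 A) g ≫ j ▷ X = lift j g by simp) α e' (e g),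
      ← c.eqToHom_π_comp _ _ _ e' rfl, eqToHom_refl, arr_id, Category.id_comp]
  -- arrows over `f` out of `⟨j, g⟩^* α` are vertical arrows out of `⟨1, g⟩^* (j × 1)^* α`
  let ε (g : A ⟶ X) : {h : tot ((c.reindex (lift j g)).obj α) ⟶ tot γ // p.IsHomLift f h} ≃
      ((c.reindex (lift (𝟙 A) g)).obj β ⟶ (c.reindex f).obj γ) :=
    (c.fillEquiv f γ _).trans ((eqToIso (e g)).symm.homCongr (Iso.refl _))
  let ε' : {h : tot ((c.reindex j).obj ((P.prod J X).obj α)) ⟶ tot γ // p.IsHomLift f h} ≃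
      ((P.prod A X).obj β ⟶ (c.reindex f).obj γ) :=
    (c.fillEquiv f γ _).trans (i.homCongr (Iso.refl _))
  have hw : Function.Bijective (fun x : (g : A ⟶ X) ×
      ((c.reindex (lift (𝟙 A) g)).obj β ⟶ (c.reindex f).obj γ) =>
        eqToHom (c.weaken_section x.1 ((P.prod A X).obj β)).symm ≫
          (c.reindex (lift (𝟙 A) x.1)).map (P.counit β) ≫ x.2) := by
    rw [Function.bijective_iff_existsUnique]
    intro h
    obtain ⟨x, hx, hu⟩ := hγ A f X β h
    exact ⟨x, hx.symm, fun y hy => hu y hy.symm⟩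
  have := ε'.symm.bijective.comp (hw.comp (Equiv.sigmaCongrRight ε).bijective)
  convert this using 1
  funext ⟨g, h, o⟩
  apply Subtype.ext
  have hε : arr (ε g ⟨h, o⟩) ≫ c.π f γ = arr (eqToHom (e g)) ≫ h := by
    simp [ε, fillEquiv]
  have hε' (k : (P.prod A X).obj β ⟶ (c.reindex f).obj γ) :
      (ε'.symm k).1 = arr i.hom ≫ arr k ≫ c.π f γ := by
    simp [ε', fillEquiv]
  refine Eq.trans ?_ (hε' _).symm
  dsimp only [Equiv.sigmaCongrRight, Function.comp, Equiv.coe_fn_mk]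
  rw [arr_comp, arr_comp, Category.assoc, Category.assoc, hε]
  have : P.evAt j α g = arr i.hom ≫ (arr (eqToHom (c.weaken_section g ((P.prod A X).obj β)).symm) ≫
      arr ((c.reindex (lift (𝟙 A) g)).map (P.counit β))) ≫ arr (eqToHom (e g)) := by
    refine c.fill_eq _ (vert_comp_over (arr_over _) (vert_comp_over
      (vert_comp_over (arr_over _) (arr_over _)) (arr_over _))) ?_
    simp only [Category.assoc]
    rw [hκ]
    have h₁ := P.reindex_counit_section β g
    have h₂ := hi (𝟙 A) g (𝟙 _) (tot_over _)
    have h₃ := P.comp_ev β (𝟙 A) g (𝟙 _) (tot_over _) (arr_over i.hom)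
    rw [← h₁] at h₃
    have h₄ := congrArg (· ≫ c.π (j ▷ X) α) h₃
    simp only [Category.assoc] at h₄
    refine h₄.trans (Eq.trans ?_ (h₂.trans ?_))
    · refine congrArg (· ≫ c.π (j ▷ X) α) (P.ev_congr _ (Category.id_comp _) ?_ _)
      rw [Category.comp_id, Category.id_comp]
    · exact P.ev_congr _ rfl (Category.id_comp _) _
  rw [this]
  simp only [Category.assoc]

variable (P)

lemma existsUnique_prodMap {K L : FormalProd c} (F : K ⟶ L) :
    ∃! m : tot ((P.prod K.ctx K.ctr).obj K.pred) ⟶ tot ((P.prod L.ctx L.ctr).obj L.pred),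
      ∃ h : p.IsHomLift F.base m,
        P.ev L.pred (fst K.ctx L.ctr ≫ F.base) (snd K.ctx L.ctr)
          (c.π (fst K.ctx L.ctr) _ ≫ m) (over_comp (c.π_over _ _) h) =
        F.app (fst K.ctx L.ctr) (snd K.ctx L.ctr)
          (P.ev K.pred (fst K.ctx L.ctr) F.bwd (c.π (fst K.ctx L.ctr) _) (c.π_over _ _))
          (over_congr (P.ev_over ..) (by simp)) :=
  P.existsUnique_curry _ _ _ _ (over_congr (F.app_over _ _ _ _) (by ext <;> simp))

/-- The morphism `∏_U α ⟶ ∏_V β` interpreting a morphism of formal products. -/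
noncomputable def prodMap {K L : FormalProd c} (F : K ⟶ L) :
    tot ((P.prod K.ctx K.ctr).obj K.pred) ⟶ tot ((P.prod L.ctx L.ctr).obj L.pred) :=
  (P.existsUnique_prodMap F).choose

lemma prodMap_over {K L : FormalProd c} (F : K ⟶ L) : p.IsHomLift F.base (P.prodMap F) :=
  (P.existsUnique_prodMap F).choose_spec.1.choose

lemma eq_prodMap {K L : FormalProd c} {F : K ⟶ L}
    {m : tot ((P.prod K.ctx K.ctr).obj K.pred) ⟶ tot ((P.prod L.ctx L.ctr).obj L.pred)}
    (h : p.IsHomLift F.base m)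
    (e : P.ev L.pred (fst K.ctx L.ctr ≫ F.base) (snd K.ctx L.ctr)
        (c.π (fst K.ctx L.ctr) _ ≫ m) (over_comp (c.π_over _ _) h) =
      F.app (fst K.ctx L.ctr) (snd K.ctx L.ctr)
        (P.ev K.pred (fst K.ctx L.ctr) F.bwd (c.π (fst K.ctx L.ctr) _) (c.π_over _ _))
        (over_congr (P.ev_over ..) (by simp))) : m = P.prodMap F :=
  (P.existsUnique_prodMap F).choose_spec.2 m ⟨h, e⟩

/-- Evaluating the image of a generalized element: `F(y)(x) = F(y(f₁(k, x)))`. -/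
lemma ev_prodMap {K L : FormalProd c} (F : K ⟶ L) {I : B} (k : I ⟶ K.ctx) (x : I ⟶ L.ctr)
    {W : E}
    (y : W ⟶ tot ((P.prod K.ctx K.ctr).obj K.pred)) (hy : p.IsHomLift k y) :
    P.ev L.pred (k ≫ F.base) x (y ≫ P.prodMap F) (over_comp hy (P.prodMap_over F)) =
      F.app k x (P.ev K.pred k (lift k x ≫ F.bwd) y hy) (P.ev_over ..) := by
  have hy₁ : p.IsHomLift (lift k x ≫ fst K.ctx L.ctr) y := by rwa [lift_fst]
  let y' := c.fill (fst K.ctx L.ctr) _ (lift k x) y hy₁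
  have oy' : p.IsHomLift (lift k x) y' := c.fill_over ..
  have ey : y' ≫ c.π (fst K.ctx L.ctr) _ = y := c.fill_π ..
  have h := (P.existsUnique_prodMap F).choose_spec.1.choose_spec
  have h := congrArg (fun t => y' ≫ t) h
  dsimp only at h
  rw [P.comp_ev _ _ _ _ _ oy', FormalProd.Hom.comp_app _ _ _ _ _ oy'] at h
  refine (P.ev_congr _ (lift_snd _ _).symm ?_ _).trans (h.trans ?_)
  · rw [← Category.assoc, ey]
    rfl
  · refine F.app_congr _ (lift_fst _ _) (lift_snd _ _) ?_ _
    rw [P.comp_ev _ _ _ _ _ oy']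
    exact P.ev_congr _ rfl ey _

lemma prodMap_id (K : FormalProd c) : P.prodMap (𝟙 K) = 𝟙 _ := by
  symm
  refine P.eq_prodMap (tot_over _) ?_
  refine Eq.trans ?_ (FormalProd.Hom.id_app ..).symm
  exact P.ev_congr _ rfl (Category.comp_id _) _

lemma prodMap_comp {K L M : FormalProd c} (F : K ⟶ L) (G : L ⟶ M) :
    P.prodMap (F ≫ G) = P.prodMap F ≫ P.prodMap G := by
  symm
  refine P.eq_prodMap (over_comp (P.prodMap_over F) (P.prodMap_over G)) ?_
  have o := over_comp (c.π_over (fst K.ctx M.ctr) _) (P.prodMap_over F)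
  have h₁ := P.ev_prodMap G (fst K.ctx M.ctr ≫ F.base) (snd K.ctx M.ctr)
    (c.π (fst K.ctx M.ctr) _ ≫ P.prodMap F) o
  have h₂ := P.ev_prodMap F (fst K.ctx M.ctr)
    (lift (fst K.ctx M.ctr ≫ F.base) (snd K.ctx M.ctr) ≫ G.bwd) (c.π (fst K.ctx M.ctr) _)
    (c.π_over _ _)
  have o₁ : p.IsHomLift (lift (fst K.ctx M.ctr) (FormalProd.Hom.bwd (F ≫ G)))
      (P.ev K.pred (fst K.ctx M.ctr) (FormalProd.Hom.bwd (F ≫ G)) (c.π (fst K.ctx M.ctr) _)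
        (c.π_over _ _)) := P.ev_over ..
  have eb := FormalProd.lift_bwd_comp F G (fst K.ctx M.ctr) (snd K.ctx M.ctr)
  have eb' : FormalProd.Hom.bwd (F ≫ G) = lift (fst K.ctx M.ctr) (lift (fst K.ctx M.ctr ≫ F.base)
      (snd K.ctx M.ctr) ≫ G.bwd) ≫ F.bwd := by
    rw [← eb, lift_fst_snd, Category.id_comp]
  rw [FormalProd.app_comp F G _ _ _ (over_congr o₁ (by simp)) (over_congr o₁ (by rw [eb']))]
  refine (P.ev_congr (j' := (fst K.ctx M.ctr ≫ F.base) ≫ G.base) _ rfl (Category.assoc _ _ _).symm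
    (over_comp o (P.prodMap_over G))).trans (h₁.trans (G.app_congr _ rfl rfl (h₂.trans ?_) _))
  refine F.app_congr _ rfl rfl (P.ev_congr _ eb'.symm rfl _) _

variable {P}

/-- The interpretation of formal products is full and faithful on morphisms into formal products of
`∏`-quantifier-free objects. -/
lemma prodMap_bijective (K L : FormalProd c) (hL : P.QuantifierFree L.pred) :
    Function.Bijective (fun F : K ⟶ L => P.prodMap F) := by
  have hev (F : K ⟶ L) : F.app (fst K.ctx L.ctr) (snd K.ctx L.ctr)
        (P.ev K.pred (fst K.ctx L.ctr) F.bwd (c.π (fst K.ctx L.ctr) _) (c.π_over _ _))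
        (over_congr (P.ev_over ..) (by simp)) =
      P.evAt (fst K.ctx L.ctr) K.pred F.bwd ≫ F.arrow :=
    congrArg (· ≫ F.arrow) (c.fill_congr lift_fst_snd rfl _ _)
  constructor
  · intro F G (h : P.prodMap F = P.prodMap G)
    have hb : F.base = G.base := over_unique (P.prodMap_over F) (h ▸ P.prodMap_over G)
    have e : P.evAt (fst K.ctx L.ctr) K.pred F.bwd ≫ F.arrow =
        P.evAt (fst K.ctx L.ctr) K.pred G.bwd ≫ G.arrow := by
      rw [← hev, ← hev, ← (P.existsUnique_prodMap F).choose_spec.1.choose_spec,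
        ← (P.existsUnique_prodMap G).choose_spec.1.choose_spec]
      exact P.ev_congr _ rfl (congrArg (c.π (fst K.ctx L.ctr) _ ≫ ·) h) _
    have := (hL.bijective_evAt (F.base ▷ L.ctr) (fst K.ctx L.ctr) K.pred).1
      (a₁ := ⟨F.bwd, F.arrow, F.arrow_over⟩)
      (a₂ := ⟨G.bwd, G.arrow, over_congr G.arrow_over (by rw [hb])⟩) (Subtype.ext e)
    obtain ⟨a, b, t, ht⟩ := F
    obtain ⟨a', b', t', ht'⟩ := G
    dsimp only at hb
    subst hb
    cases this
    rfl
  · intro m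
    obtain ⟨σ, hσ⟩ := exists_over _ _ m
    obtain ⟨⟨g, t, ht⟩, e⟩ := (hL.bijective_evAt (σ ▷ L.ctr) (fst K.ctx L.ctr) K.pred).2
      ⟨P.ev L.pred (fst K.ctx L.ctr ≫ σ) (snd K.ctx L.ctr) (c.π (fst K.ctx L.ctr) _ ≫ m)
        (over_comp (c.π_over _ _) hσ), over_congr (P.ev_over ..) (by ext <;> simp)⟩
    let F : K ⟶ L := ⟨σ, g, t, ht⟩
    refine ⟨F, (P.eq_prodMap (F := F) hσ ?_).symm⟩
    rw [hev F]
    exact (congrArg Subtype.val e).symm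

end SimpleProducts

end SplitCleavage

/-! ### Gödel fibrations are existential completions of formal products -/

namespace SplitCleavage

variable {P : c.SimpleProducts} {C : c.SimpleCoproducts}

/-- The class of `∏`-quantifier-free objects. -/
def SimpleProducts.qfProd (P : c.SimpleProducts) : ObjectProperty E :=
  fun X => P.QuantifierFree (I := p.obj X) ⟨X, rfl⟩

lemma SimpleProducts.qfProd_iff {I : B} (α : p.Fiber I) :
    P.qfProd α.1 ↔ P.QuantifierFree α := by
  obtain ⟨X, rfl⟩ := α
  exact Iff.rfl

lemma SimpleProducts.qfProd_pull {I J : B} (u : I ⟶ J) (Y : p.Fiber J) (h : P.qfProd Y.1) :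
    P.qfProd (c.pull u Y).1 := by
  rw [P.qfProd_iff] at h ⊢
  intro A f
  have e : (c.reindex f).obj (c.pull u Y) = (c.reindex (f ≫ u)).obj Y :=
    (c.reindex_obj_comp f u Y).symm
  rw [e]
  exact h A (f ≫ u)

/-- In a Gödel fibration, the `∏`-quantifier-free objects among the `∐`-quantifier-free ones
generate, through simple products, an embedded formal product completion. -/
noncomputable def embeddingOfSub (P' : C.subCleavage.SimpleProducts) :
    FormalProd.Embedding (C.subCleavage.full (Q := P'.qfProd) P'.qfProd_pull) p where
  obj K := C.subIncl ((P'.prod K.ctx K.ctr).obj K.inclObj.pred)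
  map F := (P'.prodMap (FormalProd.inclMap F)).hom
  map_id K := by
    have := P'.prodMap_id K.inclObj
    exact congrArg (fun t => t.hom) this
  map_comp F G := by
    rw [FormalProd.inclMap_comp]
    have := P'.prodMap_comp (FormalProd.inclMap F) (FormalProd.inclMap G)
    exact congrArg (fun t => t.hom) this
  map_over F := (C.sub_isHomLift _ _).1 (P'.prodMap_over (FormalProd.inclMap F))
  map_bijective K L := by
    have h₁ := SimpleProducts.prodMap_bijective (P := P') K.inclObj L.inclObj
      ((P'.qfProd_iff _).1 L.pred.1.2)
    have h₂ := h₁.comp (FormalProd.inclMap_bijective K L)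
    refine ⟨fun F G h => h₂.1 (ObjectProperty.hom_ext _ h), fun m => ?_⟩
    obtain ⟨F, hF⟩ := h₂.2 ⟨m⟩
    exact ⟨F, congrArg (fun t => t.hom) hF⟩

lemma generates_embeddingOfSub (hC : C.Enough) (P' : C.subCleavage.SimpleProducts)
    (hP' : P'.Enough) : (embeddingOfSub P').Generates C where
  qf K := C.subIncl_qf _
  gen {I} α := by
    obtain ⟨X, β, hβ, ⟨i⟩⟩ := hC I α
    obtain ⟨U, γ, hγ, ⟨j⟩⟩ := hP' (I ⊗ X) (C.subMk β hβ)
    let a : (P'.qfProd.ι ⋙ C.sub).Fiber ((I ⊗ X) ⊗ U) :=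
      ⟨⟨γ.1, (P'.qfProd_iff γ).2 hγ⟩, γ.2⟩
    let j' : β ≅ C.subIncl ((P'.prod (I ⊗ X) U).obj γ) := fiberIso (C.qf.ι.mapIso (totalIso j))
      ((C.sub_isHomLift _ _).1 (arr_over j.hom))
    exact ⟨X, U, a, ⟨i ≪≫ (C.coprod I X).mapIso j'⟩⟩

end SplitCleavage

end

section

/-! ### Dialectica fibrations are existential completions of formal products -/

variable {B : Type u₁} [Category.{v₁} B] [CartesianMonoidalCategory B]
variable {E : Type u₂} [Category.{v₂} E] {p : E ⥤ B} {c : SplitCleavage p}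
variable {E' : Type u₃} [Category.{v₃} E'] {p' : E' ⥤ B} {c' : SplitCleavage p'}

namespace SplitCleavage.SimpleCoproducts

variable (C : c.SimpleCoproducts)

/-- An arrow over a projection which is cocartesian with respect to vertical arrows exhibits its
codomain as the simple coproduct of its domain. -/
lemma exists_iso_of_existsUnique {A X : B} {β : p.Fiber (A ⊗ X)} {Y : p.Fiber A}
    {ζ : tot β ⟶ tot Y} (hζ : p.IsHomLift (fst A X) ζ)
    (H : ∀ (Z : p.Fiber A) (k : tot β ⟶ tot Z), p.IsHomLift (fst A X) k →
      ∃! h : tot Y ⟶ tot Z, p.IsHomLift (𝟙 A) h ∧ ζ ≫ h = k) :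
    ∃ j : (C.coprod A X).obj β ≅ Y, C.inj β ≫ arr j.hom = ζ := by
  obtain ⟨a, ⟨oa, ha⟩, -⟩ := C.existsUnique_desc β Y (𝟙 A) ζ (by rwa [Category.comp_id])
  obtain ⟨b, ⟨ob, hb⟩, -⟩ := H _ (C.inj β) (C.inj_over β)
  refine ⟨fiberIso ⟨a, b, ?_, ?_⟩ oa, ha⟩
  · refine C.desc_ext (f := 𝟙 A) (over_comp_vert oa ob) (tot_over _) ?_
    rw [← Category.assoc, ha, hb, Category.comp_id]
  · refine (H Y ζ hζ).unique ⟨over_comp_vert ob oa, ?_⟩ ⟨tot_over _, Category.comp_id _⟩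
    rw [← Category.assoc, hb, ha]

end SplitCleavage.SimpleCoproducts

namespace FibredEquivalence

variable (e : FibredEquivalence (Dial.proj c') p)

/-- The image of a Dialectica object, in the fibre over its context. -/
abbrev img (S : Dial c') : p.Fiber S.ctx :=
  ⟨e.equiv.functor.obj S, congrArg (fun G => G.obj S) e.functor_comp⟩

/-- The image of a Dialectica morphism. -/
abbrev imgMap {S T : Dial c'} (F : S ⟶ T) : tot (e.img S) ⟶ tot (e.img T) :=
  e.equiv.functor.map F

lemma imgMap_over {S T : Dial c'} (F : S ⟶ T) : p.IsHomLift F.base (e.imgMap F) := by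
  have h : (e.equiv.functor ⋙ p).IsHomLift F.base F := by
    rw [e.functor_comp]
    exact Dial.lift_base F
  exact IsHomLift.of_fac p _ _ (IsHomLift.domain_eq (e.equiv.functor ⋙ p) F.base F)
    (IsHomLift.codomain_eq (e.equiv.functor ⋙ p) F.base F)
    (IsHomLift.fac (e.equiv.functor ⋙ p) F.base F)

lemma imgMap_bijective (S T : Dial c') : Function.Bijective (e.imgMap (S := S) (T := T)) :=
  ⟨fun _ _ h => e.equiv.functor.map_injective h, fun h => e.equiv.functor.map_surjective h⟩

lemma imgMap_comp {S T R : Dial c'} (F : S ⟶ T) (G : T ⟶ R) :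
    e.imgMap (F ≫ G) = e.imgMap F ≫ e.imgMap G := e.equiv.functor.map_comp F G

lemma exists_img_iso {I : B} (α : p.Fiber I) : ∃ (X U : B) (a : p'.Fiber ((I ⊗ X) ⊗ U)),
    Nonempty (e.img ⟨I, X, U, a⟩ ≅ α) := by
  obtain ⟨Y, rfl⟩ := α
  obtain ⟨S, hS, i, hi⟩ : ∃ (S : Dial c') (_ : S.ctx = p.obj Y) (i : e.equiv.functor.obj S ≅ Y),
      p.IsHomLift (𝟙 (p.obj Y)) i.hom :=
    ⟨e.equiv.inverse.obj Y, congrArg (fun G => G.obj Y) e.inverse_comp, e.equiv.counitIso.app Y,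
      e.counit_vertical Y⟩
  obtain ⟨I, X, U, a⟩ := S
  dsimp only at hS
  subst hS
  exact ⟨X, U, a, ⟨fiberIso i hi⟩⟩

/-- Dialectica morphisms which are invertible on formal products are cocartesian. -/
lemma existsUnique_desc {S T : Dial c'} (ζ : S ⟶ T) [IsIso ζ.fam] (Z : p.Fiber T.ctx)
    (k : tot (e.img S) ⟶ tot Z) (hk : p.IsHomLift ζ.base k) :
    ∃! h : tot (e.img T) ⟶ tot Z, p.IsHomLift (𝟙 T.ctx) h ∧ e.imgMap ζ ≫ h = k := by
  obtain ⟨X, U, a, ⟨i⟩⟩ := e.exists_img_iso Z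
  let R : Dial c' := ⟨T.ctx, X, U, a⟩
  obtain ⟨k', hk'⟩ := (e.imgMap_bijective S R).2 (k ≫ arr i.inv)
  have o : k'.base = ζ.base ≫ 𝟙 T.ctx := by
    rw [Category.comp_id]
    exact over_unique (e.imgMap_over k') (hk' ▸ over_comp_vert hk (arr_over _))
  obtain ⟨h, ⟨h₁, h₂⟩, h₃⟩ := Dial.existsUnique_desc ζ k' (𝟙 T.ctx) o
  refine ⟨e.imgMap h ≫ arr i.hom,
    ⟨over_comp_vert (h₁ ▸ e.imgMap_over h) (arr_over _), ?_⟩, ?_⟩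
  · rw [← Category.assoc, ← imgMap_comp, h₂, hk', Category.assoc, arr_inv_hom, Category.comp_id]
  · rintro g ⟨g₁, g₂⟩
    obtain ⟨g', hg'⟩ := (e.imgMap_bijective T R).2 (g ≫ arr i.inv)
    have : g' = h := by
      refine h₃ g' ⟨over_unique (e.imgMap_over g') (hg' ▸ over_comp_vert g₁ (arr_over _)), ?_⟩
      apply (e.imgMap_bijective _ _).1
      rw [imgMap_comp, hg', hk', ← Category.assoc, g₂]
    rw [← this, hg', Category.assoc, arr_inv_hom, Category.comp_id]

/-- The formal products, embedded in the Dialectica fibration, and hence in any fibration equivalent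
to it. -/
noncomputable abbrev embedding : FormalProd.Embedding c' p where
  obj K := e.img (Dial.ofProdObj K)
  map m := e.imgMap ((Dial.ofProd c').map m)
  map_id K := by
    rw [(Dial.ofProd c').map_id]
    exact e.equiv.functor.map_id _
  map_comp m n := by
    rw [(Dial.ofProd c').map_comp]
    exact e.equiv.functor.map_comp _ _
  map_over m := e.imgMap_over ((Dial.ofProd c').map m)
  map_bijective K L := (e.imgMap_bijective _ _).comp (Dial.ofProd_bijective K L)

lemma preservesCartesian_embedding : e.embedding.PreservesCartesian :=
  fun h => e.functor_cartesian _ _ (Dial.ofProd_cartesian h)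

/-- The coproduct injection of a simple coproduct is the image of a Dialectica morphism which is
invertible on formal products: two existential quantifiers are merged into one. -/
lemma exists_inj_eq (C : c.SimpleCoproducts) {J Y : B} (β : p.Fiber (J ⊗ Y)) :
    ∃ (S T : Dial c') (ζ : S ⟶ T) (i : tot (e.img S) ≅ tot β)
      (j : tot ((C.coprod J Y).obj β) ≅ tot (e.img T)), IsIso ζ.fam ∧
        C.inj β ≫ j.hom = i.inv ≫ e.imgMap ζ := by
  obtain ⟨Z, U, a, ⟨i⟩⟩ := e.exists_img_iso β
  let S : Dial c' := ⟨J ⊗ Y, Z, U, a⟩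
  let T : Dial c' := ⟨J, Y ⊗ Z, U, (c'.reindex ((α_ J Y Z).inv ▷ U)).obj a⟩
  let m : S.fam ⟶ S.fam.reindex (α_ J Y Z).inv :=
    FormalProd.liftCart (𝟙 S.fam) (α_ J Y Z).hom (by simp)
  have hm : IsIso m := by
    have := S.fam.isIso_cart (α_ J Y Z).inv
    have h : m ≫ S.fam.cart (α_ J Y Z).inv = 𝟙 _ := FormalProd.liftCart_cart ..
    refine ⟨S.fam.cart (α_ J Y Z).inv, h, ?_⟩
    rw [← cancel_mono (S.fam.cart (α_ J Y Z).inv), Category.assoc, h, Category.comp_id,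
      Category.id_comp]
  let ζ : S ⟶ T := Dial.Hom.ofFam (T := T) (fst J Y) m (by
    change (α_ J Y Z).hom ≫ fst J (Y ⊗ Z) = fst (J ⊗ Y) Z ≫ fst J Y
    simp)
  have hζ : ζ.fam = m := Dial.Hom.ofFam_fam ..
  have : IsIso ζ.fam := by rw [hζ]; exact hm
  obtain ⟨j, hj⟩ := C.exists_iso_of_existsUnique (β := β) (Y := e.img T)
    (ζ := arr i.inv ≫ e.imgMap ζ) (vert_comp_over (arr_over _) (e.imgMap_over ζ)) (by
      intro W k hk
      obtain ⟨h, ⟨h₁, h₂⟩, h₃⟩ := e.existsUnique_desc ζ W (arr i.hom ≫ k)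
        (vert_comp_over (arr_over _) hk)
      refine ⟨h, ⟨h₁, ?_⟩, ?_⟩
      · rw [Category.assoc, h₂, arr_inv_hom_assoc]
      · rintro g ⟨g₁, g₂⟩
        refine h₃ g ⟨g₁, ?_⟩
        rw [← g₂, Category.assoc, arr_hom_inv_assoc])
  exact ⟨S, T, ζ, totalIso i, totalIso j, this, hj⟩

/-- A Dialectica object without existential quantifier is `∐`-quantifier-free: arrows from it lift
uniquely along coproduct injections. -/
lemma existsUnique_lift_embedding (C : c.SimpleCoproducts) (K : FormalProd c') {J Y : B}
    (β : p.Fiber (J ⊗ Y)) (h : tot (e.embedding.obj K) ⟶ tot ((C.coprod J Y).obj β)) :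
    ∃! k : tot (e.embedding.obj K) ⟶ tot β, k ≫ C.inj β = h := by
  obtain ⟨S, T, ζ, i, j, _, hζ⟩ := e.exists_inj_eq C β
  have hζ' : C.inj β = i.inv ≫ e.imgMap ζ ≫ j.inv := by
    rw [← Category.assoc, ← hζ, Category.assoc, Iso.hom_inv_id, Category.comp_id]
  obtain ⟨h', hh'⟩ := (e.imgMap_bijective (Dial.ofProdObj K) T).2 (h ≫ j.hom)
  obtain ⟨k, hk, hu⟩ := Dial.existsUnique_lift ζ h'
  refine ⟨e.imgMap k ≫ i.hom, ?_, ?_⟩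
  · dsimp only
    rw [hζ', Category.assoc, Iso.hom_inv_id_assoc, ← Category.assoc, ← imgMap_comp, hk, hh',
      Category.assoc, Iso.hom_inv_id, Category.comp_id]
  · intro g hg
    obtain ⟨g', hg'⟩ := (e.imgMap_bijective (Dial.ofProdObj K) S).2 (g ≫ i.inv)
    have : g' = k := by
      apply hu
      apply (e.imgMap_bijective _ _).1
      rw [imgMap_comp, hg', hh', ← hg, Category.assoc, Category.assoc, hζ]
    rw [← this, hg', Category.assoc, Iso.inv_hom_id, Category.comp_id]

lemma generates_embedding (C : c.SimpleCoproducts) : e.embedding.Generates C where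
  qf K := by
    intro A f
    rw [C.witnessed_iff]
    intro X β h _
    obtain ⟨i, -⟩ := FormalProd.Embedding.PreservesCartesian.exists_iso_reindex
      e.preservesCartesian_embedding (c := c) K f
    obtain ⟨k, hk, hu⟩ := e.existsUnique_lift_embedding C (K.reindex f) β (arr i.inv ≫ h)
    refine ⟨arr i.hom ≫ k, ?_, ?_⟩
    · dsimp only at hk ⊢
      rw [Category.assoc, hk, arr_hom_inv_assoc]
    · intro g hg
      rw [← hu (arr i.inv ≫ g) (by dsimp only; rw [Category.assoc, hg]), arr_hom_inv_assoc]
  gen {I} α := by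
    obtain ⟨X, U, a, ⟨i⟩⟩ := e.exists_img_iso α
    let S : Dial c' := ⟨I, X, U, a⟩
    let η : Dial.ofProdObj S.fam ⟶ S := Dial.Hom.ofFam (fst I X) (Dial.famIso S.fam).hom rfl
    have hη : η.fam = (Dial.famIso S.fam).hom := Dial.Hom.ofFam_fam ..
    have : IsIso η.fam := by rw [hη]; infer_instance
    obtain ⟨j, -⟩ := C.exists_iso_of_existsUnique (β := e.embedding.obj S.fam) (Y := e.img S)
      (ζ := e.imgMap η) (e.imgMap_over η) (fun W k hk => e.existsUnique_desc η W k hk)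
    exact ⟨X, U, a, ⟨i.symm ≪≫ j.symm⟩⟩

end FibredEquivalence

end

section

/-! ### Products of formal products -/

namespace FormalProd

variable {B : Type u₁} [Category.{v₁} B] [CartesianMonoidalCategory B]
variable {E : Type u₂} [Category.{v₂} E] {p : E ⥤ B} {c : SplitCleavage p}

section Products

variable {J X U V : B} (a : p.Fiber ((J ⊗ X) ⊗ U)) (ψ : J ⊗ V ≅ (J ⊗ X) ⊗ U)
  (hψ : ψ.hom ≫ fst (J ⊗ X) U ≫ fst J X = fst J V)

/-- The formal product over `J` which is the product along `X` of the formal product `(J × X, U, a)`: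
the type `V` of its counterexamples is identified with `X × U`, fibrewise over `J`. -/
noncomputable abbrev prodObj (c : SplitCleavage p) : FormalProd c :=
  ⟨J, V, (c.reindex ψ.hom).obj a⟩

include hψ in
lemma prod_inv_fst : ψ.inv ≫ fst J V = fst (J ⊗ X) U ≫ fst J X := by
  rw [← hψ, Iso.inv_hom_id_assoc]

include hψ in
lemma prod_lift_whisker :
    lift (fst (J ⊗ X) U) (ψ.inv ≫ snd J V) ≫ fst J X ▷ V = ψ.inv := by
  have := prod_inv_fst ψ hψ
  ext <;> simp [this]

/-- The evaluation of a product of formal products. -/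
noncomputable def prodEv : (prodObj a ψ c).reindex (fst J X) ⟶ (⟨J ⊗ X, U, a⟩ : FormalProd c) where
  base := 𝟙 _
  bwd := ψ.inv ≫ snd J V
  arrow := c.π _ _ ≫ c.π _ _ ≫ c.π ψ.hom a
  arrow_over := over_congr
    (over_comp (c.π_over _ _) (over_comp (c.π_over _ _) (c.π_over _ _))) (by
      have := prod_lift_whisker ψ hψ
      rw [← Category.assoc]
      refine (congrArg (· ≫ ψ.hom) this).trans ?_
      simp)

lemma prodEv_app {L : B} (k : L ⟶ J ⊗ X) (v : L ⟶ U) {Z : E}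
    (z : Z ⟶ tot ((c.reindex (fst J X ▷ V)).obj ((c.reindex ψ.hom).obj a)))
    (hz : p.IsHomLift (lift k (lift k v ≫ (prodEv (c := c) a ψ hψ).bwd)) z) :
    (prodEv a ψ hψ).app k v z hz = z ≫ c.π (fst J X ▷ V) _ ≫ c.π ψ.hom a :=
  c.fill_π_assoc _ _ _ _ _ _

section

variable {M N : B} (r : M ⟶ N) (s : M ⟶ J ⊗ X) {u : N ⟶ J}

/-- The arrow `(m, u) ↦ (r(m), v)`, where the counterexample `v` is determined by `s(m)` and `u`. -/
abbrev prodCtr : M ⊗ U ⟶ N ⊗ V := lift (fst M U ≫ r) (s ▷ U ≫ ψ.inv ≫ snd J V)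

include hψ in
lemma prodCtr_whisker (h : r ≫ u = s ≫ fst J X) :
    prodCtr ψ r s ≫ u ▷ V ≫ ψ.hom = s ▷ U := by
  have h₁ := prod_inv_fst ψ hψ
  have h₂ : prodCtr ψ r s ≫ u ▷ V = s ▷ U ≫ ψ.inv := by
    ext <;> simp [h₁, h]
  rw [← Category.assoc, h₂, Category.assoc, Iso.inv_hom_id, Category.comp_id]

lemma lift_prodCtr {L : B} (k : L ⟶ M) (v : L ⟶ U) :
    lift k v ≫ prodCtr ψ r s = lift (k ≫ r) (lift (k ≫ s) v ≫ ψ.inv ≫ snd J V) := by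
  rw [prodCtr, comp_lift, lift_fst_assoc, lift_whiskerRight_assoc]

include hψ in
/-- For the projections out of a product, the identification of counterexamples is invertible. -/
lemma isIso_prodCtr (W : B) :
    IsIso (prodCtr ψ (fst J X ▷ W) (fst (J ⊗ X) W)) := by
  let q : (J ⊗ W) ⊗ V ⟶ (J ⊗ X) ⊗ U := fst J W ▷ V ≫ ψ.hom
  let t : (J ⊗ W) ⊗ V ⟶ ((J ⊗ X) ⊗ W) ⊗ U :=
    lift (lift (q ≫ fst (J ⊗ X) U) (fst (J ⊗ W) V ≫ snd J W)) (q ≫ snd (J ⊗ X) U)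
  have h₁ : prodCtr ψ (fst J X ▷ W) (fst (J ⊗ X) W) ≫ q = fst (J ⊗ X) W ▷ U :=
    prodCtr_whisker ψ hψ _ _ (whiskerRight_fst _ _)
  have h₂ : t ≫ fst (J ⊗ X) W ▷ U = q := by
    ext <;> simp [t]
  have h₃ : q ≫ fst (J ⊗ X) U ≫ fst J X = fst (J ⊗ W) V ≫ fst J W := by
    rw [Category.assoc, hψ, whiskerRight_fst]
  refine ⟨t, ?_, ?_⟩
  · rw [comp_lift, comp_lift, ← Category.assoc _ q, ← Category.assoc _ q, h₁]
    apply CartesianMonoidalCategory.hom_ext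
    · apply CartesianMonoidalCategory.hom_ext <;> simp
    · simp
  · rw [comp_lift, ← Category.assoc t (fst (J ⊗ X) W ▷ U), h₂]
    apply CartesianMonoidalCategory.hom_ext
    · apply CartesianMonoidalCategory.hom_ext
      · simpa [t] using h₃
      · simp [t]
    · simp [q]

end

variable {K : FormalProd c} {M : B} (r : M ⟶ K.ctx) (s : M ⟶ J ⊗ X) {u : K.ctx ⟶ J}

/-- The morphism `K(r) ⟶ (J × X, U, a)` corresponding to a morphism from `K` to the product. -/
noncomputable abbrev prodUncurry (h : r ≫ u = s ≫ fst J X) (F : K ⟶ prodObj a ψ c)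
    (hF : F.base = u) : K.reindex r ⟶ (⟨J ⊗ X, U, a⟩ : FormalProd c) where
  base := s
  bwd := prodCtr ψ r s ≫ F.bwd
  arrow := c.fill (lift (fst K.ctx V) F.bwd) K.pred (prodCtr ψ r s) (c.π _ _ ≫ c.π (r ▷ K.ctr) _)
    (over_congr (over_comp (c.π_over _ _) (c.π_over _ _)) (by simp)) ≫ F.arrow ≫ c.π ψ.hom a
  arrow_over := over_congr (over_comp (c.fill_over ..) (over_comp F.arrow_over (c.π_over _ _))) (by
    rw [hF]
    exact prodCtr_whisker ψ hψ r s h)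

lemma prodUncurry_app (h : r ≫ u = s ≫ fst J X) (F : K ⟶ prodObj a ψ c) (hF : F.base = u) {L : B}
    (k : L ⟶ M) (v : L ⟶ U) {Z : E} (z : Z ⟶ tot ((c.reindex (r ▷ K.ctr)).obj K.pred))
    (hz : p.IsHomLift (lift k (lift k v ≫ (prodUncurry a ψ hψ r s h F hF).bwd)) z)
    (hz' : p.IsHomLift (lift (k ≫ r) (lift (k ≫ r) (lift (k ≫ s) v ≫ ψ.inv ≫ snd J V) ≫ F.bwd))
      (z ≫ c.π (r ▷ K.ctr) _)) :
    (prodUncurry a ψ hψ r s h F hF).app k v z hz =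
      F.app (k ≫ r) (lift (k ≫ s) v ≫ ψ.inv ≫ snd J V) (z ≫ c.π (r ▷ K.ctr) _) hz' ≫
        c.π ψ.hom a := by
  have hz₁ : p.IsHomLift (lift k v ≫ lift (fst M U) (prodCtr ψ r s ≫ F.bwd)) z :=
    over_congr hz (by rw [comp_lift, lift_fst])
  have e₁ := c.comp_fill (u := lift (fst K.ctx V) F.bwd) (w := prodCtr ψ r s)
    (z := c.π (lift (fst M U) (prodCtr ψ r s ≫ F.bwd)) _ ≫ c.π (r ▷ K.ctr) K.pred)
    (over_congr (over_comp (c.π_over _ _) (c.π_over _ _)) (by simp)) (c.fill_over _ _ _ z hz₁)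
  refine (Category.assoc _ _ _).symm.trans (Eq.trans ?_ (Category.assoc _ _ _).symm)
  refine congrArg (· ≫ F.arrow ≫ c.π ψ.hom a) (e₁.trans ?_)
  exact c.fill_congr (lift_prodCtr ψ r s k v) (c.fill_π_assoc ..) _ _

/-- The explicit description of the morphism corresponding to a morphism into a product. -/
lemma comp_prodEv (h : r ≫ u = s ≫ fst J X) (F : K ⟶ prodObj a ψ c) (hF : F.base = u)
    (F' : K.reindex r ⟶ (prodObj a ψ c).reindex (fst J X)) (hs : F'.base = s)
    (hF' : F' ≫ (prodObj a ψ c).cart (fst J X) = K.cart r ≫ F) :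
    F' ≫ prodEv a ψ hψ = prodUncurry a ψ hψ r s h F hF := by
  have hc {L : B} (k : L ⟶ M) (v : L ⟶ V) :
      lift k v ≫ Hom.bwd (F' ≫ (prodObj a ψ c).cart (fst J X)) = lift k v ≫ F'.bwd :=
    (lift_bwd_comp F' ((prodObj a ψ c).cart (fst J X)) k v).trans (by rw [cart_bwd, lift_snd])
  have hb {L : B} (k : L ⟶ M) (v : L ⟶ V) : lift k v ≫ F'.bwd = lift (k ≫ r) v ≫ F.bwd := by
    have e : lift k v ≫ Hom.bwd (F' ≫ (prodObj a ψ c).cart (fst J X)) =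
        lift k v ≫ Hom.bwd (K.cart r ≫ F) :=
      congrArg (fun t : K.reindex r ⟶ prodObj a ψ c => lift k v ≫ Hom.bwd t) hF'
    refine (hc k v).symm.trans (e.trans ((lift_bwd_comp (K.cart r) F k v).trans ?_))
    rw [cart_bwd, lift_snd, cart_base]
  have hb' {L : B} (k : L ⟶ M) (v : L ⟶ U) :
      lift k (lift (k ≫ F'.base) v ≫ ψ.inv ≫ snd J V) ≫ F'.bwd =
        lift k v ≫ prodCtr ψ r s ≫ F.bwd := by
    rw [hb, ← Category.assoc (lift k v), lift_prodCtr, hs]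
  refine hom_ext ?_ ?_ ?_
  · rw [base_comp, hs]
    exact Category.comp_id s
  · intro L k v
    rw [lift_bwd_comp]
    exact hb' k v
  · intro L k v Z z hz hz'
    have h₁ : p.IsHomLift (lift k (lift k (lift (k ≫ F'.base) v ≫ ψ.inv ≫ snd J V) ≫ F'.bwd)) z :=
      over_congr hz' (by rw [hb'])
    have h₂ : p.IsHomLift (lift (k ≫ r) (lift (k ≫ r) (lift (k ≫ s) v ≫ ψ.inv ≫ snd J V) ≫ F.bwd))
        (z ≫ c.π (r ▷ K.ctr) _) := by
      refine over_congr (over_comp h₁ (c.π_over _ _)) ?_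
      rw [hb, hs]
      ext <;> simp
    refine (app_comp F' (prodEv a ψ hψ) k v z hz h₁).trans ((prodEv_app ..).trans ?_)
    refine Eq.trans ?_ (prodUncurry_app a ψ hψ r s h F hF k v z hz' h₂).symm
    rw [← Category.assoc]
    congr 1
    have h₃ : p.IsHomLift (lift k (lift k (lift (k ≫ s) v ≫ ψ.inv ≫ snd J V) ≫
        Hom.bwd (F' ≫ (prodObj a ψ c).cart (fst J X)))) z :=
      over_congr h₁ (by rw [hc, hs])
    have h₄ : p.IsHomLift (lift k (lift k (lift (k ≫ s) v ≫ ψ.inv ≫ snd J V) ≫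
        Hom.bwd (K.cart r ≫ F))) z := hF' ▸ h₃
    have e₁ := app_comp F' ((prodObj a ψ c).cart (fst J X)) k
      (lift (k ≫ s) v ≫ ψ.inv ≫ snd J V) z h₃
      (over_congr h₁ (by rw [cart_bwd, lift_snd, hs]))
    have e₂ := app_comp (K.cart r) F k (lift (k ≫ s) v ≫ ψ.inv ≫ snd J V) z h₄
      (over_congr h₁ (by rw [cart_base, cart_bwd, lift_snd, hb, hs]))
    rw [cart_app] at e₁
    have e₃ : Hom.app (F' ≫ (prodObj a ψ c).cart (fst J X)) k
        (lift (k ≫ s) v ≫ ψ.inv ≫ snd J V) z h₃ =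
      Hom.app (K.cart r ≫ F) k (lift (k ≫ s) v ≫ ψ.inv ≫ snd J V) z h₄ := by
      simp only [hF']
    refine Eq.trans ?_ ((e₁.symm.trans (e₃.trans e₂)).trans ?_)
    · refine congrArg (· ≫ c.π (fst J X ▷ V) _) (F'.app_congr _ rfl ?_ rfl _)
      rw [cart_bwd, lift_snd, hs]
      rfl
    · exact F.app_congr _ rfl rfl (cart_app ..) _

/-- The comparison between the domains of the last components of a morphism and of its transpose. -/
lemma isIso_prodFill [IsIso (prodCtr ψ r s)] (g : K.ctx ⊗ V ⟶ K.ctr)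
    (h : p.IsHomLift (prodCtr ψ r s ≫ lift (fst K.ctx V) g)
      (c.π (lift (fst M U) (prodCtr ψ r s ≫ g)) _ ≫ c.π (r ▷ K.ctr) K.pred)) :
    IsIso (c.fill (lift (fst K.ctx V) g) K.pred (prodCtr ψ r s) _ h) := by
  have h₁ := c.π_cartesian (lift (fst M U) (prodCtr ψ r s ≫ g)) ((c.reindex (r ▷ K.ctr)).obj K.pred)
  have h₂ := c.π_cartesian (r ▷ K.ctr) K.pred
  have h₃ := c.π_cartesian (lift (fst K.ctx V) g) K.pred
  have h₄ := c.fill_over (lift (fst K.ctx V) g) K.pred (prodCtr ψ r s) _ h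
  have h₅ : p.IsStronglyCartesian (prodCtr ψ r s ≫ lift (fst K.ctx V) g)
      (c.fill (lift (fst K.ctx V) g) K.pred (prodCtr ψ r s) _ h ≫
        c.π (lift (fst K.ctx V) g) K.pred) := by
    rw [c.fill_π]
    have e : prodCtr ψ r s ≫ lift (fst K.ctx V) g =
      lift (fst M U) (prodCtr ψ r s ≫ g) ≫ r ▷ K.ctr := by simp
    rw [e]
    infer_instance
  have : p.IsStronglyCartesian (prodCtr ψ r s)
      (c.fill (lift (fst K.ctx V) g) K.pred (prodCtr ψ r s) _ h) :=
    Functor.IsStronglyCartesian.of_comp p (g := lift (fst K.ctx V) g)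
      (ψ := c.π (lift (fst K.ctx V) g) K.pred)
  exact Functor.IsStronglyCartesian.isIso_of_base_isIso p (prodCtr ψ r s) _

lemma prodUncurry_injective (h : r ≫ u = s ≫ fst J X) [IsIso (prodCtr ψ r s)]
    {F G : K ⟶ prodObj a ψ c} {hF : F.base = u} {hG : G.base = u}
    (e : prodUncurry a ψ hψ r s h F hF = prodUncurry a ψ hψ r s h G hG) : F = G := by
  have e₁ : prodCtr ψ r s ≫ F.bwd = prodCtr ψ r s ≫ G.bwd := congrArg Hom.bwd e
  rw [cancel_epi] at e₁
  obtain ⟨f, g, t, ht⟩ := F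
  obtain ⟨f', g', t', ht'⟩ := G
  dsimp only at hF hG e₁
  subst hF hG e₁
  have e₂ := eq_of_heq (Hom.mk.inj e).2.2
  dsimp only at e₂
  have := isIso_prodFill (c := c) ψ r s g
    (over_congr (over_comp (c.π_over _ _) (c.π_over _ _)) (by simp))
  rw [cancel_epi] at e₂
  exact Hom.mk_congr rfl (c.π_ext _ ht ht' e₂) _ _

lemma prodUncurry_surjective (h : r ≫ u = s ≫ fst J X) [IsIso (prodCtr ψ r s)]
    (n : K.reindex r ⟶ (⟨J ⊗ X, U, a⟩ : FormalProd c)) (hn : n.base = s) :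
    ∃ (F : K ⟶ prodObj a ψ c) (hF : F.base = u), prodUncurry a ψ hψ r s h F hF = n := by
  obtain ⟨f, n₁, t, ht⟩ := n
  obtain rfl : f = s := hn
  obtain ⟨g, rfl⟩ : ∃ g : K.ctx ⊗ V ⟶ K.ctr, n₁ = prodCtr ψ r f ≫ g :=
    ⟨inv (prodCtr ψ r f) ≫ n₁, (IsIso.hom_inv_id_assoc _ _).symm⟩
  have o : p.IsHomLift (prodCtr ψ r f ≫ lift (fst K.ctx V) g)
      (c.π (lift (fst M U) (prodCtr ψ r f ≫ g)) _ ≫ c.π (r ▷ K.ctr) K.pred) :=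
    over_congr (over_comp (c.π_over _ _) (c.π_over _ _)) (by simp)
  have hω := isIso_prodFill (c := c) ψ r f g o
  have hω' := c.fill_over _ _ _ _ o
  let ω := c.fill (lift (fst K.ctx V) g) K.pred (prodCtr ψ r f) _ o
  have ho : p.IsHomLift (inv (prodCtr ψ r f)) (inv ω) := inferInstance
  have ho' : p.IsHomLift (u ▷ V ≫ ψ.hom) (inv ω ≫ t) :=
    over_congr (over_comp ho ht) (by rw [IsIso.inv_comp_eq, prodCtr_whisker ψ hψ r f h])
  refine ⟨⟨u, g, c.fill ψ.hom a (u ▷ V) (inv ω ≫ t) ho', c.fill_over ..⟩, rfl, ?_⟩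
  refine Hom.mk_congr rfl ?_ _ _
  exact (congrArg (ω ≫ ·) (c.fill_π _ _ _ _ ho')).trans (IsIso.hom_inv_id_assoc ω t)

/-- The universal property of a product of formal products, tested on a reindexing square which
need only be a pullback up to the types of counterexamples. -/
lemma existsUnique_prod (h : r ≫ u = s ≫ fst J X) [IsIso (prodCtr ψ r s)]
    (n : K.reindex r ⟶ (⟨J ⊗ X, U, a⟩ : FormalProd c)) (hn : n.base = s) :
    ∃! F : K ⟶ prodObj a ψ c, F.base = u ∧
      ∃ F' : K.reindex r ⟶ (prodObj a ψ c).reindex (fst J X), F'.base = s ∧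
        F' ≫ (prodObj a ψ c).cart (fst J X) = K.cart r ≫ F ∧ F' ≫ prodEv a ψ hψ = n := by
  obtain ⟨F, hF, e⟩ := prodUncurry_surjective a ψ hψ r s h n hn
  refine ⟨F, ⟨hF, liftCart (K.cart r ≫ F) s ?_, rfl, liftCart_cart .., ?_⟩, ?_⟩
  · rw [base_comp, cart_base, hF, h]
  · rw [comp_prodEv a ψ hψ r s h F hF _ rfl (liftCart_cart ..), e]
  · rintro G ⟨hG, G', hs, h₁, h₂⟩
    rw [comp_prodEv a ψ hψ r s h G hG G' hs h₁, ← e] at h₂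
    exact prodUncurry_injective a ψ hψ r s h h₂

end Products

end FormalProd

end

section

/-! ### Quantifiers in an existential completion of formal products -/

variable {B : Type u₁} [Category.{v₁} B] [CartesianMonoidalCategory B]
variable {E : Type u₂} [Category.{v₂} E] {p : E ⥤ B} {c : SplitCleavage p}
variable {E' : Type u₃} [Category.{v₃} E'] {p' : E' ⥤ B} {c' : SplitCleavage p'}

namespace SplitCleavage

lemma SimpleCoproducts.QuantifierFree.of_iso {C : c.SimpleCoproducts} {I : B} {α β : p.Fiber I}
    (h : C.QuantifierFree α) (i : α ≅ β) : C.QuantifierFree β := by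
  intro A f
  have w := h A f
  rw [C.witnessed_iff] at w ⊢
  intro X γ k hk
  let j := (c.reindex f).mapIso i
  obtain ⟨l, hl, hu⟩ := w X γ (arr j.hom ≫ k) (vert_comp_over (arr_over _) hk)
  refine ⟨arr j.inv ≫ l, ?_, ?_⟩
  · dsimp only
    rw [Category.assoc, hl, arr_inv_hom_assoc]
  · intro l' e
    rw [← hu (arr j.hom ≫ l') (by dsimp only; rw [Category.assoc, e]), arr_inv_hom_assoc]

/-- An object with the universal property of the product, stated for vertical arrows, is isomorphic
to the product. -/
lemma SimpleProducts.exists_iso_prod (P : c.SimpleProducts) {J X : B} {α : p.Fiber (J ⊗ X)}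
    {Q : p.Fiber J} (ε : (c.reindex (fst J X)).obj Q ⟶ α)
    (h : ∀ (Z : p.Fiber J) (x : (c.reindex (fst J X)).obj Z ⟶ α),
      ∃! g : Z ⟶ Q, (c.reindex (fst J X)).map g ≫ ε = x) :
    ∃ i : Q ≅ (P.prod J X).obj α, (c.reindex (fst J X)).map i.hom ≫ P.counit α = ε := by
  let φ : Q ⟶ (P.prod J X).obj α := P.transpose Q α ε
  have hφ : (c.reindex (fst J X)).map φ ≫ P.counit α = ε := by
    rw [← P.transpose_symm_apply, Equiv.symm_apply_apply]
  obtain ⟨g, hg, -⟩ := h _ (P.counit α)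
  refine ⟨⟨φ, g, ?_, ?_⟩, hφ⟩
  · refine (h Q ε).unique ?_ ?_
    · rw [CategoryTheory.Functor.map_comp, Category.assoc, hg, hφ]
    · rw [CategoryTheory.Functor.map_id, Category.id_comp]
  · apply (P.transpose _ _).symm.injective
    rw [P.transpose_symm_apply, P.transpose_symm_apply, CategoryTheory.Functor.map_comp,
      Category.assoc, hφ, hg, CategoryTheory.Functor.map_id, Category.id_comp]

end SplitCleavage

namespace FormalProd.Embedding

variable {H : FormalProd.Embedding c' p} {C : c.SimpleCoproducts} (P : c.SimpleProducts)

lemma Generates.enough (hG : H.Generates C) : C.Enough := by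
  intro I α
  obtain ⟨X, U, a, i⟩ := hG.gen α
  exact ⟨X, _, hG.qf _, i⟩

/-- The `∐`-quantifier-free objects are the embedded formal products: an isomorphism of a
quantifier-free object with a coproduct has a witness, along which the formal product is
reindexed. -/
lemma Generates.exists_iso_of_qf (hG : H.Generates C) (hc : H.PreservesCartesian) {I : B}
    {α : p.Fiber I} (hα : C.QuantifierFree α) :
    ∃ (U : B) (a : p'.Fiber (I ⊗ U)), Nonempty (α ≅ H.obj ⟨I, U, a⟩) := by
  obtain ⟨X, U, a, ⟨i⟩⟩ := hG.gen α
  let K : FormalProd c' := ⟨I ⊗ X, U, a⟩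
  obtain ⟨k, hk, -⟩ := hα.existsUnique_lift (H.obj K) (arr i.hom)
  obtain ⟨v, hv⟩ := exists_over α (H.obj K) k
  have hv₁ : v ≫ fst I X = 𝟙 I :=
    over_unique (over_comp hv (C.inj_over _)) (hk ▸ arr_over i.hom)
  have hcart := hc (K.cart_cartesian v)
  obtain ⟨k', ⟨o', hk'⟩, -⟩ := Functor.IsStronglyCartesian.universal_property p v
    (H.map (K.cart v)) (𝟙 I) v (Category.id_comp v).symm k
  have or : p.IsHomLift (𝟙 I) (H.map (K.cart v) ≫ C.inj (H.obj K) ≫ arr i.inv) :=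
    over_congr (over_comp (H.map_over (K.cart v)) (over_comp_vert (C.inj_over _) (arr_over i.inv)))
      hv₁
  have e : (H.map (K.cart v) ≫ C.inj (H.obj K) ≫ arr i.inv) ≫ k = H.map (K.cart v) := by
    refine ((hG.qf (K.reindex v)).existsUnique_lift (H.obj K)
      (H.map (K.cart v) ≫ C.inj (H.obj K))).unique ?_ rfl
    rw [Category.assoc, hk]
    simp
  refine ⟨U, _, ⟨fiberIso ⟨k', H.map (K.cart v) ≫ C.inj (H.obj K) ≫ arr i.inv, ?_, ?_⟩ o'⟩⟩
  · rw [← Category.assoc, hk', ← Category.assoc, hk, arr_hom_inv]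
  · refine cartesian_ext hcart (over_comp_vert or o') (tot_over _) ?_
    rw [Category.assoc, hk', Category.id_comp, e]

section Prod

variable {J X U V : B} (a : p'.Fiber ((J ⊗ X) ⊗ U)) (ψ : J ⊗ V ≅ (J ⊗ X) ⊗ U)
  (hψ : ψ.hom ≫ fst (J ⊗ X) U ≫ fst J X = fst J V)

variable (H) in
/-- The evaluation of an embedded product of formal products. -/
noncomputable abbrev prodEv : H.obj ((prodObj a ψ c').reindex (fst J X)) ⟶ H.obj ⟨J ⊗ X, U, a⟩ :=
  mkVert (X := H.obj ((prodObj a ψ c').reindex (fst J X))) (Y := H.obj ⟨J ⊗ X, U, a⟩)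
    (H.map (FormalProd.prodEv a ψ hψ)) (H.map_over (FormalProd.prodEv a ψ hψ))

/-- The universal property of an embedded product of formal products, on vertical arrows out of a
coproduct of an embedded formal product. Such arrows are tested on the coproduct injection, where
they are morphisms of formal products. -/
lemma existsUnique_prodEv_coprod (hc : H.PreservesCartesian) {W U' : B}
    (b : p'.Fiber ((J ⊗ W) ⊗ U'))
    (κ : (c.reindex (fst J X)).obj (H.obj (prodObj a ψ c')) ≅
      H.obj ((prodObj a ψ c').reindex (fst J X)))
    (hκ : arr κ.hom ≫ H.map ((prodObj a ψ c').cart (fst J X)) = c.π (fst J X) _)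
    (x : (c.reindex (fst J X)).obj ((C.coprod J W).obj (H.obj ⟨J ⊗ W, U', b⟩)) ⟶
      H.obj ⟨J ⊗ X, U, a⟩) :
    ∃! g : (C.coprod J W).obj (H.obj ⟨J ⊗ W, U', b⟩) ⟶ H.obj (prodObj a ψ c'),
      (c.reindex (fst J X)).map g ≫ κ.hom ≫ H.prodEv a ψ hψ = x := by
  let K : FormalProd c' := ⟨J ⊗ W, U', b⟩
  let r : (J ⊗ X) ⊗ W ⟶ J ⊗ W := fst J X ▷ W
  let s : (J ⊗ X) ⊗ W ⟶ J ⊗ X := fst (J ⊗ X) W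
  let Z := (C.coprod J W).obj (H.obj K)
  have hrs : r ≫ fst J W = s ≫ fst J X := whiskerRight_fst _ _
  have : IsIso (prodCtr ψ r s) := isIso_prodCtr ψ hψ W
  have hcart := hc ((prodObj a ψ c').cart_cartesian (fst J X))
  obtain ⟨i, hi⟩ := C.exists_iso_reindex (fst J X) (H.obj K)
  obtain ⟨l, hl⟩ := hc.exists_iso_reindex (c := c) K r
  have hl' : arr l.inv ≫ c.π r (H.obj K) = H.map (K.cart r) := by
    rw [← hl, arr_inv_hom_assoc]
  let ι : tot (H.obj (K.reindex r)) ⟶ tot ((c.reindex (fst J X)).obj Z) :=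
    arr l.inv ≫ C.inj _ ≫ arr i.hom
  have oι : p.IsHomLift s ι :=
    vert_comp_over (arr_over _) (over_comp_vert (C.inj_over _) (arr_over _))
  have hι : ι ≫ c.π (fst J X) Z = H.map (K.cart r) ≫ C.inj (H.obj K) := by
    rw [← hl', Category.assoc, Category.assoc, Category.assoc]
    exact congrArg (arr l.inv ≫ ·) hi
  have ι_ext {J' : B} {f : J ⊗ X ⟶ J'} {Z' : p.Fiber J'}
      {h h' : tot ((c.reindex (fst J X)).obj Z) ⟶ tot Z'} (o : p.IsHomLift f h)
      (o' : p.IsHomLift f h') (e : ι ≫ h = ι ≫ h') : h = h' := by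
    have e₁ : arr i.hom ≫ h = arr i.hom ≫ h' := by
      refine C.desc_ext (vert_comp_over (arr_over _) o) (vert_comp_over (arr_over _) o') ?_
      have := congrArg (fun t => arr l.hom ≫ t) e
      simpa [ι] using this
    have := congrArg (fun t => arr i.inv ≫ t) e₁
    simpa using this
  have ι_desc {Z' : p.Fiber (J ⊗ X)} (k : tot (H.obj (K.reindex r)) ⟶ tot Z')
      (hk : p.IsHomLift s k) :
      ∃ h : tot ((c.reindex (fst J X)).obj Z) ⟶ tot Z', p.IsHomLift (𝟙 (J ⊗ X)) h ∧ ι ≫ h = k := by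
    obtain ⟨h, ⟨h₁, h₂⟩, -⟩ := C.existsUnique_desc _ Z' (𝟙 _) (arr l.hom ≫ k)
      (over_congr (vert_comp_over (arr_over _) hk) (Category.comp_id _).symm)
    refine ⟨arr i.inv ≫ h, vert_comp_over (arr_over _) h₁, ?_⟩
    simp [ι, h₂]
  -- the condition on `g` in terms of the total category
  have hg (g : Z ⟶ H.obj (prodObj a ψ c')) :
      (c.reindex (fst J X)).map g ≫ κ.hom ≫ H.prodEv a ψ hψ = x ↔
      ∃ g' : tot ((c.reindex (fst J X)).obj Z) ⟶
          tot (H.obj ((prodObj a ψ c').reindex (fst J X))), p.IsHomLift (𝟙 (J ⊗ X)) g' ∧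
        g' ≫ H.map ((prodObj a ψ c').cart (fst J X)) = c.π (fst J X) Z ≫ arr g ∧
        g' ≫ H.map (FormalProd.prodEv a ψ hψ) = arr x := by
    have e₁ : arr ((c.reindex (fst J X)).map g ≫ κ.hom) ≫
        H.map ((prodObj a ψ c').cart (fst J X)) = c.π (fst J X) Z ≫ arr g := by
      rw [arr_comp, Category.assoc, hκ, c.arr_reindex_π]
    constructor
    · intro e
      exact ⟨arr ((c.reindex (fst J X)).map g ≫ κ.hom), arr_over _, e₁, by
        rw [← e, arr_comp, arr_comp, arr_comp, Category.assoc]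
        rfl⟩
    · rintro ⟨g', h₁, h₂, h₃⟩
      have e : g' = arr ((c.reindex (fst J X)).map g ≫ κ.hom) :=
        cartesian_ext hcart h₁ (arr_over _) (h₂.trans e₁.symm)
      apply arr_ext
      rw [← h₃, e, arr_comp, arr_comp, arr_comp, Category.assoc]
      rfl
  obtain ⟨n, hn⟩ := (H.map_bijective (K.reindex r) ⟨J ⊗ X, U, a⟩).2 (ι ≫ arr x)
  have on : n.base = s := over_unique (H.map_over n) (hn ▸ over_comp_vert oι (arr_over x))
  obtain ⟨F, ⟨hF, F', hF'₁, hF'₂, hF'₃⟩, hu⟩ := existsUnique_prod (K := K) a ψ hψ r s hrs n on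
  obtain ⟨g, ⟨og, eg⟩, -⟩ := C.existsUnique_desc (H.obj K) (H.obj (prodObj a ψ c')) (𝟙 J)
    (H.map F) (over_congr (H.map_over F) (by rw [hF, Category.comp_id]))
  refine ⟨mkVert g og, (hg _).2 ?_, ?_⟩
  · obtain ⟨g', og', eg'⟩ := ι_desc (H.map F') (hF'₁ ▸ H.map_over F')
    refine ⟨g', og', ?_, ?_⟩
    · refine ι_ext (f := fst J X) (vert_comp_over og'
        (H.map_over ((prodObj a ψ c').cart (fst J X))))
        (over_comp_vert (c.π_over _ _) (arr_over _)) ?_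
      rw [← Category.assoc, eg', ← H.map_comp, hF'₂, H.map_comp, ← Category.assoc, hι,
        Category.assoc, arr_mkVert, eg]
    · refine ι_ext (f := 𝟙 (J ⊗ X)) (vert_comp_over og' (H.map_over (FormalProd.prodEv a ψ hψ)))
        (arr_over x) ?_
      rw [← Category.assoc, eg', ← H.map_comp, hF'₃, hn]
  · intro g₂ e₂
    obtain ⟨g', og', h₁, h₂⟩ := (hg g₂).1 e₂
    obtain ⟨G, hG⟩ := (H.map_bijective K (prodObj a ψ c')).2 (C.inj (H.obj K) ≫ arr g₂)
    obtain ⟨G', hG'⟩ := (H.map_bijective _ _).2 (ι ≫ g')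
    have : G = F := by
      refine hu G ⟨?_, G', ?_, ?_, ?_⟩
      · exact over_unique (H.map_over G) (hG ▸ over_comp_vert (C.inj_over _) (arr_over _))
      · exact over_unique (H.map_over G') (hG' ▸ over_comp_vert oι og')
      · apply (H.map_bijective _ _).1
        rw [H.map_comp, H.map_comp, hG, hG', Category.assoc, h₁, ← Category.assoc, hι,
          Category.assoc]
      · apply (H.map_bijective _ _).1
        rw [H.map_comp, hG', hn, Category.assoc, h₂]
    subst this
    apply arr_ext
    refine C.desc_ext (arr_over _) og ?_
    rw [arr_mkVert, eg, hG]

/-- Embedded products of formal products are simple products. -/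
lemma Generates.exists_iso_prod (hG : H.Generates C) (hc : H.PreservesCartesian) :
    ∃ (i : H.obj (prodObj a ψ c') ≅ (P.prod J X).obj (H.obj ⟨J ⊗ X, U, a⟩))
      (κ : (c.reindex (fst J X)).obj (H.obj (prodObj a ψ c')) ≅
        H.obj ((prodObj a ψ c').reindex (fst J X))),
      arr κ.hom ≫ H.map ((prodObj a ψ c').cart (fst J X)) = c.π (fst J X) _ ∧
      arr ((c.reindex (fst J X)).map i.hom ≫ P.counit _) =
        arr κ.hom ≫ H.map (FormalProd.prodEv a ψ hψ) := by
  obtain ⟨κ, hκ⟩ := hc.exists_iso_reindex (c := c) (prodObj a ψ c') (fst J X)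
  obtain ⟨i, hi⟩ := P.exists_iso_prod (κ.hom ≫ H.prodEv a ψ hψ) (by
      intro Z x
      obtain ⟨W, U', b, ⟨j⟩⟩ := hG.gen Z
      obtain ⟨g, hg, hu⟩ := existsUnique_prodEv_coprod a ψ hψ hc b κ hκ
        ((c.reindex (fst J X)).map j.inv ≫ x)
      refine ⟨j.hom ≫ g, ?_, ?_⟩
      · dsimp only at hg ⊢
        rw [CategoryTheory.Functor.map_comp, Category.assoc, hg,
          ← CategoryTheory.Functor.map_comp_assoc, j.hom_inv_id, CategoryTheory.Functor.map_id, Category.id_comp]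
      · intro g' e
        rw [← hu (j.inv ≫ g') (by
          dsimp only at e ⊢
          rw [CategoryTheory.Functor.map_comp, Category.assoc, e]), Iso.hom_inv_id_assoc])
  exact ⟨i, κ, hκ, by rw [hi]; rfl⟩

end Prod

/-- Simple products of `∐`-quantifier-free objects are `∐`-quantifier-free. -/
lemma Generates.qf_prod (hG : H.Generates C) (hc : H.PreservesCartesian) {I X : B}
    {α : p.Fiber (I ⊗ X)} (hα : C.QuantifierFree α) : C.QuantifierFree ((P.prod I X).obj α) := by
  obtain ⟨U, a, ⟨j⟩⟩ := hG.exists_iso_of_qf hc hα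
  obtain ⟨i, -⟩ := hG.exists_iso_prod P a (α_ I X U).symm (by simp) hc
  exact (hG.qf _).of_iso (i ≪≫ (P.prod I X).mapIso j.symm)

end FormalProd.Embedding

end

section

/-! ### Simple products of quantifier-free objects -/

namespace SplitCleavage.SimpleCoproducts

variable {B : Type u₁} [Category.{v₁} B] [CartesianMonoidalCategory B]
variable {E : Type u₂} [Category.{v₂} E] {p : E ⥤ B} {c : SplitCleavage p}
variable (C : c.SimpleCoproducts)

/-- The inclusion of a fibre of the subfibration of quantifier-free objects. -/
abbrev subFunctor (I : B) : C.sub.Fiber I ⥤ p.Fiber I where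
  obj := C.subIncl
  map φ := mkVert (arr φ).hom ((C.sub_isHomLift _ _).1 (arr_over φ))

/-- The subfibration of quantifier-free objects is full. -/
def subFullyFaithful (I : B) : (C.subFunctor I).FullyFaithful where
  preimage φ := mkVert ⟨arr φ⟩ ((C.sub_isHomLift _ _).2 (arr_over φ))

lemma subFunctor_reindex {I J : B} (u : I ⟶ J) {X Y : C.sub.Fiber J} (φ : X ⟶ Y) :
    (C.subFunctor I).map ((C.subCleavage.reindex u).map φ) =
      (c.reindex u).map ((C.subFunctor J).map φ) := by
  apply c.vert_ext u
  refine Eq.trans ?_ (c.reindex_map_cart u ((C.subFunctor J).map φ)).symm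
  exact congrArg (fun t => t.hom) (C.subCleavage.reindex_map_cart u φ)

lemma subFunctor_eqToHom {I : B} {X Y : C.sub.Fiber I} (h : X = Y) :
    (C.subFunctor I).map (eqToHom h) = eqToHom (congrArg C.subIncl h) :=
  eqToHom_map (C.subFunctor I) h

/-- Reindexing commutes with the inclusion of the quantifier-free objects. -/
noncomputable def subReindex {I J : B} (u : I ⟶ J) :
    C.subFunctor J ⋙ c.reindex u ≅ C.subCleavage.reindex u ⋙ C.subFunctor I :=
  NatIso.ofComponents (fun Y => Iso.refl (c.pull u (C.subIncl Y))) (fun φ => by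
    refine (Category.comp_id _).trans (Eq.trans ?_ (Category.id_comp _).symm)
    exact (C.subFunctor_reindex u φ).symm)

variable {C}

/-- The product functor between the fibres of the quantifier-free objects, when these are stable
under simple products. -/
noncomputable abbrev subProd {P : c.SimpleProducts}
    (h : ∀ {I X : B} (α : p.Fiber (I ⊗ X)), C.QuantifierFree α →
      C.QuantifierFree ((P.prod I X).obj α)) (I X : B) :
    C.sub.Fiber (I ⊗ X) ⥤ C.sub.Fiber I where
  obj Y := C.subMk ((P.prod I X).obj (C.subIncl Y)) (h _ (C.subIncl_qf Y))
  map {Y Z} φ := (C.subFullyFaithful I).preimage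
    (X := C.subMk ((P.prod I X).obj (C.subIncl Y)) (h _ (C.subIncl_qf Y)))
    (Y := C.subMk ((P.prod I X).obj (C.subIncl Z)) (h _ (C.subIncl_qf Z)))
    ((P.prod I X).map ((C.subFunctor _).map φ))
  map_id Y := (C.subFullyFaithful I).map_injective ((P.prod I X).map_id (C.subIncl Y))
  map_comp φ ψ := (C.subFullyFaithful I).map_injective
    ((P.prod I X).map_comp ((C.subFunctor _).map φ) ((C.subFunctor _).map ψ))

variable {P : c.SimpleProducts} (h : ∀ {I X : B} (α : p.Fiber (I ⊗ X)), C.QuantifierFree α →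
      C.QuantifierFree ((P.prod I X).obj α))

/-- The product functor commutes with the inclusion of the quantifier-free objects. -/
noncomputable def subProdIso (I X : B) :
    C.subFunctor (I ⊗ X) ⋙ P.prod I X ≅ subProd h I X ⋙ C.subFunctor I :=
  NatIso.ofComponents (fun Y => Iso.refl ((P.prod I X).obj (C.subIncl Y))) (fun _ =>
    (Category.comp_id _).trans (Category.id_comp _).symm)

/-- The adjunction for the simple products of quantifier-free objects. -/
noncomputable def subAdj (I X : B) : C.subCleavage.weaken I X ⊣ subProd h I X :=
  (P.adj I X).restrictFullyFaithful (C.subFullyFaithful I) (C.subFullyFaithful (I ⊗ X))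
    (C.subReindex (fst I X)) (subProdIso h I X)

lemma subAdj_counit {I X : B} (Y : C.sub.Fiber (I ⊗ X)) :
    (C.subFunctor (I ⊗ X)).map ((subAdj h I X).counit.app Y) = P.counit (C.subIncl Y) := by
  have e := (P.adj I X).map_restrictFullyFaithful_counit_app (C.subFullyFaithful I)
    (C.subFullyFaithful (I ⊗ X)) (C.subReindex (fst I X)) (subProdIso h I X) Y
  refine e.trans ((Category.id_comp _).trans ?_)
  refine (congrArg (· ≫ P.counit (C.subIncl Y))
    ((c.reindex (fst I X)).map_id ((P.prod I X).obj (C.subIncl Y)))).trans ?_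
  exact Category.id_comp _

lemma subAdj_homEquiv {I X : B} {Z : C.sub.Fiber I} {Y : C.sub.Fiber (I ⊗ X)}
    (φ : (C.subCleavage.weaken I X).obj Z ⟶ Y) :
    (C.subFunctor I).map ((subAdj h I X).homEquiv Z Y φ) =
      (P.adj I X).homEquiv (C.subIncl Z) (C.subIncl Y) ((C.subFunctor (I ⊗ X)).map φ) := by
  apply ((P.adj I X).homEquiv (C.subIncl Z) (C.subIncl Y)).symm.injective
  refine Eq.trans ?_ (Equiv.symm_apply_apply _ _).symm
  refine (Adjunction.homEquiv_counit ..).trans ?_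
  have e : (C.subCleavage.weaken I X).map ((subAdj h I X).homEquiv Z Y φ) ≫
      (subAdj h I X).counit.app Y = φ :=
    (Adjunction.homEquiv_counit ..).symm.trans (Equiv.symm_apply_apply _ _)
  have e' := congrArg (fun t => (C.subFunctor (I ⊗ X)).map t) e
  refine Eq.trans ?_ e'
  refine Eq.trans ?_ ((C.subFunctor (I ⊗ X)).map_comp
    ((C.subCleavage.weaken I X).map ((subAdj h I X).homEquiv Z Y φ))
    ((subAdj h I X).counit.app Y)).symm
  exact congrArg₂ (· ≫ ·) (C.subFunctor_reindex _ _).symm (subAdj_counit h Y).symm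

/-- The simple products of the subfibration of quantifier-free objects, when these are stable under
the simple products of the whole fibration. -/
noncomputable abbrev subProducts : C.subCleavage.SimpleProducts where
  prod := subProd h
  adj := subAdj h
  beckChevalley {I J} f X α := by
    have hbc := P.beckChevalley f X (C.subIncl α)
    have := (C.subFullyFaithful I).faithful
    have := (C.subFullyFaithful I).full
    refine @isIso_of_reflects_iso _ _ _ _ _ _ _ (C.subFunctor I) ?_ _
    rw [subAdj_homEquiv]
    refine (congrArg (fun t => IsIso ((P.adj I X).homEquiv
      ((c.reindex f).obj ((P.prod J X).obj (C.subIncl α)))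
      ((c.reindex (f ▷ X)).obj (C.subIncl α)) t)) ?_).mpr hbc
    refine ((C.subFunctor (I ⊗ X)).map_comp _ _).trans (congrArg₂ (· ≫ ·)
      (C.subFunctor_eqToHom _) ?_)
    exact (C.subFunctor_reindex _ _).trans
      (congrArg (fun t => (c.reindex (f ▷ X)).map t) (subAdj_counit h α))

end SplitCleavage.SimpleCoproducts

end

section

namespace FormalProd

variable {B : Type u₁} [Category.{v₁} B] [CartesianMonoidalCategory B]
variable {E : Type u₂} [Category.{v₂} E] {p : E ⥤ B} {c : SplitCleavage p}

/-! ### Instances of products of formal products -/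

section Instances

variable {A X V : B} (b : p.Fiber ((A ⊗ X) ⊗ V)) (g : A ⟶ X)

variable (c) in
/-- The formal product over `A` of the formal product `(A × X, V, b)` along `X`. -/
noncomputable abbrev prodOver : FormalProd c := prodObj b (α_ A X V).symm c

lemma liftCart_app {K : B} {T : FormalProd c} {u : K ⟶ T.ctx} {R : FormalProd c}
    (h : R ⟶ T) (w : R.ctx ⟶ K) (e : h.base = w ≫ u) {L : B} (k : L ⟶ R.ctx) (v : L ⟶ T.ctr)
    {Z : E} (z : Z ⟶ tot R.pred) (hz : p.IsHomLift (lift k (lift k v ≫ h.bwd)) z) :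
    (liftCart h w e).app k v z hz ≫ c.π (u ▷ T.ctr) T.pred = h.app k v z hz := by
  refine (Category.assoc _ _ _).trans (congrArg (c.fill _ _ _ z _ ≫ ·) ?_)
  exact c.fill_π _ _ _ _ (over_congr h.arrow_over (by rw [e, comp_whiskerRight]))

variable (c) in
/-- The morphism from a product to its weakening along the section `⟨1_A, g⟩` of the projection. -/
noncomputable abbrev instSection : prodOver c b ⟶ (prodOver c b).reindex (fst A X) :=
  liftCart (𝟙 (prodOver c b)) (lift (𝟙 A) g) (lift_fst _ _).symm

variable (c) in
/-- The evaluation of a product over `A`. -/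
noncomputable abbrev prodOverEv :
    (prodOver c b).reindex (fst A X) ⟶ (⟨A ⊗ X, V, b⟩ : FormalProd c) :=
  prodEv b (α_ A X V).symm (by simp)

variable (c) in
/-- The instance at `g` of a product, as a morphism to the formal product `(A × X, V, b)`. -/
noncomputable def instTo : prodOver c b ⟶ (⟨A ⊗ X, V, b⟩ : FormalProd c) :=
  instSection c b g ≫ prodOverEv c b

@[simp]
lemma instTo_base : (instTo c b g).base = lift (𝟙 A) g := Category.comp_id _

lemma instTo_bwd {L : B} (k : L ⟶ A) (v : L ⟶ V) :
    lift k v ≫ (instTo c b g).bwd = lift (k ≫ g) v := by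
  refine (lift_bwd_comp (instSection c b g) (prodOverEv c b) k v).trans ?_
  refine Eq.trans (b := lift k (lift (k ≫ lift (𝟙 A) g) v ≫ (α_ A X V).hom ≫ snd A (X ⊗ V)) ≫
    snd A (X ⊗ V)) rfl ?_
  rw [lift_snd]
  ext <;> simp

lemma instTo_app {L : B} (k : L ⟶ A) (v : L ⟶ V) {Z : E}
    (z : Z ⟶ tot (prodOver c b).pred)
    (hz : p.IsHomLift (lift k (lift k v ≫ (instTo c b g).bwd)) z) :
    (instTo c b g).app k v z hz = z ≫ c.π (α_ A X V).inv b := by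
  have h₁ : p.IsHomLift (lift k (lift k (lift (k ≫ (instSection c b g).base) v ≫
      (prodOverEv c b).bwd) ≫ (instSection c b g).bwd)) z :=
    over_congr hz (by
      congr 1
      exact lift_bwd_comp (instSection c b g) (prodOverEv c b) k v)
  refine (app_comp (instSection c b g) (prodOverEv c b) k v z hz h₁).trans ?_
  refine (prodEv_app b (α_ A X V).symm _ _ v _
    ((instSection c b g).app_over _ _ _ h₁)).trans ?_
  refine (Category.assoc _ _ _).symm.trans (congrArg (· ≫ c.π (α_ A X V).inv b) ?_)
  exact (liftCart_app (𝟙 (prodOver c b)) (lift (𝟙 A) g) _ k _ z h₁).trans (Hom.id_app ..)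

/-- The instance at `g` of a product, as a vertical morphism. -/
noncomputable def inst : prodOver c b ⟶
    (⟨A ⊗ X, V, b⟩ : FormalProd c).reindex (lift (𝟙 A) g) :=
  liftCart (instTo c b g) (𝟙 A) (by simp)

lemma inst_bwd {L : B} (k : L ⟶ A) (v : L ⟶ V) :
    lift k v ≫ (inst (c := c) b g).bwd = lift (k ≫ g) v := instTo_bwd b g k v

lemma inst_cart : inst (c := c) b g ≫ cart ⟨A ⊗ X, V, b⟩ (lift (𝟙 A) g) = instTo c b g :=
  liftCart_cart ..

/-- On generalized elements, taking an instance does not change the arrow to `b`. -/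
lemma inst_app_π {L : B} (k : L ⟶ A) (v : L ⟶ V) {Z : E}
    (z : Z ⟶ tot (prodOver c b).pred)
    (hz : p.IsHomLift (lift k (lift k v ≫ (inst (c := c) b g).bwd)) z) :
    (inst b g).app k v z hz ≫ c.π (lift (𝟙 A) g ▷ V) b = z ≫ c.π (α_ A X V).inv b :=
  (liftCart_app ..).trans (instTo_app ..)

variable {b g} {a : p.Fiber (A ⊗ 𝟙_ B)}

lemma inst_comp_bwd
    (m : (⟨A ⊗ X, V, b⟩ : FormalProd c).reindex (lift (𝟙 A) g) ⟶ (⟨A, 𝟙_ B, a⟩ : FormalProd c))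
    {L : B} (k : L ⟶ A) (v : L ⟶ 𝟙_ B) :
    lift k v ≫ Hom.bwd (inst b g ≫ m) = lift (k ≫ g) (lift k v ≫ m.bwd) := by
  refine (lift_bwd_comp (inst b g) m k v).trans ?_
  refine (inst_bwd b g _ _).trans ?_
  have : k ≫ (inst (c := c) b g).base = k := Category.comp_id k
  rw [this]

lemma inst_comp_app
    (m : (⟨A ⊗ X, V, b⟩ : FormalProd c).reindex (lift (𝟙 A) g) ⟶ (⟨A, 𝟙_ B, a⟩ : FormalProd c))
    {L : B} (k : L ⟶ A) (v : L ⟶ 𝟙_ B) {Z : E} (z : Z ⟶ tot (prodOver c b).pred)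
    (hz : p.IsHomLift (lift k (lift k v ≫ Hom.bwd (inst b g ≫ m))) z)
    (z' : Z ⟶ tot ((c.reindex (lift (𝟙 A) g ▷ V)).obj b))
    (hz' : p.IsHomLift (lift k (lift k v ≫ m.bwd)) z')
    (e : z' ≫ c.π (lift (𝟙 A) g ▷ V) b = z ≫ c.π (α_ A X V).inv b) :
    Hom.app (inst b g ≫ m) k v z hz = m.app k v z' hz' := by
  have hk : k ≫ (inst (c := c) b g).base = k := Category.comp_id k
  have h₁ : p.IsHomLift (lift k (lift k (lift (k ≫ (inst (c := c) b g).base) v ≫ m.bwd) ≫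
      (inst (c := c) b g).bwd)) z :=
    over_congr hz (by rw [inst_comp_bwd, inst_bwd, hk])
  refine (app_comp (inst b g) m k v z hz h₁).trans ?_
  refine m.app_congr _ hk rfl ?_ _
  refine c.π_ext (lift k (lift k v ≫ m.bwd)) (over_congr ((inst b g).app_over _ _ _ h₁)
    (by rw [hk])) hz' ?_
  rw [inst_app_π, e]

/-- Two factorizations through instances agree: the first component `k ≫ g` of the counterexample in
`A × X × V` determines `g`, because the type of counterexamples of the codomain has a point. -/
lemma inst_comp_injective {g' : A ⟶ X}
    {m : (⟨A ⊗ X, V, b⟩ : FormalProd c).reindex (lift (𝟙 A) g) ⟶ (⟨A, 𝟙_ B, a⟩ : FormalProd c)}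
    {m' : (⟨A ⊗ X, V, b⟩ : FormalProd c).reindex (lift (𝟙 A) g') ⟶ (⟨A, 𝟙_ B, a⟩ : FormalProd c)}
    (e : inst b g ≫ m = inst b g' ≫ m') (hm : m.base = 𝟙 A) (hm' : m'.base = 𝟙 A) :
    (⟨g, m, hm⟩ : (g : A ⟶ X) × {m : (⟨A ⊗ X, V, b⟩ : FormalProd c).reindex (lift (𝟙 A) g) ⟶
      (⟨A, 𝟙_ B, a⟩ : FormalProd c) // m.base = 𝟙 A}) = ⟨g', m', hm'⟩ := by
  have hb {L : B} (k : L ⟶ A) (v : L ⟶ 𝟙_ B) :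
      lift (k ≫ g) (lift k v ≫ m.bwd) = lift (k ≫ g') (lift k v ≫ m'.bwd) := by
    rw [← inst_comp_bwd, ← inst_comp_bwd, e]
  obtain rfl : g = g' := by
    have := congrArg (· ≫ fst X V) (hb (𝟙 A) (toUnit A))
    simpa using this
  have hb' {L : B} (k : L ⟶ A) (v : L ⟶ 𝟙_ B) : lift k v ≫ m.bwd = lift k v ≫ m'.bwd := by
    have := congrArg (· ≫ snd X V) (hb k v)
    simpa using this
  obtain rfl : m = m' := by
    refine hom_ext (hm.trans hm'.symm) hb' ?_
    intro L k v Z z hz hz'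
    -- every generalized element of the instance comes from one of the product
    have o : p.IsHomLift (lift k (lift (k ≫ g) (lift k v ≫ m.bwd)) ≫ (α_ A X V).inv)
        (z ≫ c.π (lift (𝟙 A) g ▷ V) b) :=
      over_congr (over_comp hz (c.π_over _ _)) (by
        rw [lift_whiskerRight, comp_lift, Category.comp_id, Iso.eq_comp_inv]
        ext <;> simp)
    have o' := c.fill_over _ _ _ _ o
    have eo := c.fill_π _ _ _ _ o
    have e₁ := inst_comp_app m k v _ (over_congr o' (by rw [inst_comp_bwd])) z hz eo.symm
    have e₂ := inst_comp_app m' k v _ (over_congr o' (by rw [inst_comp_bwd, hb'])) z hz' eo.symm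
    rw [← e₁, ← e₂]
    simp only [e]
  rfl

/-- Morphisms from a product to a formal product whose type of counterexamples is terminal come
from a unique instance of the product. -/
lemma existsUnique_inst (n : prodOver c b ⟶ (⟨A, 𝟙_ B, a⟩ : FormalProd c)) (hn : n.base = 𝟙 A) :
    ∃! x : (g : A ⟶ X) × {m : (⟨A ⊗ X, V, b⟩ : FormalProd c).reindex (lift (𝟙 A) g) ⟶
      (⟨A, 𝟙_ B, a⟩ : FormalProd c) // m.base = 𝟙 A}, inst b x.1 ≫ x.2.1 = n := by
  -- the counterexample in `X × V` provided by `n` consists of the point `g` at which the product is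
  -- instantiated and of a counterexample for this instance
  let g : A ⟶ X := lift (𝟙 A) (toUnit A) ≫ n.bwd ≫ fst X V
  let bwd : A ⊗ 𝟙_ B ⟶ V := n.bwd ≫ snd X V
  have hg : lift (fst A (𝟙_ B) ≫ g) bwd = n.bwd := by
    have hs : fst A (𝟙_ B) ≫ lift (𝟙 A) (toUnit A) = 𝟙 _ := by ext; simp
    have : fst A (𝟙_ B) ≫ g = n.bwd ≫ fst X V := by rw [← Category.assoc, hs, Category.id_comp]
    rw [this]
    ext <;> simp [bwd]
  have hg' {L : B} (k : L ⟶ A) (v : L ⟶ 𝟙_ B) :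
      lift (k ≫ g) (lift k v ≫ bwd) = lift k v ≫ n.bwd := by
    rw [← hg, comp_lift, lift_fst_assoc]
  let y := c.π (lift (fst A (𝟙_ B)) bwd) ((c.reindex (lift (𝟙 A) g ▷ V)).obj b) ≫
    c.π (lift (𝟙 A) g ▷ V) b
  have hy : p.IsHomLift (lift (fst A (𝟙_ B)) n.bwd ≫ (α_ A X V).inv) y := by
    refine over_congr (over_comp (c.π_over _ _) (c.π_over _ _)) ?_
    rw [lift_whiskerRight, comp_lift, Category.comp_id, ← hg, Iso.eq_comp_inv]
    ext <;> simp
  let y' := c.fill (α_ A X V).inv b (lift (fst A (𝟙_ B)) n.bwd) y hy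
  have hy' : p.IsHomLift (lift (fst A (𝟙_ B)) n.bwd) y' := c.fill_over ..
  have hy'' : p.IsHomLift
      (lift (fst A (𝟙_ B)) (lift (fst A (𝟙_ B)) (snd A (𝟙_ B)) ≫ n.bwd)) y' :=
    over_congr hy' (by simp)
  let m : (⟨A ⊗ X, V, b⟩ : FormalProd c).reindex (lift (𝟙 A) g) ⟶ (⟨A, 𝟙_ B, a⟩ : FormalProd c) :=
    ⟨𝟙 A, bwd, n.app (fst A (𝟙_ B)) (snd A (𝟙_ B)) y' hy'',
      over_congr (n.app_over _ _ _ hy'') (by rw [hn]; simp)⟩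
  have hm : inst b g ≫ m = n := by
    refine hom_ext ((Category.id_comp (𝟙 A)).trans hn.symm) ?_ ?_
    · intro L k v
      exact (inst_comp_bwd m k v).trans (hg' k v)
    · intro L k v Z z hz hz'
      have o : p.IsHomLift (lift k (lift k v ≫ bwd) ≫ lift (𝟙 A) g ▷ V)
          (z ≫ c.π (α_ A X V).inv b) :=
        over_congr (over_comp hz' (c.π_over _ _)) (by
          rw [lift_whiskerRight, comp_lift, Category.comp_id, ← hg', Iso.comp_inv_eq]
          ext <;> simp)
      have o' := c.fill_over _ _ _ _ o
      refine (inst_comp_app m k v z hz _ o' (c.fill_π _ _ _ _ o)).trans ?_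
      have o'' : p.IsHomLift (lift k v ≫ lift (fst A (𝟙_ B)) bwd) (c.fill _ b _ _ o) :=
        over_congr o' (by rw [comp_lift, lift_fst])
      refine (n.comp_app _ _ _ hy'' (c.fill_over _ _ _ _ o'')).trans ?_
      refine n.app_congr _ (lift_fst _ _) (lift_snd _ _) ?_ _
      refine c.π_ext (lift k (lift k v ≫ n.bwd))
        (over_congr (over_comp (c.fill_over _ _ _ _ o'') hy') (by rw [comp_lift, lift_fst])) hz' ?_
      have ey : y' ≫ c.π (α_ A X V).inv b = y := c.fill_π _ _ _ _ hy
      refine (Category.assoc _ _ _).trans ((congrArg (c.fill _ _ _ _ o'' ≫ ·) ey).trans ?_)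
      exact (c.fill_π_assoc ..).trans (c.fill_π _ _ _ _ o)
  refine ⟨⟨g, m, rfl⟩, hm, ?_⟩
  rintro ⟨g₂, m₂, hm₂⟩ e₂
  exact inst_comp_injective (e₂.trans hm.symm) hm₂ rfl

end Instances

end FormalProd

end

section

/-! ### Quantifier-free objects for simple products -/

variable {B : Type u₁} [Category.{v₁} B] [CartesianMonoidalCategory B]
variable {E : Type u₂} [Category.{v₂} E] {p : E ⥤ B} {c : SplitCleavage p}
variable {E' : Type u₃} [Category.{v₃} E'] {p' : E' ⥤ B} {c' : SplitCleavage p'}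

namespace SplitCleavage.SimpleProducts

variable (P : c.SimpleProducts)

/-- The instance `∏_{π_A} β ⟶ ⟨1_A, g⟩^* β` of a product at `g`. -/
noncomputable def inst {A X : B} (β : p.Fiber (A ⊗ X)) (g : A ⟶ X) :
    (P.prod A X).obj β ⟶ (c.reindex (lift (𝟙 A) g)).obj β :=
  eqToHom (c.weaken_section g ((P.prod A X).obj β)).symm ≫
    (c.reindex (lift (𝟙 A) g)).map (P.counit β)

lemma inst_π {A X : B} (β : p.Fiber (A ⊗ X)) (g : A ⟶ X) :
    arr (P.inst β g) ≫ c.π (lift (𝟙 A) g) β = P.ev β (𝟙 A) g (𝟙 _) (tot_over _) :=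
  P.reindex_counit_section β g

lemma inst_naturality {A X : B} {β β' : p.Fiber (A ⊗ X)} (i : β ⟶ β') (g : A ⟶ X) :
    P.inst β g ≫ (c.reindex (lift (𝟙 A) g)).map i = (P.prod A X).map i ≫ P.inst β' g := by
  have h₁ : (c.reindex (fst A X)).map ((P.prod A X).map i) ≫ P.counit β' = P.counit β ≫ i :=
    (P.adj A X).counit_naturality i
  have h₂ : eqToHom (c.weaken_section g ((P.prod A X).obj β)).symm ≫
      (c.reindex (lift (𝟙 A) g)).map ((c.reindex (fst A X)).map ((P.prod A X).map i)) =
      (P.prod A X).map i ≫ eqToHom (c.weaken_section g ((P.prod A X).obj β')).symm := by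
    rw [c.reindex_map_map, c.reindex_map_congr (lift_fst (𝟙 A) g), c.reindex_map_id]
    simp
  rw [inst, inst, Category.assoc, ← CategoryTheory.Functor.map_comp, ← h₁,
    CategoryTheory.Functor.map_comp, ← Category.assoc, h₂, Category.assoc]

/-- Every vertical arrow `∏_{π_A} β ⟶ γ` comes from a unique instance of the product: the
co-witness property of `γ` with respect to a single `β`. -/
def Instantiated {A X : B} (β : p.Fiber (A ⊗ X)) (γ : p.Fiber A) : Prop :=
  Function.Bijective fun x : (g : A ⟶ X) × ((c.reindex (lift (𝟙 A) g)).obj β ⟶ γ) =>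
    P.inst β x.1 ≫ x.2

variable {P}

lemma coWitnessed_of_instantiated {A : B} {γ : p.Fiber A}
    (h : ∀ (X : B) (β : p.Fiber (A ⊗ X)), P.Instantiated β γ) : P.CoWitnessed γ := by
  intro X β k
  obtain ⟨x, hx, hu⟩ := (h X β).existsUnique k
  refine ⟨x, ?_, fun y hy => hu y ?_⟩
  · rw [← hx]
    exact Category.assoc _ _ _
  · rw [hy]
    exact Category.assoc _ _ _

lemma Instantiated.of_iso {A X : B} {β β' : p.Fiber (A ⊗ X)} {γ γ' : p.Fiber A}
    (h : P.Instantiated β' γ') (i : β ≅ β') (j : γ ≅ γ') : P.Instantiated β γ := by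
  let ε : ((g : A ⟶ X) × ((c.reindex (lift (𝟙 A) g)).obj β ⟶ γ)) ≃
      ((g : A ⟶ X) × ((c.reindex (lift (𝟙 A) g)).obj β' ⟶ γ')) :=
    Equiv.sigmaCongrRight fun g => ((c.reindex (lift (𝟙 A) g)).mapIso i).homCongr j
  let ε' : ((P.prod A X).obj β ⟶ γ) ≃ ((P.prod A X).obj β' ⟶ γ') :=
    ((P.prod A X).mapIso i).homCongr j
  have := ε'.symm.bijective.comp (Function.Bijective.comp h ε.bijective)
  unfold Instantiated
  convert this using 1
  funext ⟨g, k⟩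
  have e := P.inst_naturality i.hom g
  have e' : (c.reindex (lift (𝟙 A) g)).map i.hom ≫ (c.reindex (lift (𝟙 A) g)).map i.inv = 𝟙 _ := by
    rw [← CategoryTheory.Functor.map_comp, i.hom_inv_id, CategoryTheory.Functor.map_id]
  have e'' : ε'.symm (P.inst β' g ≫ (c.reindex (lift (𝟙 A) g)).map i.inv ≫ k ≫ j.hom) =
      P.inst β g ≫ k := by
    simp [ε', ← reassoc_of% e, reassoc_of% e']
  exact e''.symm

end SplitCleavage.SimpleProducts

open SplitCleavage SplitCleavage.SimpleCoproducts

variable {C : c.SimpleCoproducts} {P : c.SimpleProducts}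

section Restriction

variable (h : ∀ {I X : B} (α : p.Fiber (I ⊗ X)), C.QuantifierFree α →
  C.QuantifierFree ((P.prod I X).obj α))

lemma subFunctor_inst {A X : B} (β : C.sub.Fiber (A ⊗ X)) (g : A ⟶ X) :
    (C.subFunctor A).map ((subProducts h).inst β g) = P.inst (C.subIncl β) g := by
  refine ((C.subFunctor A).map_comp _ _).trans (congrArg₂ (· ≫ ·) (C.subFunctor_eqToHom _) ?_)
  exact (C.subFunctor_reindex _ _).trans
    (congrArg (fun t => (c.reindex (lift (𝟙 A) g)).map t) (subAdj_counit h β))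

lemma instantiated_subProducts {A X : B} {β : C.sub.Fiber (A ⊗ X)} {γ : C.sub.Fiber A}
    (hβ : P.Instantiated (C.subIncl β) (C.subIncl γ)) : (subProducts h).Instantiated β γ := by
  let ε : ((g : A ⟶ X) × ((C.subCleavage.reindex (lift (𝟙 A) g)).obj β ⟶ γ)) ≃
      ((g : A ⟶ X) × ((c.reindex (lift (𝟙 A) g)).obj (C.subIncl β) ⟶ C.subIncl γ)) :=
    Equiv.sigmaCongrRight fun g => (C.subFullyFaithful A).homEquiv
  let ε' : (((subProducts h).prod A X).obj β ⟶ γ) ≃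
      ((P.prod A X).obj (C.subIncl β) ⟶ C.subIncl γ) := (C.subFullyFaithful A).homEquiv
  have := ε'.symm.bijective.comp (Function.Bijective.comp hβ ε.bijective)
  unfold SimpleProducts.Instantiated
  convert this using 1
  funext ⟨g, k⟩
  refine (ε'.symm_apply_eq.2 ?_).symm
  refine (congrArg (· ≫ _) (subFunctor_inst h β g).symm).trans ?_
  exact ((C.subFunctor A).map_comp ((subProducts h).inst β g) k).symm

end Restriction

namespace FormalProd.Embedding

variable {H : FormalProd.Embedding c' p}

/-- Embedded formal products with terminal type of counterexamples have the co-witness property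
with respect to embedded formal products. -/
lemma Generates.instantiated (hG : H.Generates C) (hc : H.PreservesCartesian) {A X V : B}
    (b : p'.Fiber ((A ⊗ X) ⊗ V)) (a : p'.Fiber (A ⊗ 𝟙_ B)) :
    P.Instantiated (H.obj ⟨A ⊗ X, V, b⟩) (H.obj ⟨A, 𝟙_ B, a⟩) := by
  let T : FormalProd c' := ⟨A ⊗ X, V, b⟩
  let K : FormalProd c' := ⟨A, 𝟙_ B, a⟩
  obtain ⟨i, κ, hκ, hi⟩ := hG.exists_iso_prod P b (α_ A X V).symm (by simp) hc
  have key (g : A ⟶ X) : arr i.hom ≫ P.ev (H.obj T) (𝟙 A) g (𝟙 _) (tot_over _) =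
      H.map (instTo c' b g) := by
    let Y := prodOver c' b
    have o : p.IsHomLift (lift (𝟙 A) g ≫ fst A X) (𝟙 (tot (H.obj Y))) :=
      over_congr (tot_over _) (lift_fst _ _).symm
    have oy := c.fill_over _ _ _ _ o
    have h₁ : c.fill (fst A X) (H.obj Y) (lift (𝟙 A) g) (𝟙 _) o ≫ arr κ.hom =
        H.map (instSection c' b g) := by
      refine cartesian_ext (hc (Y.cart_cartesian (fst A X))) (over_comp_vert oy (arr_over _))
        (H.map_over (instSection c' b g)) ?_
      have e : instSection c' b g ≫ Y.cart (fst A X) = 𝟙 Y := liftCart_cart ..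
      rw [Category.assoc, hκ, c.fill_π, ← H.map_comp, e, H.map_id]
    have h₂ : c.fill (fst A X) (H.obj Y) (lift (𝟙 A) g) (𝟙 _) o ≫
        arr ((c.reindex (fst A X)).map i.hom) =
        c.fill (fst A X) _ (lift (𝟙 A) g) (arr i.hom)
          (over_congr (arr_over _) (lift_fst _ _).symm) := by
      refine (c.fill_eq _ (over_comp_vert oy (arr_over _)) ?_).symm
      rw [Category.assoc, c.arr_reindex_π, c.fill_π_assoc, Category.id_comp]
    refine (P.comp_ev _ _ _ _ _ (arr_over i.hom)).trans ?_
    refine (P.ev_congr _ (Category.id_comp _) (Category.comp_id _)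
      (j' := 𝟙 A) (arr_over i.hom)).trans ?_
    rw [SimpleProducts.ev, ← h₂, Category.assoc, ← arr_comp]
    refine (congrArg (c.fill (fst A X) (H.obj Y) (lift (𝟙 A) g) (𝟙 _) o ≫ ·) hi).trans ?_
    rw [← Category.assoc, h₁]
    exact (H.map_comp (instSection c' b g) (prodOverEv c' b)).symm
  choose l hl using fun g : A ⟶ X => hc.exists_iso_reindex (c := c) T (lift (𝟙 A) g)
  have key' (g : A ⟶ X) : arr i.hom ≫ arr (P.inst (H.obj T) g) ≫ arr (l g).hom =
      H.map (FormalProd.inst b g) := by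
    refine cartesian_ext (hc (T.cart_cartesian (lift (𝟙 A) g)))
      (over_comp_vert (arr_over _) (over_comp_vert (arr_over _) (arr_over _)))
      (H.map_over (FormalProd.inst b g)) ?_
    rw [← H.map_comp, Category.assoc, Category.assoc, hl, P.inst_π, key]
    exact congrArg H.map (inst_cart b g).symm
  unfold SimpleProducts.Instantiated
  rw [Function.bijective_iff_existsUnique]
  intro h
  obtain ⟨n, hn⟩ := (H.map_bijective (prodOver c' b) K).2 (arr i.hom ≫ arr h)
  have on : n.base = 𝟙 A :=
    over_unique (H.map_over n) (hn ▸ over_comp_vert (arr_over _) (arr_over _))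
  obtain ⟨⟨g, m, hm⟩, e, hu⟩ := existsUnique_inst n on
  have om (g : A ⟶ X) (m : T.reindex (lift (𝟙 A) g) ⟶ K) (hm : m.base = 𝟙 A) :
      p.IsHomLift (𝟙 A) (arr (l g).hom ≫ H.map m) :=
    vert_comp_over (arr_over _) (over_congr (H.map_over m) hm)
  refine ⟨⟨g, mkVert (arr (l g).hom ≫ H.map m) (om g m hm)⟩, ?_, ?_⟩
  · apply arr_ext
    have : arr i.hom ≫ arr (P.inst (H.obj T) g) ≫ arr (l g).hom ≫ H.map m = arr i.hom ≫ arr h := by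
      rw [← hn, ← e, H.map_comp, ← key']
      simp only [Category.assoc]
    have := congrArg (fun t => arr i.inv ≫ t) this
    simpa using this
  · rintro ⟨g', h'⟩ e'
    obtain ⟨m', hm'⟩ := (H.map_bijective (T.reindex (lift (𝟙 A) g')) K).2 (arr (l g').inv ≫ arr h')
    have ob : m'.base = 𝟙 A :=
      over_unique (H.map_over m') (hm' ▸ over_comp_vert (arr_over _) (arr_over _))
    have := hu ⟨g', m', ob⟩ (by
      apply (H.map_bijective _ _).1
      rw [hn, ← e']
      dsimp only
      rw [H.map_comp, ← key', hm', arr_comp, Category.assoc, Category.assoc, arr_hom_inv_assoc])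
    cases this
    congr 1
    apply arr_ext
    rw [arr_mkVert, hm', arr_hom_inv_assoc]

/-- Every embedded formal product `(I, U, a)` is the product along `U` of `(I × U, 1, a)`, whose type
of counterexamples is terminal. -/
lemma Generates.enough_subProducts (hG : H.Generates C) (hc : H.PreservesCartesian)
    (P : c.SimpleProducts) :
    (subProducts (C := C) (P := P) fun _ hα => hG.qf_prod P hc hα).Enough := by
  intro I α
  obtain ⟨U, a, ⟨j⟩⟩ := hG.exists_iso_of_qf hc (C.subIncl_qf α)
  -- `(I, U, a)` is exhibited literally as a formal product along `U`
  obtain ⟨a, rfl⟩ : ∃ a', a = (c'.reindex (ρ_ (I ⊗ U)).inv).obj a' :=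
    ⟨(c'.reindex (ρ_ (I ⊗ U)).hom).obj a, by
      rw [← c'.reindex_obj_comp, Iso.inv_hom_id, c'.reindex_obj_id]⟩
  let T : FormalProd c' := ⟨I ⊗ U, 𝟙_ B, a⟩
  refine ⟨U, C.subMk (H.obj T) (hG.qf T), ?_, ?_⟩
  · intro A f
    refine SimpleProducts.coWitnessed_of_instantiated fun X β => ?_
    obtain ⟨V, b, ⟨i⟩⟩ := hG.exists_iso_of_qf hc (C.subIncl_qf β)
    obtain ⟨k, -⟩ := hc.exists_iso_reindex (c := c) T f
    exact instantiated_subProducts _ ((hG.instantiated hc b _).of_iso i k)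
  · obtain ⟨i, -⟩ := hG.exists_iso_prod P a (ρ_ (I ⊗ U)).symm (by simp) hc
    exact ⟨(C.subFullyFaithful I).preimageIso (j ≪≫ i)⟩

lemma Generates.isGodel [MonoidalClosed B] (hG : H.Generates C) (hc : H.PreservesCartesian)
    (P : c.SimpleProducts) : IsGodel P C where
  enough := hG.enough
  stable _ hα := hG.qf_prod P hc hα
  enough_sub := ⟨_, hG.enough_subProducts hc P⟩

end FormalProd.Embedding

end

end DialecticaFib

theorem mainTheorem1 {B : Type u₁} [Category.{v₁} B] [CartesianMonoidalCategory B]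
    [MonoidalClosed B] {E : Type u₂} [Category.{v₂} E] (p : E ⥤ B)
    (c : DialecticaFib.SplitCleavage p) (P : c.SimpleProducts) (C : c.SimpleCoproducts) :
    (∃ (E' : Type u₂) (_ : Category.{v₂} E') (p' : E' ⥤ B) (c' : DialecticaFib.SplitCleavage p'),
      Nonempty (DialecticaFib.FibredEquivalence (DialecticaFib.Dial.proj c') p)) ↔
    DialecticaFib.SplitCleavage.IsGodel P C := by
  constructor
  · rintro ⟨E', _, p', c', ⟨e⟩⟩
    exact (e.generates_embedding C).isGodel e.preservesCartesian_embedding P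
  · intro h
    obtain ⟨P', hP'⟩ := h.enough_sub
    exact ⟨_, _, _, _, (DialecticaFib.SplitCleavage.generates_embeddingOfSub h.enough P'
      hP').nonempty_fibredEquivalence⟩
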